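/- Let $H=(V,A)$ be a finite directed graph with $A\neq\varnothing$ (loops and parallel arcs are allowed), and let $D\in\{0,\pm1\}^{V\times A}$ be its node-arc incidence matrix: the column of an arc has $+1$ at its tail, $-1$ at its head and zeros elsewhere, and the column of a loop is zero. Let $d\in\mathbb{Z}_{\ge 0}$, let $\mathbf{H}\in\mathbb{Z}^{d\times d}$ be nonsingular with $\Delta=|\det\mathbf{H}|\geq 1$ (for $d=0$, $\Delta=1$), let $W\in\mathbb{Z}^{d\times A}$ and $f\in\mathbb{Z}^d$. Put $$\mathcal{S}:=\operatorname{conv}\left\{y\in\mathbb{Z}_{\ge0}^A:\ Dy=0\ \text{ and }\ Wy\equiv f \pmod{\mathbf{H}\mathbb{Z}^d}\right\}\subseteq\mathbb{R}^A .$$ An extended formulation of $\mathcal{S}$ of size $\ell$ is a description $$\mathcal{S}=\{x\in\mathbb{R}^A:\ \exists\, y\in\mathbb{R}^k \text{ such that } Bx+Cy\le b\}$$ with $B\in\mathbb{R}^{\ell\times A}$, $C\in\mathbb{R}^{\ell\times k}$, $b\in\mathbb{R}^\ell$. Then $\mathcal{S}$ admits an extended formulation of size in $O\!\left(\Delta^{\Delta+1}\,|A|\,|V|^{\Delta-1}\right)$,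 with an absolute implied constant, that can be constructed in polynomial time. More precisely, there are a constant $c$, a polynomial $q$ and one algorithm which, for every input $(H,\mathbf{H},W,f)$ as above, of binary encoding length $L$, outputs integral $B,C,b$ forming an extended formulation of $\mathcal{S}$ of size at most $c\,\Delta^{\Delta+1}|A||V|^{\Delta-1}$, and which runs in time at most $q\!\left(L+\Delta^{\Delta+1}|A||V|^{\Delta-1}\right)$. In particular, for every fixed $\Delta$ the running time is polynomial in $L$. -/

import Mathlib

/-! ### A deterministic machine model with a step count (logarithmic cost) -/

/-- Data handled by programs: integers, the empty list, and pairs (`cons` also builds lists). -/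
inductive CVal where
  | int (z : ℤ)
  | nil
  | cons (x y : CVal)

/-- Encoding length: integers count with their number of binary digits. -/
def CVal.size : CVal → ℕ
  | .int z => 1 + Nat.size z.natAbs
  | .nil => 1
  | .cons x y => 1 + x.size + y.size

/-- A list of data, as iterated pairs ending in `nil`. -/
def CVal.ofList : List CVal → CVal
  | [] => .nil
  | x :: l => .cons x (CVal.ofList l)

/-- Elementary operations. The binary ones act on a pair of integers. -/
inductive COp where
  | id
  | nil
  | const (z : ℤ)
  | fst
  | snd
  | add
  | sub
  | mul
  | div
  | mod
  | le

/-- The result of an elementary operation; it is `nil` on data of the wrong shape. The comparison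
`le` answers with `1` for true and `nil` for false. -/
def COp.apply : COp → CVal → CVal
  | .id, v => v
  | .nil, _ => .nil
  | .const z, _ => .int z
  | .fst, .cons x _ => x
  | .snd, .cons _ y => y
  | .add, .cons (.int a) (.int b) => .int (a + b)
  | .sub, .cons (.int a) (.int b) => .int (a - b)
  | .mul, .cons (.int a) (.int b) => .int (a * b)
  | .div, .cons (.int a) (.int b) => .int (a / b)
  | .mod, .cons (.int a) (.int b) => .int (a % b)
  | .le, .cons (.int a) (.int b) => if a ≤ b then .int 1 else .nil
  | _, _ => .nil

/-- Programs: elementary operations, sequential composition (`seq p q` runs `p`, then `q` on its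
result), pairing of two results, branching, and while loops. A test succeeds when its result
is different from `nil`. -/
inductive CProg where
  | op (o : COp)
  | seq (p q : CProg)
  | pair (p q : CProg)
  | cond (c p q : CProg)
  | loop (c p : CProg)

/-- `p.Runs v w t`: started on `v`, the program `p` halts with result `w` after `t` steps. Every
action is charged for the encoding length of the data which it reads, copies or writes, so that
step counts agree with those of Turing machines up to a polynomial. -/
inductive CProg.Runs : CProg → CVal → CVal → ℕ → Prop where
  | op (o : COp) (v : CVal) :
      Runs (.op o) v (o.apply v) (v.size + (o.apply v).size)
  | seq {p q : CProg} {u v w : CVal} {s t : ℕ} :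
      Runs p u v s → Runs q v w t → Runs (.seq p q) u w (s + t + 1)
  | pair {p q : CProg} {v x y : CVal} {s t : ℕ} :
      Runs p v x s → Runs q v y t →
        Runs (.pair p q) v (.cons x y) (v.size + s + t + (CVal.cons x y).size)
  | cond_true {c p q : CProg} {v b w : CVal} {s t : ℕ} :
      Runs c v b s → b ≠ .nil → Runs p v w t → Runs (.cond c p q) v w (v.size + s + t + 1)
  | cond_false {c p q : CProg} {v w : CVal} {s t : ℕ} :
      Runs c v .nil s → Runs q v w t → Runs (.cond c p q) v w (v.size + s + t + 1)
  | loop_stop {c p : CProg} {v : CVal} {s : ℕ} :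
      Runs c v .nil s → Runs (.loop c p) v v (v.size + s + 1)
  | loop_step {c p : CProg} {u b v w : CVal} {s t r : ℕ} :
      Runs c u b s → b ≠ .nil → Runs p u v t → Runs (.loop c p) v w r →
        Runs (.loop c p) u w (u.size + s + t + r + 1)

/-! ### Directed graphs and circulations -/

/-- A directed graph with nodes `V` and arcs `A`; parallel arcs and loops are allowed. -/
structure ArcDigraph (V A : Type*) where
  tail : A → V
  head : A → V

/-- The node-arc incidence matrix: `1` at the tail, `-1` at the head, zero column for a loop. -/
def ArcDigraph.incidence {V A : Type*} [DecidableEq V] (G : ArcDigraph V A) : Matrix V A ℤ :=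
  fun v a => (if G.tail a = v then 1 else 0) - (if G.head a = v then 1 else 0)

/-- Nonnegative integer circulations `y` with `W y ≡ f` modulo the lattice `H ℤᵈ`. -/
def congruenceCirculations {V A ι : Type*} [DecidableEq V] [Fintype A] [Fintype ι]
    (G : ArcDigraph V A) (H : Matrix ι ι ℤ) (W : Matrix ι A ℤ) (f : ι → ℤ) : Set (A → ℤ) :=
  {y | 0 ≤ y ∧ G.incidence.mulVec y = 0 ∧ ∃ z : ι → ℤ, W.mulVec y - f = H.mulVec z}

/-- The convex hull in `ℝ^A` of these circulations. -/
def circulationHull {V A ι : Type*} [DecidableEq V] [Fintype A] [Fintype ι]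
    (G : ArcDigraph V A) (H : Matrix ι ι ℤ) (W : Matrix ι A ℤ) (f : ι → ℤ) : Set (A → ℝ) :=
  convexHull ℝ ((fun (y : A → ℤ) (a : A) => (y a : ℝ)) '' congruenceCirculations G H W f)

/-! ### Extended formulations -/

/-- `E = {x | ∃ y, B x + C y ≤ b}`. The size of the formulation is the number of its rows, that
is, the cardinality of `ρ`. -/
def IsExtendedFormulation {α ρ κ : Type*} [Fintype α] [Fintype κ] (E : Set (α → ℝ))
    (B : Matrix ρ α ℝ) (C : Matrix ρ κ ℝ) (b : ρ → ℝ) : Prop :=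
  E = {x | ∃ y : κ → ℝ, B.mulVec x + C.mulVec y ≤ b}

/-! ### Encoding of the input and of the output -/

def encodeVec {k : ℕ} (x : Fin k → ℤ) : CVal :=
  .ofList (List.ofFn fun i => .int (x i))

/-- An integer matrix as the list of its rows. -/
def encodeMatrix {k l : ℕ} (M : Matrix (Fin k) (Fin l) ℤ) : CVal :=
  .ofList (List.ofFn fun i => encodeVec (M i))

/-- A digraph as its list of nodes `0, …, n - 1` and its list of arcs `(tail, head)`. -/
def ArcDigraph.encode {n m : ℕ} (G : ArcDigraph (Fin n) (Fin m)) : CVal :=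
  .cons (encodeVec fun v : Fin n => ((v : ℕ) : ℤ))
    (.ofList (List.ofFn fun a =>
      .cons (.int ((G.tail a : ℕ) : ℤ)) (.int ((G.head a : ℕ) : ℤ))))

def encodeInput {n m d : ℕ} (G : ArcDigraph (Fin n) (Fin m)) (H : Matrix (Fin d) (Fin d) ℤ)
    (W : Matrix (Fin d) (Fin m) ℤ) (f : Fin d → ℤ) : CVal :=
  .ofList [G.encode, encodeMatrix H, encodeMatrix W, encodeVec f]

def encodeOutput {l m k : ℕ} (B : Matrix (Fin l) (Fin m) ℤ) (C : Matrix (Fin l) (Fin k) ℤ)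
    (b : Fin l → ℤ) : CVal :=
  .ofList [encodeMatrix B, encodeMatrix C, encodeVec b]

/-- `Δ^(Δ+1) |A| |V|^(Δ-1)`, used for `Δ ≥ 1` only. -/
def sizeBound (Δ m n : ℕ) : ℕ := Δ ^ (Δ + 1) * m * n ^ (Δ - 1)

/-!
The formulation is a flow polyhedron on a layered digraph.

*Labels.* Multiplying by an integer matrix `adj` with `H * adj = ±Δ • 1` turns the condition
`W y ≡ f` modulo `H ℤᵈ` into an equation in `(ℤ/Δ)ᵈ` (`latticeResidue_eq_zero_iff`). Every arc of `G`
gets a label in this group, and the labels generate a group with at most `Δ` elements, because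
residues inject into `ℤᵈ / H ℤᵈ` (`card_le_of_latticeResidue`). The circulations in question are the
nonnegative integer circulations with total label `F`.

*The layered digraph.* A nonnegative integer circulation is a sum of closed walks. By the pigeonhole
bound for the Davenport constant, fewer than `Δ` of these walks already have total label `F`
(`exists_short_sublist`). For each tuple of `K = Δ - 1` starting nodes, the digraph `layered` has a
copy with `K + 1` layers; a layer is the product of `G` with the group. A walk passes through closed
walks from the prescribed starting nodes, one per layer, records the sum of the labels in its state,
and can return to the beginning by an arc only if this sum is `F`. There are `|V| ^ K` tuples, `Δ`
layers, at most `Δ` states and `|A| + 1` arcs for each of these.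

*The hull.* The hull consists of the projections of the circulations with one unit of flow on the
return arcs (`convexHull_labelledCirculations`). On the one hand, the short list of closed walks lifts
to a closed walk through one return arc; the rest of the circulation lifts to a single layer, evenly
distributed over the states. On the other hand, a circulation of the layered digraph is a
combination of closed walks without repeated arcs, and such a walk contains at most one return arc
(`countP_isReturn_le_one`). By the potential argument of `flowProj_isCirc` and `label_flowProj`, it
projects to a circulation with label `F` if it
contains a return arc, and otherwise to one with label `0`, which is a recession direction.
The inequalities (`flowCoeff`, `arcCoeff`, `rhsCoeff`) come in groups of four per arc of the layered
digraph. Conservation of flow needs only one inequality at each node, since the sum over all nodes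
vanishes (`ArcDigraph.isCirc_of_le`).

*The algorithm.* The relation `Comp μ a b` says that one program carries `a x` to `b x` for all `x`, in
time polynomial in `μ x`. It is closed under arithmetic, branching and bounded loops, provided that
all intermediate values have polynomially many digits, so that an algorithm is given by an
expression for its result. The matrix `adj` and the determinant up to sign come from the
Faddeev–LeVerrier recursion, which needs `d` rounds with exact divisions (`faddeev_eq`) and numbers
of polynomial length (`natAbs_faddeev_le`). The group is enumerated by adjoining one label at a time
(`groupList_spec`), and the entries of the matrices are computed from tables of the ends of the arcs
of the layered digraph (`CircInstance.comp_output`).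
-/

/-! ### Programs running in polynomial time -/

/-- `h` is bounded by a polynomial in the measure `μ`. -/
def PolyBdd {α : Type} (μ h : α → ℕ) : Prop := ∃ q : Polynomial ℕ, ∀ x, h x ≤ q.eval (μ x)

namespace PolyBdd

variable {α β : Type} {μ h k : α → ℕ}

theorem mono (hk : PolyBdd μ k) (hh : ∀ x, h x ≤ k x) : PolyBdd μ h :=
  hk.imp fun _ hq x => (hh x).trans (hq x)

theorem const (μ : α → ℕ) (c : ℕ) : PolyBdd μ fun _ => c := ⟨Polynomial.C c, fun x => by simp⟩

theorem self (μ : α → ℕ) : PolyBdd μ μ := ⟨Polynomial.X, fun x => by simp⟩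

theorem add (hh : PolyBdd μ h) (hk : PolyBdd μ k) : PolyBdd μ fun x => h x + k x := by
  obtain ⟨q, hq⟩ := hh
  obtain ⟨r, hr⟩ := hk
  exact ⟨q + r, fun x => by simpa using Nat.add_le_add (hq x) (hr x)⟩

theorem mul (hh : PolyBdd μ h) (hk : PolyBdd μ k) : PolyBdd μ fun x => h x * k x := by
  obtain ⟨q, hq⟩ := hh
  obtain ⟨r, hr⟩ := hk
  exact ⟨q * r, fun x => by simpa using Nat.mul_le_mul (hq x) (hr x)⟩

theorem reindex (g : β → α) (hh : PolyBdd μ h) : PolyBdd (μ ∘ g) (h ∘ g) :=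
  hh.imp fun _ hq x => hq (g x)

end PolyBdd

/-- Input and result are no longer than the running time, since every action is charged for the
data which it reads and writes. -/
theorem CProg.Runs.size_le {p : CProg} {v w : CVal} {t : ℕ} (h : p.Runs v w t) :
    v.size ≤ t ∧ w.size ≤ t := by
  induction h <;> omega

/-- One program carries every `a x` to `b x`, in time polynomial in `μ x`. The family `a` plays the
role of an environment and `b` that of the value of an expression in this environment. Since input
and result are bounded by the running time, a polynomial bound on the sizes of `a` and `b` is part
of the notion; this makes it closed under composition. -/
def Comp {α : Type} (μ : α → ℕ) (a b : α → CVal) : Prop :=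
  ∃ (P : CProg) (t : α → ℕ), (∀ x, P.Runs (a x) (b x) (t x)) ∧ PolyBdd μ t

namespace Comp

variable {α β : Type} {μ : α → ℕ} {a b c : α → CVal}

theorem bdd_left (h : Comp μ a b) : PolyBdd μ fun x => (a x).size := by
  obtain ⟨P, t, hP, ht⟩ := h
  exact ht.mono fun x => (hP x).size_le.1

theorem bdd_right (h : Comp μ a b) : PolyBdd μ fun x => (b x).size := by
  obtain ⟨P, t, hP, ht⟩ := h
  exact ht.mono fun x => (hP x).size_le.2

theorem reindex (g : β → α) (h : Comp μ a b) : Comp (μ ∘ g) (a ∘ g) (b ∘ g) := by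
  obtain ⟨P, t, hP, ht⟩ := h
  exact ⟨P, t ∘ g, fun x => hP (g x), ht.reindex g⟩

theorem trans (h : Comp μ a b) (h' : Comp μ b c) : Comp μ a c := by
  obtain ⟨P, s, hP, hs⟩ := h
  obtain ⟨Q, t, hQ, ht⟩ := h'
  exact ⟨.seq P Q, _, fun x => .seq (hP x) (hQ x), (hs.add ht).add (.const μ 1)⟩

theorem op (o : COp) (ha : PolyBdd μ fun x => (a x).size)
    (hb : PolyBdd μ fun x => (o.apply (a x)).size) : Comp μ a fun x => o.apply (a x) :=
  ⟨.op o, _, fun x => .op o (a x), ha.add hb⟩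

theorem refl (ha : PolyBdd μ fun x => (a x).size) : Comp μ a a := op .id ha ha

theorem pair (h : Comp μ a b) (h' : Comp μ a c) : Comp μ a fun x => .cons (b x) (c x) := by
  have hs := ((PolyBdd.const μ 1).add h.bdd_right).add h'.bdd_right
  have ha := h.bdd_left
  obtain ⟨P, s, hP, hs'⟩ := h
  obtain ⟨Q, t, hQ, ht⟩ := h'
  exact ⟨.pair P Q, _, fun x => .pair (hP x) (hQ x), ((ha.add hs').add ht).add hs⟩

theorem fst (h : Comp μ a fun x => .cons (b x) (c x)) : Comp μ a b :=
  h.trans (op .fst h.bdd_right (h.bdd_right.mono fun x => by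
    simp only [COp.apply, CVal.size]; omega))

theorem snd (h : Comp μ a fun x => .cons (b x) (c x)) : Comp μ a c :=
  h.trans (op .snd h.bdd_right (h.bdd_right.mono fun x => by
    simp only [COp.apply, CVal.size]; omega))

theorem nil (ha : PolyBdd μ fun x => (a x).size) : Comp μ a fun _ => .nil :=
  op .nil ha (.const μ _)

theorem const (ha : PolyBdd μ fun x => (a x).size) (z : ℤ) : Comp μ a fun _ => .int z :=
  op (.const z) ha (.const μ _)

/-- An environment extended by a further value still computes what it computed before. -/
theorem weaken {s : α → CVal} (h : Comp μ a b) (hs : PolyBdd μ fun x => (s x).size) :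
    Comp μ (fun x => .cons (s x) (a x)) b :=
  (snd (refl (((PolyBdd.const μ 1).add hs).add h.bdd_left))).trans h

theorem head {s : α → CVal} (ha : PolyBdd μ fun x => (a x).size)
    (hs : PolyBdd μ fun x => (s x).size) : Comp μ (fun x => .cons (s x) (a x)) s :=
  fst (refl (((PolyBdd.const μ 1).add hs).add ha))

end Comp

theorem Int.size_add_le (u v : ℤ) :
    (u + v).natAbs.size ≤ u.natAbs.size + v.natAbs.size + 1 := by
  rw [Nat.size_le]
  have hu := Nat.lt_size_self u.natAbs
  have hv := Nat.lt_size_self v.natAbs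
  have h1 : 2 ^ u.natAbs.size ≤ 2 ^ (u.natAbs.size + v.natAbs.size) :=
    Nat.pow_le_pow_right (by norm_num) (by omega)
  have h2 : 2 ^ v.natAbs.size ≤ 2 ^ (u.natAbs.size + v.natAbs.size) :=
    Nat.pow_le_pow_right (by norm_num) (by omega)
  rw [pow_succ]
  omega

theorem Int.size_mul_le (u v : ℤ) :
    (u * v).natAbs.size ≤ u.natAbs.size + v.natAbs.size := by
  rw [Nat.size_le, Int.natAbs_mul, pow_add]
  exact Nat.mul_lt_mul'' (Nat.lt_size_self _) (Nat.lt_size_self _)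

namespace Comp

variable {α : Type} {μ : α → ℕ} {a b c : α → CVal} {u v : α → ℤ}

theorem bdd_int (h : Comp μ a fun x => .int (u x)) : PolyBdd μ fun x => (u x).natAbs.size :=
  h.bdd_right.mono fun x => by simp [CVal.size]

/-- Elementary operations on integers whose result has about as many digits as the arguments. -/
theorem binop {o : COp} {w : α → ℤ} (hu : Comp μ a fun x => .int (u x))
    (hv : Comp μ a fun x => .int (v x))
    (ho : ∀ x, o.apply (.cons (.int (u x)) (.int (v x))) = .int (w x))
    (hw : ∀ x, (w x).natAbs.size ≤ (u x).natAbs.size + (v x).natAbs.size + 1) :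
    Comp μ a fun x => .int (w x) := by
  have h := hu.pair hv
  have := h.trans (op o h.bdd_right (((hu.bdd_int.add hv.bdd_int).add (.const μ 2)).mono fun x => by
    rw [ho]; have := hw x; simp only [CVal.size]; omega))
  simpa only [ho] using this

theorem add (hu : Comp μ a fun x => .int (u x)) (hv : Comp μ a fun x => .int (v x)) :
    Comp μ a fun x => .int (u x + v x) :=
  binop (o := .add) hu hv (fun _ => rfl) fun _ => Int.size_add_le _ _

theorem sub (hu : Comp μ a fun x => .int (u x)) (hv : Comp μ a fun x => .int (v x)) :
    Comp μ a fun x => .int (u x - v x) :=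
  binop (o := .sub) hu hv (fun _ => rfl) fun x => by
    simpa [sub_eq_add_neg] using Int.size_add_le (u x) (-v x)

theorem mul (hu : Comp μ a fun x => .int (u x)) (hv : Comp μ a fun x => .int (v x)) :
    Comp μ a fun x => .int (u x * v x) :=
  binop (o := .mul) hu hv (fun _ => rfl) fun _ => (Int.size_mul_le _ _).trans (by omega)

theorem div (hu : Comp μ a fun x => .int (u x)) (hv : Comp μ a fun x => .int (v x)) :
    Comp μ a fun x => .int (u x / v x) :=
  binop (o := .div) hu hv (fun _ => rfl) fun x => by
    have h : (u x / v x).natAbs ≤ (u x).natAbs := by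
      zify
      exact Int.abs_ediv_le_abs (u x) (v x)
    have := Nat.size_le_size h
    omega

theorem mod (hu : Comp μ a fun x => .int (u x)) (hv : Comp μ a fun x => .int (v x)) :
    Comp μ a fun x => .int (u x % v x) :=
  binop (o := .mod) hu hv (fun _ => rfl) fun x => by
    rcases eq_or_ne (v x) 0 with h0 | h0
    · rw [h0, Int.emod_zero]
      omega
    · have h : (u x % v x).natAbs ≤ (v x).natAbs := by
        have h1 := Int.emod_nonneg (u x) h0
        have h2 := Int.emod_lt (u x) h0
        omega
      have := Nat.size_le_size h
      omega

/-- Branching on a comparison. Each branch has to work, and to be fast, only where it is taken. -/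
theorem ite (hu : Comp μ a fun x => .int (u x)) (hv : Comp μ a fun x => .int (v x))
    (hb : Comp (fun x : {x // u x ≤ v x} => μ x) (fun x => a x) (fun x => b x))
    (hc : Comp (fun x : {x // ¬ u x ≤ v x} => μ x) (fun x => a x) (fun x => c x)) :
    Comp μ a fun x => if u x ≤ v x then b x else c x := by
  have h := hu.pair hv
  have hle := h.trans (op .le h.bdd_right ((PolyBdd.const μ 2).mono fun x => by
    simp only [COp.apply]; split_ifs <;> simp [CVal.size]))
  have ha := h.bdd_left
  obtain ⟨T, r, hT, q, hr⟩ := hle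
  obtain ⟨P, s, hP, qs, hs⟩ := hb
  obtain ⟨Q, t, hQ, qt, ht⟩ := hc
  classical
  refine ⟨.cond T P Q, fun x => (a x).size + r x +
    (if hx : u x ≤ v x then s ⟨x, hx⟩ else t ⟨x, hx⟩) + 1, fun x => ?_, ?_⟩
  · have hTx := hT x
    by_cases hx : u x ≤ v x
    · simp only [hx, if_true, dif_pos]
      simp only [COp.apply, hx, if_true] at hTx
      exact .cond_true hTx (by simp) (hP ⟨x, hx⟩)
    · simp only [hx, if_false, dif_neg, not_false_eq_true]
      simp only [COp.apply, hx, if_false] at hTx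
      exact .cond_false hTx (hQ ⟨x, hx⟩)
  · refine ((ha.add ⟨q, hr⟩).add (PolyBdd.mono (k := fun x => qs.eval (μ x) + qt.eval (μ x))
      ⟨qs + qt, fun x => by simp⟩ fun x => ?_)).add (.const μ 1)
    split_ifs with hx
    · exact (hs ⟨x, hx⟩).trans (Nat.le_add_right _ _)
    · exact (ht ⟨x, hx⟩).trans (Nat.le_add_left _ _)

theorem ite' (hu : Comp μ a fun x => .int (u x)) (hv : Comp μ a fun x => .int (v x))
    (hb : Comp μ a b) (hc : Comp μ a c) : Comp μ a fun x => if u x ≤ v x then b x else c x :=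
  ite hu hv (hb.reindex Subtype.val) (hc.reindex Subtype.val)

/-- The indicator of an equation between integers. -/
theorem eqInd (hu : Comp μ a fun x => .int (u x)) (hv : Comp μ a fun x => .int (v x)) :
    Comp μ a fun x => .int (if u x = v x then 1 else 0) := by
  have ha := hu.bdd_left
  have h := ite' hu hv (ite' hv hu (const ha 1) (const ha 0)) (const ha 0)
  refine (congrArg (Comp μ a) (funext fun x => ?_)).mp h
  rcases lt_trichotomy (u x) (v x) with h | h | h
  · simp [h.le, h.ne, h.not_ge]
  · simp [h]
  · simp [h.not_ge, h.ne']

/-- A while loop running through the values `st x 0, …, st x (N x)`. The test is also evaluated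
after the last round, hence for indices up to and including `N x`, which `min` expresses for a
pair with an arbitrary natural number; the body runs for the smaller indices only. -/
theorem loop {N : α → ℕ} (hN : PolyBdd μ N) (st : α → ℕ → CVal) (test : α → ℕ → CVal)
    (ht : Comp (fun p : α × ℕ => μ p.1) (fun p => st p.1 (min p.2 (N p.1)))
      (fun p => test p.1 (min p.2 (N p.1))))
    (htest : ∀ x i, test x i ≠ .nil ↔ i < N x)
    (hb : Comp (fun p : Σ x, Fin (N x) => μ p.1) (fun p => st p.1 p.2)
      (fun p => st p.1 (p.2 + 1))) :
    Comp μ (fun x => st x 0) (fun x => st x (N x)) := by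
  obtain ⟨T, r, hT, q, hr⟩ := ht
  obtain ⟨P, s, hP, q', hs⟩ := hb
  have key : ∀ x k i, i + k = N x → ∃ t, (CProg.loop T P).Runs (st x i) (st x (N x)) t ∧
      t ≤ (k + 1) * (2 * q.eval (μ x) + q'.eval (μ x) + 1) := by
    intro x k
    induction k with
    | zero =>
      intro i hi
      have hi' : i = N x := by omega
      subst hi'
      have h := hT (x, N x)
      have h2 := hr (x, N x)
      simp only [min_self] at h h2
      have h3 : test x (N x) = .nil := by
        by_contra h'
        exact absurd ((htest x _).1 h') (lt_irrefl _)
      rw [h3] at h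
      refine ⟨(st x (N x)).size + r (x, N x) + 1, by constructor; exact h, ?_⟩
      have := h.size_le.1
      omega
    | succ k ih =>
      intro i hi
      have hi' : i < N x := by omega
      obtain ⟨t, ht, htle⟩ := ih (i + 1) (by omega)
      have h := hT (x, i)
      have h2 := hr (x, i)
      simp only [min_eq_left hi'.le] at h h2
      have h3 := hP ⟨x, ⟨i, hi'⟩⟩
      have h4 := hs ⟨x, ⟨i, hi'⟩⟩
      refine ⟨_, .loop_step h ((htest x i).2 hi') h3 ht, ?_⟩
      have := h.size_le.1
      simp only at h4
      rw [add_mul (k + 1) 1]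
      omega
  choose t ht htle using fun x => key x (N x) 0 (by omega)
  refine ⟨.loop T P, t, ht, PolyBdd.mono ?_ htle⟩
  exact (hN.add (.const μ 1)).mul
    ⟨2 * q + q' + 1, fun x => by simp⟩

end Comp

/-! ### Loops over indices, tables and sums -/

theorem Nat.size_le_self (n : ℕ) : n.size ≤ n := Nat.size_le.2 Nat.lt_two_pow_self

theorem CVal.size_int_natCast_le (n : ℕ) : (CVal.int n).size ≤ 1 + n := by
  simpa [CVal.size] using Nat.size_le_self n

theorem CVal.size_ofList_le {l : List CVal} {B : ℕ} (h : ∀ v ∈ l, v.size ≤ B) :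
    (CVal.ofList l).size ≤ 1 + l.length * (B + 1) := by
  induction l with
  | nil => simp [CVal.ofList, CVal.size]
  | cons v l ih =>
    have h1 := h v (by simp)
    have h2 := ih fun w hw => h w (by simp [hw])
    simp only [CVal.ofList, CVal.size, List.length_cons, add_mul]
    omega

theorem CVal.size_ofList_drop_le (l : List CVal) (i : ℕ) :
    (CVal.ofList (l.drop i)).size ≤ (CVal.ofList l).size := by
  induction l generalizing i with
  | nil => simp
  | cons v l ih =>
    cases i with
    | zero => simp
    | succ i =>
      have := ih i
      simp only [List.drop_succ_cons, CVal.ofList, CVal.size]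
      omega

theorem CVal.length_le_size_ofList (l : List CVal) : l.length ≤ (CVal.ofList l).size := by
  induction l with
  | nil => simp
  | cons v l ih =>
    simp only [CVal.ofList, CVal.size, List.length_cons]
    omega

theorem CVal.ofList_ne_nil (l : List CVal) : CVal.ofList l ≠ .nil ↔ 0 < l.length := by
  cases l <;> simp [CVal.ofList]

/-- The tail of an encoded list is an encoded list: a loop can consume a list from the front. -/
theorem CVal.ofList_drop {l : List CVal} {i : ℕ} (h : i < l.length) :
    CVal.ofList (l.drop i) = .cons l[i] (CVal.ofList (l.drop (i + 1))) := by
  rw [List.drop_eq_getElem_cons h, CVal.ofList]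

theorem PolyBdd.fin {α : Type} {μ N : α → ℕ} (hN : PolyBdd μ N) :
    PolyBdd (fun p : Σ x, Fin (N x) => μ p.1) fun p => (CVal.int ((p.2 : ℕ) : ℤ)).size := by
  refine ((PolyBdd.const μ 1).add hN).reindex Sigma.fst |>.mono fun p => ?_
  have := CVal.size_int_natCast_le p.2
  have := p.2.2
  simp only [Function.comp]
  omega

namespace Comp

variable {α : Type} {μ : α → ℕ} {a : α → CVal} {N : α → ℕ}

/-- The value of an expression of the surrounding environment inside a loop. -/
theorem inner {b : α → CVal} (h : Comp μ a b) (N : α → ℕ) :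
    Comp (fun p : Σ x, Fin (N x) => μ p.1) (fun p => a p.1) (fun p => b p.1) :=
  h.reindex Sigma.fst

/-- Iteration: `st x i` is the state after `i` rounds; the body finds the index `i` and the state
on top of the environment. -/
theorem iter {h : α → ℕ} (hN : PolyBdd μ N) (hn : Comp μ a fun x => .int (N x))
    (st : α → ℕ → CVal) (hh : PolyBdd μ h) (hst : ∀ x i, i ≤ N x → (st x i).size ≤ h x)
    (h0 : Comp μ a fun x => st x 0)
    (hb : Comp (fun p : Σ x, Fin (N x) => μ p.1)
      (fun p => .cons (.int (p.2 : ℕ)) (.cons (st p.1 p.2) (a p.1)))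
      (fun p => st p.1 (p.2 + 1))) :
    Comp μ a fun x => st x (N x) := by
  have ha := h0.bdd_left
  let S : α → ℕ → CVal := fun x i => .cons (.int (i : ℕ)) (.cons (st x i) (a x))
  have hS : PolyBdd (fun p : α × ℕ => μ p.1) fun p => (S p.1 (min p.2 (N p.1))).size := by
    refine PolyBdd.mono (((((PolyBdd.const μ 3).add hN).add hh).add ha).reindex Prod.fst) fun p => ?_
    have h1 := hst p.1 (min p.2 (N p.1)) (min_le_right _ _)
    have h2 := CVal.size_int_natCast_le (min p.2 (N p.1))
    have h3 := min_le_right p.2 (N p.1)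
    simp only [S, CVal.size, Function.comp] at h2 ⊢
    omega
  have hS' : PolyBdd (fun p : Σ x, Fin (N x) => μ p.1) fun p => (S p.1 p.2).size := by
    refine (hS.reindex fun p : Σ x, Fin (N x) => (p.1, (p.2 : ℕ))).mono fun p => ?_
    simp
  have hrefl := Comp.refl hS
  have htest := (hrefl.fst.add (const hS 1))
  have hnn : Comp (fun p : α × ℕ => μ p.1) (fun p => S p.1 (min p.2 (N p.1)))
      (fun p => .int (N p.1)) := hrefl.snd.snd.trans (hn.reindex Prod.fst)
  have hp := htest.pair hnn
  have hle := hp.trans (op .le hp.bdd_right ((PolyBdd.const _ 2).mono fun x => by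
    simp only [COp.apply]; split_ifs <;> simp [CVal.size]))
  have hr := Comp.refl hS'
  have hbody := (hr.fst.add (const hS' 1)).pair (hb.pair hr.snd.snd)
  have hl := loop hN S (fun x i => COp.apply .le (.cons (.int ((i : ℤ) + 1)) (.int (N x))))
    hle (fun x i => by
      simp only [COp.apply]
      split_ifs <;> simp <;> omega)
    ((congrArg (Comp _ _) (funext fun p => by simp [S])).mp hbody)
  have hin : Comp μ a fun x => S x 0 :=
    (congrArg (Comp _ _) (funext fun p => by simp [S])).mp
      ((const ha ((0 : ℕ) : ℤ)).pair (h0.pair (.refl ha)))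
  exact (hin.trans hl).snd.fst

/-- The table of the values of the body. Lists grow at the front, so the loop computes the entries
in descending order of their indices. -/
theorem tab (hN : PolyBdd μ N) (hn : Comp μ a fun x => .int (N x)) {b : ∀ x, Fin (N x) → CVal}
    (hb : Comp (fun p : Σ x, Fin (N x) => μ p.1) (fun p => .cons (.int (p.2 : ℕ)) (a p.1))
      (fun p => b p.1 p.2)) :
    Comp μ a fun x => .ofList (List.ofFn (b x)) := by
  have ha := hn.bdd_left
  obtain ⟨q, hq⟩ := hb.bdd_right
  have hsize : ∀ x, (CVal.ofList (List.ofFn (b x))).size ≤ 1 + N x * (q.eval (μ x) + 1) := by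
    intro x
    refine (CVal.size_ofList_le (B := q.eval (μ x)) ?_).trans (by simp)
    intro v hv
    obtain ⟨i, rfl⟩ := List.mem_ofFn.1 hv
    exact hq ⟨x, i⟩
  have hbd : PolyBdd μ fun x => 1 + N x * (q.eval (μ x) + 1) :=
    (PolyBdd.const μ 1).add (hN.mul (PolyBdd.add ⟨q, fun _ => le_rfl⟩ (.const μ 1)))
  let st : α → ℕ → CVal := fun x i => .ofList ((List.ofFn (b x)).drop (N x - i))
  have hst : ∀ x i, (st x i).size ≤ 1 + N x * (q.eval (μ x) + 1) := fun x i =>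
    (CVal.size_ofList_drop_le _ _).trans (hsize x)
  have hE : PolyBdd (fun p : Σ x, Fin (N x) => μ p.1)
      fun p => (CVal.cons (st p.1 p.2) (a p.1)).size :=
    (((((PolyBdd.const μ 1).add hbd).add ha).reindex Sigma.fst)).mono fun p => by
      simpa [CVal.size] using hst p.1 p.2
  have hi := head hE hN.fin
  have hstp := (head (ha.reindex Sigma.fst : PolyBdd (fun p : Σ x, Fin (N x) => μ p.1) _)
    ((hbd.reindex Sigma.fst).mono fun p => hst p.1 p.2)).weaken hN.fin
  have hout := ((Comp.refl ha).inner N).weaken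
    ((hbd.reindex Sigma.fst).mono fun p => hst p.1 p.2) |>.weaken hN.fin
  have hrev := ((hout.trans (hn.inner N)).sub (hi.add (const hi.bdd_left 1))).pair hout
  have hb' := hb.reindex fun p : Σ x, Fin (N x) => ⟨p.1, p.2.rev⟩
  have hbody := (hrev.trans ((congrArg (Comp _ · _) (funext fun p => by
    have := p.2.2
    simp only [Function.comp, Fin.val_rev]
    congr 2
    omega)).mp hb')).pair hstp
  have h := iter hN hn st hbd (fun x i _ => hst x i)
    ((congrArg (Comp _ _) (funext fun x => by
      simp only [st]
      rw [Nat.sub_zero, List.drop_eq_nil_of_le (by simp), CVal.ofList])).mp (nil ha))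
    ((congrArg (Comp _ _) (funext fun p => by
      have := p.2.2
      simp only [st, Function.comp]
      rw [show N p.1 - (p.2 : ℕ) = N p.1 - (p.2 + 1) + 1 by omega,
        CVal.ofList_drop (i := N p.1 - (p.2 + 1)) (by simp; omega)]
      congr 1
      simp [Fin.rev])).mp hbody)
  simpa [st] using h

/-- The sum of the values of the body. -/
theorem sum (hN : PolyBdd μ N) (hn : Comp μ a fun x => .int (N x)) {b : ∀ x, Fin (N x) → ℤ}
    (hb : Comp (fun p : Σ x, Fin (N x) => μ p.1) (fun p => .cons (.int (p.2 : ℕ)) (a p.1))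
      (fun p => .int (b p.1 p.2))) :
    Comp μ a fun x => .int (∑ i, b x i) := by
  have ha := hn.bdd_left
  obtain ⟨q, hq⟩ := hb.bdd_int
  let b' : α → ℕ → ℤ := fun x i => if h : i < N x then b x ⟨i, h⟩ else 0
  let st : α → ℕ → CVal := fun x i => .int (∑ j ∈ Finset.range i, b' x j)
  have hst : ∀ x i, i ≤ N x → (st x i).size ≤ 1 + (N x + q.eval (μ x)) := by
    intro x i hi
    simp only [st, CVal.size, Nat.add_le_add_iff_left]
    rw [Nat.size_le]
    have h1 : (∑ j ∈ Finset.range i, b' x j).natAbs ≤ i * 2 ^ q.eval (μ x) := by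
      refine (Int.natAbs_sum_le _ _).trans ?_
      refine (Finset.sum_le_card_nsmul _ _ (2 ^ q.eval (μ x)) fun j hj => ?_).trans (by simp)
      have hj' : j < N x := lt_of_lt_of_le (Finset.mem_range.1 hj) hi
      simp only [b', hj', dif_pos]
      exact ((Nat.lt_size_self _).le.trans (Nat.pow_le_pow_right (by norm_num) (hq ⟨x, ⟨j, hj'⟩⟩)))
    refine h1.trans_lt ?_
    rw [pow_add]
    exact Nat.mul_lt_mul_of_pos_right (hi.trans_lt Nat.lt_two_pow_self) (by positivity)
  have hbd : PolyBdd μ fun x => 1 + (N x + q.eval (μ x)) :=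
    (PolyBdd.const μ 1).add (hN.add ⟨q, fun _ => le_rfl⟩)
  have hstb : PolyBdd (fun p : Σ x, Fin (N x) => μ p.1) fun p => (st p.1 p.2).size :=
    (hbd.reindex Sigma.fst).mono fun p => hst p.1 p.2 p.2.2.le
  have hs1 := head (ha.reindex Sigma.fst : PolyBdd (fun p : Σ x, Fin (N x) => μ p.1) _) hstb
  have hi := head hs1.bdd_left hN.fin
  have hout := (((Comp.refl ha).inner N).weaken hstb).weaken hN.fin
  have hbody := (hs1.weaken hN.fin).add ((hi.pair hout).trans hb)
  have h := iter hN hn st hbd hst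
    ((congrArg (Comp _ _) (funext fun x => by simp [st])).mp (const ha 0))
    ((congrArg (Comp _ _) (funext fun p => by
      simp [st, Finset.sum_range_succ, b'])).mp hbody)
  refine (congrArg (Comp _ _) (funext fun x => ?_)).mp h
  simp only [st]
  rw [Finset.sum_range]
  simp [b']

/-- Access to a list by index: the loop drops the entries in front. -/
theorem getElem {l : α → List CVal} (hl : Comp μ a fun x => .ofList (l x)) {k : α → ℕ}
    (hk : Comp μ a fun x => .int (k x)) (hlt : ∀ x, k x < (l x).length) :
    Comp μ a fun x => (l x)[k x]'(hlt x) := by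
  have hkb : PolyBdd μ k := hl.bdd_right.mono fun x =>
    (hlt x).le.trans (CVal.length_le_size_ofList _)
  have ha := hl.bdd_left
  let st : α → ℕ → CVal := fun x i => .ofList ((l x).drop i)
  have hst : ∀ x i, (st x i).size ≤ (CVal.ofList (l x)).size := fun x i =>
    CVal.size_ofList_drop_le _ _
  have hs1 := head (ha.reindex Sigma.fst : PolyBdd (fun p : Σ x, Fin (k x) => μ p.1) _)
    ((hl.bdd_right.reindex Sigma.fst).mono fun p => hst p.1 p.2)
  have hs2 := hs1.weaken hkb.fin
  have h := iter hkb hk st hl.bdd_right (fun x i _ => hst x i) hl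
    (((congrArg (Comp _ _) (funext fun p => by
      simp only [st]
      exact CVal.ofList_drop (p.2.2.trans (hlt p.1)))).mp hs2).snd)
  exact ((congrArg (Comp _ _) (funext fun x => CVal.ofList_drop (hlt x))).mp h).fst

theorem get {b : ∀ x, Fin (N x) → CVal} (hl : Comp μ a fun x => .ofList (List.ofFn (b x)))
    {k : ∀ x, Fin (N x)} (hk : Comp μ a fun x => .int (k x : ℕ)) :
    Comp μ a fun x => b x (k x) := by
  have h := hl.getElem hk fun x => by simp
  simpa using h

/-- The length of a list: the loop drops entries, and counts them, until the list is `nil`. -/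
theorem length {l : α → List CVal} (hl : Comp μ a fun x => .ofList (l x)) :
    Comp μ a fun x => .int ((l x).length : ℕ) := by
  have ha := hl.bdd_left
  have hN : PolyBdd μ fun x => (l x).length :=
    hl.bdd_right.mono fun x => CVal.length_le_size_ofList _
  let st : α → ℕ → CVal := fun x i => .cons (.int (i : ℕ)) (.ofList ((l x).drop i))
  have hst : ∀ x i, i ≤ (l x).length →
      (st x i).size ≤ 2 + (l x).length + (CVal.ofList (l x)).size := by
    intro x i hi
    have h1 := CVal.size_ofList_drop_le (l x) i
    have h2 := CVal.size_int_natCast_le i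
    simp only [st]
    rw [CVal.size]
    omega
  have hbd := ((PolyBdd.const μ 2).add hN).add hl.bdd_right
  have h1 : PolyBdd (fun p : α × ℕ => μ p.1)
      fun p => (st p.1 (min p.2 (l p.1).length)).size :=
    (hbd.reindex Prod.fst).mono fun p => hst _ _ (min_le_right _ _)
  have h2 : PolyBdd (fun p : Σ x, Fin (l x).length => μ p.1) fun p => (st p.1 p.2).size :=
    (hbd.reindex Sigma.fst).mono fun p => hst _ _ p.2.2.le
  have hr := Comp.refl h2
  have h := loop hN st (fun x i => .ofList ((l x).drop i)) (Comp.refl h1).snd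
    (fun x i => by rw [CVal.ofList_ne_nil]; simp)
    ((congrArg (Comp _ _) (funext fun p => by simp [st])).mp
      ((hr.fst.add (const h2 1)).pair
        ((congrArg (Comp _ _) (funext fun p => CVal.ofList_drop p.2.2)).mp hr.snd).snd))
  have h0 : Comp μ a fun x => st x 0 := by
    simpa [st] using (const ha ((0 : ℕ) : ℤ)).pair hl
  exact (h0.trans h).fst

theorem length_ofFn {b : ∀ x, Fin (N x) → CVal}
    (hl : Comp μ a fun x => .ofList (List.ofFn (b x))) : Comp μ a fun x => .int (N x) := by
  simpa using hl.length

theorem pow {u : α → ℤ} (hu : Comp μ a fun x => .int (u x)) (hN : PolyBdd μ N)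
    (hn : Comp μ a fun x => .int (N x)) : Comp μ a fun x => .int (u x ^ N x) := by
  have ha := hu.bdd_left
  have hbd := ((PolyBdd.const μ 2).add (hN.mul hu.bdd_int))
  let st : α → ℕ → CVal := fun x i => .int (u x ^ i)
  have hst : ∀ x i, i ≤ N x → (st x i).size ≤ 2 + N x * (u x).natAbs.size := by
    intro x i hi
    have : ∀ j, (u x ^ j).natAbs.size ≤ 1 + j * (u x).natAbs.size := by
      intro j
      induction j with
      | zero => simp
      | succ j ih =>
        rw [pow_succ, add_mul]
        have := Int.size_mul_le (u x ^ j) (u x)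
        omega
    have h1 := this i
    have h2 := Nat.mul_le_mul_right (u x).natAbs.size hi
    simp only [st, CVal.size]
    omega
  have hstb : PolyBdd (fun p : Σ x, Fin (N x) => μ p.1) fun p => (st p.1 p.2).size :=
    (hbd.reindex Sigma.fst).mono fun p => hst p.1 p.2 p.2.2.le
  have hs1 := head (ha.reindex Sigma.fst : PolyBdd (fun p : Σ x, Fin (N x) => μ p.1) _) hstb
  have hout := ((hu.inner N).weaken hstb).weaken hN.fin
  exact iter hN hn st hbd hst
    ((congrArg (Comp _ _) (funext fun x => by simp [st])).mp (const ha 1))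
    ((congrArg (Comp _ _) (funext fun p => by
      simp [st, pow_succ])).mp ((hs1.weaken hN.fin).mul hout))

end Comp

/-! ### The Faddeev–LeVerrier recursion and the index of a lattice -/

open Polynomial in
/-- The derivative of a determinant, by the product rule in each term of the Leibniz formula. -/
theorem Matrix.derivative_det {n R : Type*} [Fintype n] [DecidableEq n] [CommRing R]
    (M : Matrix n n R[X]) :
    derivative M.det = ∑ i, (M.updateCol i fun j => derivative (M j i)).det := by
  simp only [Matrix.det_apply', derivative_sum]
  rw [Finset.sum_comm]
  refine Finset.sum_congr rfl fun σ _ => ?_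
  rw [derivative_mul, derivative_intCast, zero_mul, zero_add, derivative_prod_finset,
    Finset.mul_sum]
  refine Finset.sum_congr rfl fun i _ => ?_
  rw [← Finset.prod_erase_mul _ _ (Finset.mem_univ i)]
  congr 2
  · refine Finset.prod_congr rfl fun j hj => ?_
    rw [Matrix.updateCol_ne (Finset.ne_of_mem_erase hj)]
  · simp

open Polynomial in
/-- Jacobi's formula for the matrix `X - A`. -/
theorem Matrix.derivative_charpoly {n R : Type*} [Fintype n] [DecidableEq n] [CommRing R]
    (A : Matrix n n R) : derivative A.charpoly = A.charmatrix.adjugate.trace := by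
  rw [Matrix.charpoly, Matrix.derivative_det, Matrix.trace]
  refine Finset.sum_congr rfl fun i _ => ?_
  have h : (fun j => derivative (A.charmatrix j i)) = Pi.single i 1 := by
    ext1 j
    by_cases h : j = i
    · subst h
      simp
    · simp [h]
  rw [h, ← Matrix.cramer_apply, Matrix.cramer_eq_adjugate_mulVec]
  simp

section Adjugate

open Polynomial

variable {n R : Type*} [Fintype n] [DecidableEq n] [CommRing R] (A : Matrix n n R)

/-- The matrix of the coefficients of `X ^ k` in the adjugate of `X - A`. -/
noncomputable def adjCoeff (k : ℕ) : Matrix n n R :=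
  .of fun i j => (A.charmatrix.adjugate i j).coeff k

/-- The entries of `(X - A) * adjugate (X - A) = charpoly A • 1`. -/
theorem charmatrix_mul_adjugate_apply (i j : n) :
    X * A.charmatrix.adjugate i j - ∑ l, C (A i l) * A.charmatrix.adjugate l j =
      if i = j then A.charpoly else 0 := by
  have h := congrFun (congrFun A.charmatrix.mul_adjugate i) j
  generalize hB : A.charmatrix.adjugate = B at h ⊢
  rw [Matrix.charmatrix, sub_mul, Matrix.sub_apply, Matrix.scalar_apply, Matrix.diagonal_mul,
    Matrix.mul_apply] at h
  simp only [RingHom.mapMatrix_apply, Matrix.map_apply] at h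
  rw [h]
  simp [Matrix.one_apply, Matrix.charpoly, Matrix.charmatrix]

/-- The recursion compares the coefficients of `X ^ (k + 1)` in
`(X - A) * adjugate (X - A) = charpoly A • 1`. -/
theorem adjCoeff_eq (k : ℕ) :
    adjCoeff A k = A * adjCoeff A (k + 1) + A.charpoly.coeff (k + 1) • 1 := by
  ext i j
  have hij := congrArg (fun p => Polynomial.coeff p (k + 1)) (charmatrix_mul_adjugate_apply A i j)
  simp only [coeff_sub, coeff_X_mul, finsetSum_coeff, coeff_C_mul] at hij
  simp only [adjCoeff, Matrix.of_apply, Matrix.add_apply, Matrix.mul_apply, Matrix.smul_apply,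
    smul_eq_mul, Matrix.one_apply, mul_ite, mul_one, mul_zero]
  rw [sub_eq_iff_eq_add] at hij
  rw [hij, add_comm]
  congr 1
  split_ifs <;> simp

theorem mul_adjCoeff_zero : A * adjCoeff A 0 = -(A.charpoly.coeff 0 • 1) := by
  ext i j
  have hij := congrArg (fun p => Polynomial.coeff p 0) (charmatrix_mul_adjugate_apply A i j)
  simp only [coeff_sub, coeff_X_mul_zero, finsetSum_coeff, coeff_C_mul, zero_sub] at hij
  simp only [adjCoeff, Matrix.of_apply, Matrix.neg_apply, Matrix.mul_apply, Matrix.smul_apply,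
    smul_eq_mul, Matrix.one_apply, mul_ite, mul_one, mul_zero]
  rw [← neg_eq_iff_eq_neg, hij]
  split_ifs <;> simp

/-- The adjugate of `X - A` has degree less than the dimension: the coefficients vanish for large
`k`, and the recursion carries this down to the dimension. -/
theorem adjCoeff_eq_zero [Nontrivial R] {k : ℕ} (hk : Fintype.card n ≤ k) : adjCoeff A k = 0 := by
  have hK : ∃ K, ∀ k, K ≤ k → adjCoeff A k = 0 := by
    refine ⟨(Finset.univ.sup fun i => Finset.univ.sup fun j =>
      (A.charmatrix.adjugate i j).natDegree) + 1, fun k hk => ?_⟩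
    ext i j
    refine Polynomial.coeff_eq_zero_of_natDegree_lt (lt_of_le_of_lt ?_ (Nat.lt_of_succ_le hk))
    exact (Finset.le_sup (f := fun j => (A.charmatrix.adjugate i j).natDegree)
      (Finset.mem_univ j)).trans (Finset.le_sup (f := fun i => Finset.univ.sup fun j =>
        (A.charmatrix.adjugate i j).natDegree) (Finset.mem_univ i))
  obtain ⟨K, hK⟩ := hK
  have key : ∀ j, Fintype.card n ≤ K - j → adjCoeff A (K - j) = 0 := by
    intro j
    induction j with
    | zero => exact fun _ => hK _ le_rfl
    | succ j ih =>
      intro hj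
      rcases le_or_gt K j with h | h
      · rw [show K - (j + 1) = K - j by omega] at hj ⊢
        exact ih hj
      · rw [adjCoeff_eq, show K - (j + 1) + 1 = K - j by omega, ih (by omega),
          Polynomial.coeff_eq_zero_of_natDegree_lt]
        · simp
        · rw [Matrix.charpoly_natDegree_eq_dim]
          omega
  rcases le_or_gt K k with h | h
  · exact hK k h
  · have := key (K - k)
    rw [show K - (K - k) = k by omega] at this
    exact this hk

/-- The traces of the coefficients give the characteristic polynomial, by Jacobi's formula. -/
theorem trace_adjCoeff (k : ℕ) :
    (adjCoeff A k).trace = A.charpoly.coeff (k + 1) * (k + 1) := by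
  rw [← Polynomial.coeff_derivative, Matrix.derivative_charpoly]
  simp [Matrix.trace, adjCoeff]

end Adjugate

/-- The Faddeev–LeVerrier recursion: after `k` rounds, the matrix coefficient of `X ^ (d - k)` in
the adjugate of `X - A`, and minus the coefficient of `X ^ (d - k)` in the characteristic
polynomial. -/
def faddeev {d : ℕ} (A : Matrix (Fin d) (Fin d) ℤ) : ℕ → Matrix (Fin d) (Fin d) ℤ × ℤ
  | 0 => (0, -1)
  | k + 1 =>
    let M := A * (faddeev A k).1 - (faddeev A k).2 • 1
    (M, (A * M).trace / (k + 1 : ℕ))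

/-- Correctness of the recursion. In particular, the divisions in it are exact. -/
theorem faddeev_eq {d : ℕ} (A : Matrix (Fin d) (Fin d) ℤ) {k : ℕ} (hk : k ≤ d) :
    faddeev A k = (adjCoeff A (d - k), -A.charpoly.coeff (d - k)) := by
  induction k with
  | zero =>
    have h := (A.charpoly_monic).coeff_natDegree
    rw [A.charpoly_natDegree_eq_dim, Fintype.card_fin] at h
    rw [Nat.sub_zero, adjCoeff_eq_zero A (by simp), h, faddeev]
  | succ k ih =>
    have hM : A * (faddeev A k).1 - (faddeev A k).2 • 1 = adjCoeff A (d - (k + 1)) := by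
      rw [ih (by omega), adjCoeff_eq A (d - (k + 1)), show d - (k + 1) + 1 = d - k by omega]
      simp [sub_eq_add_neg]
    simp only [faddeev, hM, Prod.mk.injEq, true_and]
    have ht : (A * adjCoeff A (d - (k + 1))).trace =
        (k + 1 : ℕ) * -A.charpoly.coeff (d - (k + 1)) := by
      rcases Nat.eq_zero_or_pos (d - (k + 1)) with h | h
      · rw [h, mul_adjCoeff_zero]
        obtain rfl : d = k + 1 := by omega
        rw [Matrix.trace_neg, Matrix.trace_smul, Matrix.trace_one, Fintype.card_fin, smul_eq_mul]
        simp [mul_comm]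
      · obtain ⟨j, hj⟩ := Nat.exists_eq_succ_of_ne_zero h.ne'
        have h1 := congrArg Matrix.trace (adjCoeff_eq A j)
        rw [Matrix.trace_add, trace_adjCoeff, Matrix.trace_smul, Matrix.trace_one,
          Fintype.card_fin] at h1
        rw [hj, Nat.succ_eq_add_one]
        have hd : (d : ℤ) = j + 1 + (k + 1) := by omega
        rw [hd, smul_eq_mul] at h1
        push_cast
        linarith
    rw [ht, Int.mul_ediv_cancel_left]
    positivity

/-- The adjugate up to sign, as computed by the recursion. -/
def pseudoAdj {d : ℕ} (A : Matrix (Fin d) (Fin d) ℤ) : Matrix (Fin d) (Fin d) ℤ := (faddeev A d).1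

theorem natAbs_faddeev {d : ℕ} (A : Matrix (Fin d) (Fin d) ℤ) :
    (faddeev A d).2.natAbs = A.det.natAbs := by
  rw [faddeev_eq A le_rfl, Nat.sub_self, A.det_eq_sign_charpoly_coeff]
  simp [Int.natAbs_mul, Int.natAbs_pow]

theorem mul_pseudoAdj {d : ℕ} (A : Matrix (Fin d) (Fin d) ℤ) :
    A * pseudoAdj A = (faddeev A d).2 • 1 := by
  rw [pseudoAdj, faddeev_eq A le_rfl, Nat.sub_self, mul_adjCoeff_zero]
  simp

theorem pseudoAdj_mul {d : ℕ} (A : Matrix (Fin d) (Fin d) ℤ) (hA : A.det ≠ 0) :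
    pseudoAdj A * A = (faddeev A d).2 • 1 := by
  have h : A.det • (pseudoAdj A * A) = A.det • ((faddeev A d).2 • 1) := by
    -- the classical adjugate inverts `A` on the left, up to the determinant
    calc A.det • (pseudoAdj A * A) = A.adjugate * (A * pseudoAdj A) * A := by
          rw [← Matrix.mul_assoc, Matrix.adjugate_mul]
          simp [Matrix.mul_assoc]
      _ = _ := by
          rw [mul_pseudoAdj]
          simp only [mul_smul_comm, smul_mul_assoc, mul_one, Matrix.adjugate_mul]
          rw [smul_comm]
  exact smul_right_injective _ hA h

/-- The residue map `ℤᵈ → (ℤ/Δ)ᵈ` with kernel `A ℤᵈ`. -/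
def latticeResidue {d : ℕ} (A : Matrix (Fin d) (Fin d) ℤ) (Δ : ℕ) (x : Fin d → ℤ) :
    Fin d → ZMod Δ := fun i => (((pseudoAdj A).mulVec x i : ℤ) : ZMod Δ)

theorem latticeResidue_sub {d : ℕ} (A : Matrix (Fin d) (Fin d) ℤ) (Δ : ℕ) (x y : Fin d → ℤ) :
    latticeResidue A Δ (x - y) = latticeResidue A Δ x - latticeResidue A Δ y := by
  ext i
  simp [latticeResidue, Matrix.mulVec_sub]

theorem latticeResidue_eq_zero_iff {d : ℕ} {A : Matrix (Fin d) (Fin d) ℤ} {Δ : ℕ}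
    (hΔ : Δ = A.det.natAbs) (h0 : Δ ≠ 0) (x : Fin d → ℤ) :
    latticeResidue A Δ x = 0 ↔ ∃ z, x = A.mulVec z := by
  have hdet : A.det ≠ 0 := by
    rintro h
    simp [h] at hΔ
    exact h0 hΔ
  have hδ : (faddeev A d).2.natAbs = Δ := by rw [natAbs_faddeev, hΔ]
  have hdvd : ∀ z : ℤ, (Δ : ℤ) ∣ z ↔ (faddeev A d).2 ∣ z := fun z => by
    rw [← hδ, Int.natAbs_dvd]
  constructor
  · intro h
    have h1 : ∀ i, ∃ z, (pseudoAdj A).mulVec x i = (faddeev A d).2 * z := fun i => by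
      have := congrFun h i
      rw [latticeResidue, Pi.zero_apply, ZMod.intCast_zmod_eq_zero_iff_dvd] at this
      exact (hdvd _).1 this
    choose z hz using h1
    have h2 : (pseudoAdj A).mulVec x = (faddeev A d).2 • z := by
      ext i
      simp [hz i]
    have h3 : (faddeev A d).2 • x = (faddeev A d).2 • A.mulVec z := by
      calc (faddeev A d).2 • x = (A * pseudoAdj A).mulVec x := by
            rw [mul_pseudoAdj, Matrix.smul_mulVec, Matrix.one_mulVec]
        _ = _ := by rw [← Matrix.mulVec_mulVec, h2, Matrix.mulVec_smul]
    refine ⟨z, smul_right_injective _ (r := (faddeev A d).2) ?_ h3⟩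
    intro h
    rw [h] at hδ
    exact h0 hδ.symm
  · rintro ⟨z, rfl⟩
    ext i
    rw [latticeResidue, Matrix.mulVec_mulVec, pseudoAdj_mul A hdet, Pi.zero_apply,
      ZMod.intCast_zmod_eq_zero_iff_dvd, hdvd, Matrix.smul_mulVec, Matrix.one_mulVec]
    exact ⟨z i, rfl⟩

/-- Distinct residues are at most as many as the index of the lattice. -/
theorem card_le_of_latticeResidue {d : ℕ} {A : Matrix (Fin d) (Fin d) ℤ} {Δ : ℕ}
    (hΔ : Δ = A.det.natAbs) (h0 : Δ ≠ 0) {s : ℕ} (x : Fin s → Fin d → ℤ)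
    (hx : Function.Injective fun g => latticeResidue A Δ (x g)) : s ≤ Δ := by
  have hdet : A.det ≠ 0 := by
    rintro h
    simp [h] at hΔ
    exact h0 hΔ
  have hinj : Function.Injective (Matrix.toLin' A) := by
    rw [Matrix.toLin'_apply']
    exact Matrix.mulVec_injective_of_det_ne_zero hdet
  let e := LinearEquiv.ofInjective _ hinj
  have hcard := Submodule.natAbs_det_equiv (LinearMap.range (Matrix.toLin' A)) e
  have hcomp : (LinearMap.range (Matrix.toLin' A)).subtype ∘ₗ
      AddMonoidHom.toIntLinearMap (e : (Fin d → ℤ) →+ LinearMap.range (Matrix.toLin' A)) =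
        Matrix.toLin' A := by
    ext x
    rfl
  rw [hcomp, LinearMap.det_toLin', ← hΔ] at hcard
  have hfin : Finite ((Fin d → ℤ) ⧸ LinearMap.range (Matrix.toLin' A)) :=
    Nat.finite_of_card_ne_zero (hcard ▸ h0)
  have := Nat.card_le_card_of_injective
    (fun g => (Submodule.Quotient.mk (x g) : (Fin d → ℤ) ⧸ LinearMap.range (Matrix.toLin' A))) ?_
  · simpa [← hcard] using this
  · intro g h hgh
    rw [Submodule.Quotient.eq] at hgh
    obtain ⟨z, hz⟩ := hgh
    refine hx ?_
    have := (latticeResidue_eq_zero_iff hΔ h0 (x g - x h)).2 ⟨z, by simpa using hz.symm⟩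
    rw [latticeResidue_sub, sub_eq_zero] at this
    exact this

/-! ### Circulations and closed walks -/

namespace ArcDigraph

variable {V A R : Type*} (G : ArcDigraph V A)

section Circ

variable [Fintype A] [DecidableEq V] [CommRing R]

/-- Circulations with coefficients in a commutative ring. -/
def IsCirc (y : A → R) : Prop :=
  ∀ v, ∑ a, y a * ((if G.tail a = v then 1 else 0) - (if G.head a = v then 1 else 0)) = 0

variable {G}

/-- A potential on the nodes does not change, in total, along a circulation. -/
theorem IsCirc.sum_smul {M : Type*} [AddCommGroup M] [Module R M] {y : A → R} (hy : G.IsCirc y)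
    (p : V → M) : ∑ a, y a • p (G.head a) = ∑ a, y a • p (G.tail a) := by
  classical
  let S : Finset V := Finset.univ.image G.tail ∪ Finset.univ.image G.head
  have key : ∀ a, y a • p (G.tail a) - y a • p (G.head a) =
      ∑ v ∈ S, (y a * ((if G.tail a = v then 1 else 0) - (if G.head a = v then 1 else 0))) • p v := by
    intro a
    have h1 : G.tail a ∈ S := by simp [S]
    have h2 : G.head a ∈ S := by simp [S]
    simp only [mul_sub, sub_smul, Finset.sum_sub_distrib, mul_ite, mul_one, mul_zero, ite_smul,
      zero_smul, Finset.sum_ite_eq, h1, h2, if_true]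
  have : ∑ a, (y a • p (G.tail a) - y a • p (G.head a)) = 0 := by
    rw [Finset.sum_congr rfl fun a _ => key a, Finset.sum_comm]
    refine Finset.sum_eq_zero fun v _ => ?_
    rw [← Finset.sum_smul, hy v, zero_smul]
  rw [Finset.sum_sub_distrib, sub_eq_zero] at this
  exact this.symm

/-- Circulations are characterized by potentials. This form needs no case distinction on nodes when
circulations are pushed forward or pulled back. -/
theorem isCirc_iff_potential {y : A → R} :
    G.IsCirc y ↔ ∀ p : V → R, ∑ a, y a * p (G.head a) = ∑ a, y a * p (G.tail a) := by
  refine ⟨fun h p => h.sum_smul p, fun h v => ?_⟩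
  simp only [mul_sub, Finset.sum_sub_distrib]
  rw [sub_eq_zero]
  exact (h fun u => if u = v then 1 else 0).symm

theorem IsCirc.add {y z : A → R} (hy : G.IsCirc y) (hz : G.IsCirc z) : G.IsCirc (y + z) :=
  fun v => by simp [add_mul, Finset.sum_add_distrib, hy v, hz v]

theorem IsCirc.smul {y : A → R} (c : R) (hy : G.IsCirc y) : G.IsCirc (c • y) :=
  fun v => by simp [mul_assoc, ← Finset.mul_sum, hy v]

theorem IsCirc.sub {y z : A → R} (hy : G.IsCirc y) (hz : G.IsCirc z) : G.IsCirc (y - z) :=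
  fun v => by simp [sub_mul, hy v, hz v]

theorem IsCirc.intCast {y : A → ℤ} (hy : G.IsCirc y) : G.IsCirc fun a => (y a : R) :=
  fun v => by simpa using congrArg (Int.cast : ℤ → R) (hy v)

variable (G)

theorem incidence_mulVec_eq_zero {y : A → ℤ} : G.incidence.mulVec y = 0 ↔ G.IsCirc y := by
  simp only [funext_iff, Matrix.mulVec, dotProduct, incidence, IsCirc, Pi.zero_apply, mul_comm]

end Circ

/-- `l` is the list of arcs of a walk from `u` to `w`. -/
def IsWalk : V → List A → V → Prop
  | u, [], w => u = w
  | u, a :: l, w => G.tail a = u ∧ IsWalk (G.head a) l w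

variable {G}

theorem IsWalk.append {u v w : V} {l k : List A} (hl : G.IsWalk u l v) (hk : G.IsWalk v k w) :
    G.IsWalk u (l ++ k) w := by
  induction l generalizing u with
  | nil => rw [List.nil_append, show u = v from hl]; exact hk
  | cons a l ih => exact ⟨hl.1, ih hl.2⟩

theorem IsWalk.sum_map {M : Type*} [AddCommGroup M] {u w : V} {l : List A}
    (h : G.IsWalk u l w) (p : V → M) :
    (l.map fun a => p (G.head a)).sum + p u = (l.map fun a => p (G.tail a)).sum + p w := by
  induction l generalizing u with
  | nil => simp [show u = w from h]
  | cons a l ih =>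
    simp only [List.map_cons, List.sum_cons]
    have := ih h.2
    rw [← h.1, add_assoc (p (G.tail a)), ← this]
    abel

/-- A function of the nodes which is preserved by all arcs is constant along a walk. -/
theorem IsWalk.const {X : Type*} {f : V → X} (hf : ∀ a, f (G.head a) = f (G.tail a)) {u w : V}
    {l : List A} (h : G.IsWalk u l w) : ∀ a ∈ l, f (G.tail a) = f u := by
  induction l generalizing u with
  | nil => simp
  | cons a l ih =>
    intro b hb
    rcases List.mem_cons.1 hb with rfl | hb
    · rw [h.1]
    · rw [ih h.2 b hb, hf, h.1]

section Circ

variable [Fintype A]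

/-- How often a walk uses an arc. -/
def arcCount [DecidableEq A] (l : List A) (a : A) : ℕ := l.count a

theorem sum_arcCount_mul [DecidableEq A] [CommRing R] (l : List A) (f : A → R) :
    ∑ a, (arcCount l a : R) * f a = (l.map f).sum := by
  simp only [arcCount]
  induction l with
  | nil => simp
  | cons b l ih =>
    simp only [List.count_cons, Nat.cast_add, add_mul, Finset.sum_add_distrib, ih, List.map_cons,
      List.sum_cons, Nat.cast_ite, Nat.cast_one, Nat.cast_zero, ite_mul, one_mul, zero_mul,
      beq_iff_eq, Finset.sum_ite_eq, Finset.mem_univ, if_true]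
    rw [add_comm]

variable [DecidableEq V]

/-- A nonzero nonnegative circulation contains a directed cycle: follow arcs of the support until
an arc repeats. -/
theorem IsCirc.exists_cycle [CommRing R] [LinearOrder R] [IsStrictOrderedRing R] {y : A → R}
    (h0 : 0 ≤ y) (hy : G.IsCirc y) (hne : y ≠ 0) :
    ∃ u l, G.IsWalk u l u ∧ l.Nodup ∧ l ≠ [] ∧ ∀ a ∈ l, 0 < y a := by
  have hnext : ∀ a : {a // 0 < y a}, ∃ b : {a // 0 < y a}, G.tail b = G.head a := by
    rintro ⟨a, ha⟩
    have h := hy (G.head a)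
    simp only [mul_sub, Finset.sum_sub_distrib, sub_eq_zero, mul_ite, mul_one, mul_zero] at h
    have hpos : 0 < ∑ b, if G.tail b = G.head a then y b else 0 := by
      rw [h]
      refine lt_of_lt_of_le ha ?_
      have := Finset.single_le_sum (f := fun b => if G.head b = G.head a then y b else 0)
        (fun b _ => by split_ifs; exacts [h0 b, le_rfl]) (Finset.mem_univ a)
      simpa using this
    obtain ⟨b, -, hb⟩ := Finset.exists_lt_of_sum_lt (s := Finset.univ) (f := fun _ : A => (0 : R))
      (by simpa using hpos)
    split_ifs at hb with hb'
    · exact ⟨⟨b, hb⟩, hb'⟩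
    · exact absurd hb (lt_irrefl _)
  -- the choice of a next arc in the support is a self-map of a finite set: it has a periodic point
  choose next hn using hnext
  obtain ⟨a0, ha0⟩ : ∃ a, 0 < y a := by
    by_contra! h
    exact hne (funext fun a => le_antisymm (h a) (h0 a))
  obtain ⟨a, ha⟩ : (Function.periodicPts next).Nonempty := by
    obtain ⟨i, j, hij, h⟩ := Finite.exists_ne_map_eq_of_infinite
      fun k : ℕ => next^[k] ⟨a0, ha0⟩
    wlog hlt : i < j generalizing i j
    · exact this j i hij.symm h.symm (by omega)
    refine ⟨next^[i] ⟨a0, ha0⟩, Function.mk_mem_periodicPts (n := j - i) (by omega) ?_⟩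
    rw [Function.IsPeriodicPt, Function.IsFixedPt, ← Function.iterate_add_apply,
      Nat.sub_add_cancel hlt.le]
    exact h.symm
  set p := Function.minimalPeriod next a with hp
  have hp0 : 0 < p := Function.minimalPeriod_pos_of_mem_periodicPts ha
  have hwalk : ∀ k, G.IsWalk (G.tail a) ((List.range k).map fun i => (next^[i] a : A))
      (G.tail (next^[k] a)) := by
    intro k
    induction k with
    | zero => rfl
    | succ k ih =>
      rw [List.range_succ, List.map_append]
      refine ih.append ⟨rfl, ?_⟩
      rw [Function.iterate_succ_apply']
      exact (hn _).symm
  refine ⟨G.tail a, (List.range p).map fun i => (next^[i] a : A), ?_, ?_, ?_, ?_⟩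
  · have := hwalk p
    rwa [hp, Function.iterate_minimalPeriod] at this
  · refine List.Nodup.map_on (fun i hi j hj h => ?_) List.nodup_range
    exact Function.iterate_injOn_Iio_minimalPeriod (List.mem_range.1 hi) (List.mem_range.1 hj)
      (Subtype.ext h)
  · intro h
    rw [List.map_eq_nil_iff, List.range_eq_nil] at h
    omega
  · intro b hb
    obtain ⟨i, -, rfl⟩ := List.mem_map.1 hb
    exact (next^[i] a).2

variable [DecidableEq A]

theorem IsWalk.isCirc [CommRing R] {u : V} {l : List A} (h : G.IsWalk u l u) :
    G.IsCirc fun a => (arcCount l a : R) := by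
  rw [isCirc_iff_potential]
  intro p
  rw [sum_arcCount_mul, sum_arcCount_mul]
  exact add_right_cancel (h.sum_map p)

/-- Nonnegative circulations, over `ℤ` as well as over `ℝ`, are built up from directed cycles. -/
theorem IsCirc.induction [CommRing R] [LinearOrder R] [IsStrictOrderedRing R]
    {P : (A → R) → Prop} (zero : P 0)
    (add : ∀ (y : A → R) (c : R) (u : V) (l : List A), 0 < c → G.IsWalk u l u → l.Nodup → P y →
      P (y + c • fun a => (arcCount l a : R)))
    {y : A → R} (h0 : 0 ≤ y) (hy : G.IsCirc y) : P y := by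
  induction hk : (Finset.univ.filter fun a => y a ≠ 0).card using Nat.strong_induction_on
    generalizing y with
  | _ k ih =>
  by_cases hne : y = 0
  · rwa [hne]
  obtain ⟨u, l, hw, hnd, hl, hpos⟩ := hy.exists_cycle h0 hne
  -- subtracting as much of the cycle as possible removes the arc `b` from the support
  obtain ⟨b, hb, hmin⟩ := l.toFinset.exists_min_image y (by simpa using hl)
  rw [List.mem_toFinset] at hb
  simp only [List.mem_toFinset] at hmin
  have hcount : ∀ a, ((y b) • fun a => (arcCount l a : R)) a = if a ∈ l then y b else 0 := by
    intro a
    by_cases ha : a ∈ l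
    · simp [arcCount, ha, List.count_eq_one_of_mem hnd ha]
    · simp [arcCount, ha, List.count_eq_zero_of_not_mem ha]
  have hz0 : 0 ≤ y - (y b) • fun a => (arcCount l a : R) := by
    intro a
    rw [Pi.sub_apply, hcount]
    split_ifs with ha
    · simpa using hmin a ha
    · simpa using h0 a
  have := ih _ ?_ hz0 (hy.sub ((IsWalk.isCirc hw).smul (y b))) rfl
  · simpa using add _ (y b) u l (hpos b hb) hw hnd this
  · rw [← hk]
    refine Finset.card_lt_card ⟨fun a ha => ?_, fun h => ?_⟩
    · simp only [Finset.mem_filter, Finset.mem_univ, true_and] at ha ⊢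
      intro h
      apply ha
      refine le_antisymm ?_ (hz0 a)
      rw [Pi.sub_apply, h, hcount]
      split_ifs
      · simpa using (hpos b hb).le
      · simp
    · have h1 := h (show b ∈ _ by simpa using (hpos b hb).ne')
      simp only [Finset.mem_filter, Finset.mem_univ, true_and] at h1
      apply h1
      rw [Pi.sub_apply, hcount, if_pos hb, sub_self]

/-- An integer circulation is a sum of closed walks. -/
theorem IsCirc.exists_closed_walks {y : A → ℤ} (h0 : 0 ≤ y) (hy : G.IsCirc y) :
    ∃ ws : List (V × List A), (∀ q ∈ ws, G.IsWalk q.1 q.2 q.1) ∧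
      ∀ a, y a = (arcCount (ws.flatMap Prod.snd) a : ℕ) := by
  refine IsCirc.induction (R := ℤ) (P := fun y => ∃ ws : List (V × List A),
    (∀ q ∈ ws, G.IsWalk q.1 q.2 q.1) ∧ ∀ a, y a = (arcCount (ws.flatMap Prod.snd) a : ℕ))
    ⟨[], by simp, by simp [arcCount]⟩ ?_ h0 hy
  rintro y c u l hc hl - ⟨ws, hws, h⟩
  refine ⟨List.replicate c.toNat (u, l) ++ ws, ?_, fun a => ?_⟩
  · intro q hq
    rcases List.mem_append.1 hq with hq | hq
    · rw [List.eq_of_mem_replicate hq]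
      exact hl
    · exact hws q hq
  · have hr : ∀ k : ℕ, ((List.replicate k (u, l)).flatMap Prod.snd).count a = k * l.count a := by
      intro k
      induction k with
      | zero => simp
      | succ k ih => rw [List.replicate_succ, List.flatMap_cons, List.count_append, ih]; ring
    rw [arcCount, List.flatMap_append, List.count_append, hr, Pi.add_apply, h a]
    push_cast
    rw [Int.toNat_of_nonneg hc.le]
    simp [arcCount, add_comm]

end Circ

end ArcDigraph

/-- The bound on the Davenport constant: a long list of elements of a finite group has a nonempty
segment with sum zero, since two of its initial segments have the same sum. Here the initial
segments are only required to have their sums in the range of `L`. -/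
theorem exists_short_sublist {Q X σ : Type*} [AddCommGroup X] [Fintype σ] (L : σ → X)
    (f : Q → X) (l : List Q) (h0 : 0 ∈ Set.range L)
    (hadd : ∀ q ∈ l, ∀ x ∈ Set.range L, x + f q ∈ Set.range L) :
    ∃ l' : List Q, l'.Sublist l ∧ l'.length < Fintype.card σ ∧ (l'.map f).sum = (l.map f).sum := by
  induction hk : l.length using Nat.strong_induction_on generalizing l with
  | _ k ih =>
  by_cases hlt : l.length < Fintype.card σ
  · exact ⟨l, List.Sublist.refl l, hlt, rfl⟩
  have hpre : ∀ i, ((l.take i).map f).sum ∈ Set.range L := by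
    intro i
    induction i with
    | zero => simpa using h0
    | succ i ih =>
      by_cases hi : i < l.length
      · rw [List.take_succ_eq_append_getElem hi, List.map_append, List.sum_append, List.map_singleton,
          List.sum_singleton]
        exact hadd l[i] (List.getElem_mem hi) _ ih
      · rwa [List.take_of_length_le (by omega), ← List.take_of_length_le (l := l) (i := i) (by omega)]
  choose g hg using hpre
  obtain ⟨i, j, hij, hgij⟩ := Fintype.exists_ne_map_eq_of_card_lt
    (fun i : Fin (l.length + 1) => g i) (by simp; omega)
  wlog hlt' : i < j generalizing i j
  · exact this j i hij.symm hgij.symm (by omega)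
  have hs : ((l.take i).map f).sum = ((l.take j).map f).sum := by
    rw [← hg, ← hg]
    exact congrArg L hgij
  -- the segment between positions `i` and `j` has sum zero and is left out
  have hsub : (l.take i ++ l.drop j).Sublist l := by
    conv_rhs => rw [← List.take_append_drop j l]
    exact (List.take_sublist_take_left hlt'.le).append (List.Sublist.refl _)
  have hj := j.2
  have hij' : (i : ℕ) < j := hlt'
  obtain ⟨l', h1, h2, h3⟩ := ih _ (by simp; omega) (l.take i ++ l.drop j)
    (fun q hq => hadd q (hsub.subset hq)) rfl
  refine ⟨l', h1.trans hsub, h2, ?_⟩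
  rw [h3, List.map_append, List.sum_append, hs, ← List.sum_append, ← List.map_append,
    List.take_append_drop]

/-! ### The layered digraph -/

section Layered

variable {V A σ τ X : Type*} {K : ℕ}

/-- The layered digraph of a digraph `G` with a state transition `succ` along its arcs. Its nodes
`(((T, i), u), g)` consist of a tuple `T` of starting nodes, a layer `i ≤ K`, a node `u` of `G` and
a state `g`. An arc `some a` follows the arc `a` of `G` and updates the state. The arc `none` leaves
layer `i` at the starting node `v T i`, keeping the state, and leads to the starting node of the
next layer. From the last layer it returns to the beginning of layer `0` with the state `g₀` when
the state is final; otherwise it is a loop. -/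
def layered (G : ArcDigraph V A) (v : τ → Fin (K + 1) → V) (succ : σ → A → σ) (g₀ : σ)
    (fin : σ → Prop) [DecidablePred fin] :
    ArcDigraph (((τ × Fin (K + 1)) × V) × σ) (((τ × Fin (K + 1)) × σ) × Option A) where
  tail
    | (((T, i), g), some a) => (((T, i), G.tail a), g)
    | (((T, i), g), none) => (((T, i), v T i), g)
  head
    | (((T, i), g), some a) => (((T, i), G.head a), succ g a)
    | (((T, i), g), none) =>
      if h : (i : ℕ) < K then (((T, ⟨i + 1, by omega⟩), v T ⟨i + 1, by omega⟩), g)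
      else if fin g then (((T, 0), v T 0), g₀)
      else (((T, i), v T i), g)

/-- The return arcs of the layered digraph. -/
def IsReturn (A : Type*) (fin : σ → Prop) (e : ((τ × Fin (K + 1)) × σ) × Option A) : Prop :=
  e.2 = none ∧ (e.1.1.2 : ℕ) = K ∧ fin e.1.2

instance (fin : σ → Prop) [DecidablePred fin] : DecidablePred (IsReturn (τ := τ) (K := K) A fin) :=
  fun e => by unfold IsReturn; cases h : e.2 <;> simp <;> infer_instance

variable {G : ArcDigraph V A} {v : τ → Fin (K + 1) → V} {succ : σ → A → σ} {g₀ : σ}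
  {fin : σ → Prop} [DecidablePred fin]

/-- The lift of a walk to a layer, starting in the state `g`. -/
def liftWalk (succ : σ → A → σ) (T : τ) (i : Fin (K + 1)) :
    σ → List A → List (((τ × Fin (K + 1)) × σ) × Option A)
  | _, [] => []
  | g, a :: l => (((T, i), g), some a) :: liftWalk succ T i (succ g a) l

theorem liftWalk_isWalk (T : τ) (i : Fin (K + 1)) {u w : V} {l : List A} (h : G.IsWalk u l w)
    (g : σ) : (layered G v succ g₀ fin).IsWalk (((T, i), u), g) (liftWalk succ T i g l)
      (((T, i), w), l.foldl succ g) := by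
  induction l generalizing u g with
  | nil => rw [show u = w from h]; rfl
  | cons a l ih =>
    refine ⟨?_, ih h.2 _⟩
    rw [← h.1]
    rfl

theorem liftWalk_filterMap (T : τ) (i : Fin (K + 1)) (g : σ) (l : List A) :
    (liftWalk succ T i g l).filterMap Prod.snd = l := by
  induction l generalizing g with
  | nil => rfl
  | cons a l ih => simp [liftWalk, ih]

theorem liftWalk_countP (T : τ) (i : Fin (K + 1)) (g : σ) (l : List A) :
    (liftWalk succ T i g l).countP (IsReturn A fin ·) = 0 := by
  induction l generalizing g with
  | nil => rfl
  | cons a l ih => rw [liftWalk, List.countP_cons, ih]; simp [IsReturn]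

/-- A cycle of the layered digraph stays with one tuple, and passes through at most one return
arc. -/
theorem countP_isReturn_le_one {L : σ → X} {F : X}
    (hinjL : Function.Injective L) (hfin : ∀ g, fin g ↔ L g = F)
    {u : ((τ × Fin (K + 1)) × V) × σ} {l : List (((τ × Fin (K + 1)) × σ) × Option A)}
    (hl : (layered G v succ g₀ fin).IsWalk u l u) (hnd : l.Nodup) :
    l.countP (IsReturn A fin ·) ≤ 1 := by
  have hT := hl.const (f := fun x => x.1.1.1) (by
    rintro ⟨⟨⟨T, i⟩, g⟩, _ | a⟩
    · by_cases hiK : (i : ℕ) < K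
      · simp [layered, hiK]
      · by_cases hg : fin g <;> simp [layered, hiK, hg]
    · simp [layered])
  have huniq : ∀ e ∈ l, ∀ e' ∈ l, IsReturn A fin e → IsReturn A fin e' → e = e' := by
    rintro ⟨⟨⟨T, i⟩, g⟩, _ | a⟩ he ⟨⟨⟨T', i'⟩, g'⟩, _ | a'⟩ he' ⟨h1, h2, h3⟩ ⟨k1, k2, k3⟩
    · have e1 : T = T' := (hT _ he).trans (hT _ he').symm
      have e2 : i = i' := Fin.ext (h2.trans k2.symm)
      have e3 : g = g' := hinjL (((hfin g).1 h3).trans ((hfin g').1 k3).symm)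
      rw [e1, e2, e3]
    all_goals simp at h1 k1
  rw [List.countP_eq_length_filter]
  by_contra! hlt
  have hnd' := hnd.filter (fun e => decide (IsReturn A fin e))
  have m0 := List.mem_filter.1 (List.getElem_mem (show 0 < _ by omega) :
    (l.filter fun e => decide (IsReturn A fin e))[0] ∈ _)
  have m1 := List.mem_filter.1 (List.getElem_mem hlt)
  have := huniq _ m0.1 _ m1.1 (by simpa using m0.2) (by simpa using m1.2)
  rw [hnd'.getElem_inj_iff] at this
  omega

variable [AddCommGroup X] {L : σ → X} {w : A → X} {F : X}

theorem foldl_succ (hsucc : ∀ g a, L (succ g a) = L g + w a) (g : σ) (l : List A) :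
    L (l.foldl succ g) = L g + (l.map w).sum := by
  induction l generalizing g with
  | nil => simp
  | cons a l ih => rw [List.foldl_cons, ih, hsucc, List.map_cons, List.sum_cons, add_assoc]

/-- At most `K` closed walks with total label `F`, starting at the nodes of the tuple `T`, lift to a
closed walk through one return arc. -/
theorem exists_lift (hsucc : ∀ g a, L (succ g a) = L g + w a) (hfin : ∀ g, fin g ↔ L g = F)
    (T : τ) (k : ℕ) (i : Fin (K + 1)) (hi : i + k = K) (ws : List (V × List A))
    (hlen : ws.length ≤ k) (hws : ∀ q ∈ ws, G.IsWalk q.1 q.2 q.1)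
    (hv : ∀ (j : ℕ) (hj : j < ws.length), v T ⟨i + j, by omega⟩ = ws[j].1) (g : σ)
    (hg : L g + (ws.map fun q => (q.2.map w).sum).sum = F) :
    ∃ l, (layered G v succ g₀ fin).IsWalk (((T, i), v T i), g) l (((T, 0), v T 0), g₀) ∧
      l.filterMap Prod.snd = ws.flatMap Prod.snd ∧ l.countP (IsReturn A fin ·) = 1 := by
  induction k generalizing i ws g with
  | zero =>
    obtain rfl := List.length_eq_zero_iff.1 (Nat.le_zero.1 hlen)
    have hf : fin g := (hfin g).2 (by simpa using hg)
    have hiK : ¬ (i : ℕ) < K := by omega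
    refine ⟨[(((T, i), g), none)], ⟨rfl, ?_⟩, by simp, ?_⟩
    · simp [layered, hiK, hf, ArcDigraph.IsWalk]
    · simp [IsReturn, hf]
      omega
  | succ k ih =>
    have hiK : (i : ℕ) < K := by omega
    have jump : ∀ g, (layered G v succ g₀ fin).IsWalk (((T, i), v T i), g) [(((T, i), g), none)]
        (((T, ⟨i + 1, by omega⟩), v T ⟨i + 1, by omega⟩), g) := by
      intro g
      refine ⟨rfl, ?_⟩
      simp [layered, hiK, ArcDigraph.IsWalk]
    have hjump : ∀ g : σ, ¬ IsReturn A fin (((T, i), g), none) := by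
      rintro g ⟨-, h, -⟩
      exact hiK.ne h
    cases ws with
    | nil =>
      obtain ⟨l, h1, h2, h3⟩ := ih ⟨i + 1, by omega⟩ (by simp; omega) [] (by simp) (by simp)
        (by simp) g hg
      refine ⟨_, (jump g).append h1, ?_, ?_⟩
      · simpa using h2
      · rw [List.countP_append, h3]
        simp [hjump g]
    | cons q ws =>
      have hq : v T i = q.1 := hv 0 (by simp)
      have hw := liftWalk_isWalk (v := v) (succ := succ) (g₀ := g₀) (fin := fin) T i
        (hws q (by simp)) g
      rw [← hq] at hw
      obtain ⟨l, h1, h2, h3⟩ := ih ⟨i + 1, by omega⟩ (by simp; omega) ws (by simpa using hlen)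
        (fun p hp => hws p (by simp [hp])) (fun j hj => by
          have := hv (j + 1) (by simpa using hj)
          simp only [List.getElem_cons_succ] at this
          rw [← this]
          congr 2
          simp
          omega) (q.2.foldl succ g) (by
          rw [foldl_succ hsucc, ← hg]
          simp [add_assoc])
      refine ⟨_, hw.append ((jump _).append h1), ?_, ?_⟩
      · simp [List.filterMap_append, liftWalk_filterMap, h2]
      · rw [List.countP_append, List.countP_append, h3, liftWalk_countP]
        simp [hjump]

end Layered

/-! ### Flows on the layered digraph and their projections -/

section Polytope

variable {V A σ τ X : Type*} {K : ℕ} [Fintype A] [Fintype σ] [Fintype τ] (G : ArcDigraph V A)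
  (v : τ → Fin (K + 1) → V) (succ : σ → A → σ) (g₀ : σ) (fin : σ → Prop) [DecidablePred fin]

/-- The projection of a flow on the layered digraph to the arcs of `G`. -/
def flowProj [DecidableEq A] {R : Type*} [CommRing R]
    (φ : ((τ × Fin (K + 1)) × σ) × Option A → R) (a : A) : R :=
  ∑ e, φ e * if e.2 = some a then 1 else 0

/-- The amount of a flow on the return arcs. -/
def returnFlow {R : Type*} [CommRing R] (φ : ((τ × Fin (K + 1)) × σ) × Option A → R) : R :=
  ∑ e, φ e * if IsReturn A fin e then 1 else 0

/-- The projections of the circulations of the layered digraph with one unit on the return arcs. -/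
def unitFlows [DecidableEq A] [DecidableEq V] [DecidableEq σ] [DecidableEq τ] : Set (A → ℝ) :=
  {x | ∃ φ : ((τ × Fin (K + 1)) × σ) × Option A → ℝ, 0 ≤ φ ∧
    (layered G v succ g₀ fin).IsCirc φ ∧ (∀ a, x a = flowProj φ a) ∧ returnFlow fin φ = 1}

/-- Nonnegative integer circulations with label `F`. -/
def labelledCirculations [DecidableEq V] [AddCommGroup X] (w : A → X) (F : X) : Set (A → ℤ) :=
  {y | 0 ≤ y ∧ G.IsCirc y ∧ ∑ a, y a • w a = F}

variable {G v succ g₀ fin}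

section

variable {R : Type*} [CommRing R]

theorem returnFlow_add (φ ψ : ((τ × Fin (K + 1)) × σ) × Option A → R) :
    returnFlow fin (φ + ψ) = returnFlow fin φ + returnFlow fin ψ := by
  simp only [returnFlow, Pi.add_apply, add_mul, Finset.sum_add_distrib]

theorem returnFlow_smul (c : R) (φ : ((τ × Fin (K + 1)) × σ) × Option A → R) :
    returnFlow fin (c • φ) = c * returnFlow fin φ := by
  simp [returnFlow, Finset.mul_sum]

variable [DecidableEq A]

theorem flowProj_add (φ ψ : ((τ × Fin (K + 1)) × σ) × Option A → R) :
    flowProj (φ + ψ) = flowProj φ + flowProj ψ := by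
  ext a
  simp only [flowProj, Pi.add_apply, add_mul, Finset.sum_add_distrib]

theorem flowProj_smul (c : R) (φ : ((τ × Fin (K + 1)) × σ) × Option A → R) :
    flowProj (c • φ) = c • flowProj φ := by
  ext a
  simp [flowProj, Finset.mul_sum]

theorem sum_flowProj_smul {M : Type*} [AddCommGroup M] [Module R M]
    (φ : ((τ × Fin (K + 1)) × σ) × Option A → R) (f : A → M) :
    ∑ a, flowProj φ a • f a = ∑ e, φ e • (e.2.elim 0 f) := by
  simp only [flowProj, Finset.sum_smul]
  rw [Finset.sum_comm]
  refine Finset.sum_congr rfl fun e _ => ?_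
  cases h : e.2 with
  | none => simp
  | some b => simp

variable [DecidableEq σ] [DecidableEq τ]

theorem flowProj_count (l : List (((τ × Fin (K + 1)) × σ) × Option A)) (a : A) :
    flowProj (fun e => (ArcDigraph.arcCount l e : R)) a = ArcDigraph.arcCount (l.filterMap Prod.snd) a := by
  rw [flowProj, ArcDigraph.sum_arcCount_mul]
  induction l with
  | nil => simp [ArcDigraph.arcCount]
  | cons e l ih =>
    rw [List.map_cons, List.sum_cons, ih]
    simp only [ArcDigraph.arcCount]
    cases h : e.2 with
    | none => simp [h]
    | some b =>
      rw [List.filterMap_cons_some h, List.count_cons]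
      by_cases hb : b = a <;> simp [hb, add_comm]

theorem returnFlow_count (l : List (((τ × Fin (K + 1)) × σ) × Option A)) :
    returnFlow fin (fun e => (ArcDigraph.arcCount l e : R)) = l.countP (IsReturn A fin ·) := by
  rw [returnFlow, ArcDigraph.sum_arcCount_mul]
  induction l with
  | nil => simp
  | cons e l ih =>
    rw [List.map_cons, List.sum_cons, ih, List.countP_cons]
    by_cases hb : IsReturn A fin e <;> simp [hb, add_comm]

variable [DecidableEq V]

/-- The projection of a circulation is a circulation: this is seen with potentials which, in each
layer, vanish at the starting node. -/
theorem flowProj_isCirc {φ : ((τ × Fin (K + 1)) × σ) × Option A → R}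
    (h : (layered G v succ g₀ fin).IsCirc φ) : G.IsCirc (flowProj φ) := by
  intro u
  obtain ⟨p, hp⟩ : ∃ p : ((τ × Fin (K + 1)) × V) × σ → R, ∀ T i y g, p (((T, i), y), g) =
    (if y = u then 1 else 0) - (if v T i = u then 1 else 0) :=
    ⟨fun x => (if x.1.2 = u then 1 else 0) - (if v x.1.1.1 x.1.1.2 = u then 1 else 0),
      fun _ _ _ _ => rfl⟩
  have hp0 : ∀ T i g, p (((T, i), v T i), g) = 0 := fun T i g => by rw [hp, sub_self]
  have h2 := sum_flowProj_smul φ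
    fun a => ((if G.tail a = u then 1 else 0) - (if G.head a = u then 1 else 0) : R)
  have h3 := sub_eq_zero.2 (h.sum_smul p).symm
  rw [← Finset.sum_sub_distrib] at h3
  refine (h2.trans (Finset.sum_congr rfl fun e _ => ?_)).trans h3
  rw [← smul_sub]
  congr 1
  rcases e with ⟨⟨⟨T, i⟩, g⟩, _ | a⟩
  · by_cases hiK : (i : ℕ) < K
    · simp [layered, hiK, hp0]
    · by_cases hg : fin g <;> simp [layered, hiK, hg, hp0]
  · simp only [layered, Option.elim_some, hp]
    ring

/-- The label of an integer circulation of the layered digraph: this is seen with the state as a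
potential. -/
theorem label_flowProj [AddCommGroup X] {L : σ → X} {w : A → X} {F : X}
    (hsucc : ∀ g a, L (succ g a) = L g + w a) (h0 : L g₀ = 0) (hfin : ∀ g, fin g ↔ L g = F)
    {φ : ((τ × Fin (K + 1)) × σ) × Option A → ℤ} (h : (layered G v succ g₀ fin).IsCirc φ) :
    ∑ a, flowProj φ a • w a = returnFlow fin φ • F := by
  have h1 := h.sum_smul fun x : ((τ × Fin (K + 1)) × V) × σ => L x.2
  have h3 := sub_eq_zero.2 h1
  rw [← Finset.sum_sub_distrib] at h3
  rw [sum_flowProj_smul, returnFlow, Finset.sum_smul, ← sub_eq_zero, ← Finset.sum_sub_distrib]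
  refine (Finset.sum_congr rfl fun e _ => ?_).trans h3
  rw [mul_smul, ← smul_sub, ← smul_sub]
  congr 1
  rcases e with ⟨⟨⟨T, i⟩, g⟩, _ | a⟩
  · have hi := i.2
    by_cases hiK : (i : ℕ) < K
    · simp [layered, hiK, IsReturn, hiK.ne]
    · by_cases hg : fin g
      · have : (i : ℕ) = K := by omega
        simp [layered, IsReturn, this, hg, h0, (hfin g).1 hg]
      · simp [layered, hiK, IsReturn, hg]
  · simp [layered, IsReturn, hsucc]

end

end Polytope

/-! ### The hull as a projection of unit flows -/

section Hull

variable {V A σ τ X : Type*} {K : ℕ} [Fintype A] [Fintype σ] [Fintype τ]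
  [DecidableEq A] [DecidableEq σ] [DecidableEq τ] [DecidableEq V] {G : ArcDigraph V A}
  {v : τ → Fin (K + 1) → V} {succ : σ → A → σ} {g₀ : σ} {fin : σ → Prop} [DecidablePred fin]

theorem convex_unitFlows : Convex ℝ (unitFlows G v succ g₀ fin) := by
  rintro x ⟨φ, h1, h2, h3, h4⟩ y ⟨ψ, k1, k2, k3, k4⟩ a b ha hb hab
  refine ⟨a • φ + b • ψ, add_nonneg (smul_nonneg ha h1) (smul_nonneg hb k1),
    (h2.smul a).add (k2.smul b), fun c => ?_, ?_⟩
  · rw [flowProj_add, flowProj_smul, flowProj_smul]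
    simp [h3 c, k3 c]
  · rw [returnFlow_add, returnFlow_smul, returnFlow_smul, h4, k4, mul_one, mul_one, hab]

/-- A circulation of `G` lifts to layer `0`, evenly distributed over the states: every arc permutes
the states. -/
theorem exists_lift_circ (hinj : ∀ a, Function.Injective fun g => succ g a) (T : τ) {z : A → ℝ}
    (h0 : 0 ≤ z) (hz : G.IsCirc z) :
    ∃ φ : ((τ × Fin (K + 1)) × σ) × Option A → ℝ, 0 ≤ φ ∧
      (layered G v succ g₀ fin).IsCirc φ ∧ flowProj φ = z ∧ returnFlow fin φ = 0 := by
  have hs : (Fintype.card σ : ℝ) ≠ 0 := by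
    have : Nonempty σ := ⟨g₀⟩
    exact_mod_cast Fintype.card_ne_zero
  let φ : ((τ × Fin (K + 1)) × σ) × Option A → ℝ := fun e =>
    ∑ g, ∑ a, (z a / Fintype.card σ) * if (((T, 0), g), some a) = e then 1 else 0
  have key : ∀ h : ((τ × Fin (K + 1)) × σ) × Option A → ℝ,
      ∑ e, φ e * h e = ∑ a, z a / Fintype.card σ * ∑ g, h (((T, 0), g), some a) := by
    intro h
    simp only [φ, Finset.sum_mul]
    rw [Finset.sum_comm]
    simp_rw [Finset.mul_sum]
    rw [Finset.sum_comm (s := (Finset.univ : Finset A))]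
    refine Finset.sum_congr rfl fun g _ => ?_
    rw [Finset.sum_comm]
    refine Finset.sum_congr rfl fun a _ => ?_
    simp
  refine ⟨φ, fun e => ?_, ?_, ?_, ?_⟩
  · refine Finset.sum_nonneg fun g _ => Finset.sum_nonneg fun a _ => mul_nonneg ?_ ?_
    · exact div_nonneg (h0 a) (Nat.cast_nonneg _)
    · split_ifs <;> norm_num
  · rw [ArcDigraph.isCirc_iff_potential]
    intro p
    rw [key, key]
    have h := (hz.smul (Fintype.card σ : ℝ)⁻¹).sum_smul fun u => ∑ g, p (((T, 0), u), g)
    simp only [Pi.smul_apply, smul_eq_mul, inv_mul_eq_div] at h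
    refine Eq.trans (Finset.sum_congr rfl fun a _ => ?_) h
    congr 1
    exact ((Finite.injective_iff_bijective.1 (hinj a)).sum_comp
      fun g => p (((T, 0), G.head a), g))
  · ext a
    rw [flowProj, key]
    simp
    field_simp
  · rw [returnFlow, key]
    simp [IsReturn]

variable [AddCommGroup X] {L : σ → X} {w : A → X} {F : X}

/-- A circulation with label `F` is a sum of closed walks, of which fewer than `card σ` already have
total label `F`. These lift to a closed walk of the layered digraph, one walk per layer, with one
return arc; the remaining circulation lifts without return arcs. -/
theorem image_subset_unitFlows [Nonempty V] (hinjL : Function.Injective L)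
    (hsucc : ∀ g a, L (succ g a) = L g + w a) (h0 : L g₀ = 0) (hfin : ∀ g, fin g ↔ L g = F)
    (hcard : Fintype.card σ ≤ K + 1) (hv : ∀ u : Fin K → V, ∃ T, ∀ i, v T i.castSucc = u i) :
    (fun (y : A → ℤ) (a : A) => (y a : ℝ)) '' labelledCirculations G w F ⊆
      unitFlows G v succ g₀ fin := by
  rintro _ ⟨y, ⟨hy0, hyc, hyF⟩, rfl⟩
  obtain ⟨ws, hws, hyws⟩ := hyc.exists_closed_walks hy0
  have hclosed : ∀ l : List A, ∀ x ∈ Set.range L, x + (l.map w).sum ∈ Set.range L := by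
    rintro l _ ⟨g, rfl⟩
    exact ⟨l.foldl succ g, foldl_succ hsucc g l⟩
  obtain ⟨ws', hsub, hlen, hsum⟩ := exists_short_sublist L
    (fun q : V × List A => (q.2.map w).sum) ws ⟨g₀, h0⟩ fun q _ x hx => hclosed q.2 x hx
  have hF : (ws.map fun q => (q.2.map w).sum).sum = F := by
    rw [← hyF]
    have : ∑ a, y a • w a = ((ws.flatMap Prod.snd).map w).sum := by
      rw [Finset.sum_list_map_count, Finset.sum_congr rfl fun a _ => by rw [hyws a]]
      symm
      refine Finset.sum_subset_zero_on_sdiff (Finset.subset_univ _) (fun a ha => ?_) fun a _ => ?_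
      · simp only [Finset.mem_sdiff, Finset.mem_univ, true_and, List.mem_toFinset] at ha
        rw [ArcDigraph.arcCount, List.count_eq_zero_of_not_mem ha]
        simp
      · rw [ArcDigraph.arcCount, natCast_zsmul]
    rw [this]
    clear this hyws hws hsub hsum
    induction ws with
    | nil => simp
    | cons q ws ih => simp [ih]
  obtain ⟨T, hT⟩ := hv fun i =>
    if h : (i : ℕ) < ws'.length then (ws'[(i : ℕ)]).1 else Classical.arbitrary V
  obtain ⟨l, hl, hproj, hret⟩ := exists_lift (G := G) (v := v) (g₀ := g₀) hsucc hfin T K 0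
    (by simp) ws' (by omega) (fun q hq => hws q (hsub.subset hq)) (fun j hj => by
      have := hT ⟨j, by omega⟩
      simp only [hj, dif_pos] at this
      rw [← this]
      congr 1
      ext
      simp) g₀ (by rw [h0, zero_add, hsum, hF])
  have hlc := hl.isCirc (R := ℝ)
  have hlp : flowProj (fun e => (ArcDigraph.arcCount l e : ℝ)) =
      fun a => (ArcDigraph.arcCount (ws'.flatMap Prod.snd) a : ℝ) := by
    ext a
    rw [flowProj_count, hproj]
  have hz0 : 0 ≤ (fun a => (y a : ℝ)) - flowProj fun e => (ArcDigraph.arcCount l e : ℝ) := by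
    intro a
    rw [hlp, Pi.sub_apply, hyws a, Pi.zero_apply, sub_nonneg, Int.cast_natCast]
    have : ArcDigraph.arcCount (ws'.flatMap Prod.snd) a ≤
        ArcDigraph.arcCount (ws.flatMap Prod.snd) a := (hsub.flatMap _).count_le a
    exact Nat.cast_le.2 this
  have hzc : G.IsCirc ((fun a => (y a : ℝ)) - flowProj fun e => (ArcDigraph.arcCount l e : ℝ)) :=
    (hyc.intCast).sub (flowProj_isCirc hlc)
  obtain ⟨φ, k1, k2, k3, k4⟩ := exists_lift_circ (K := K) (v := v) (g₀ := g₀) (fin := fin)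
    (succ := succ) (fun a g h hgh => hinjL (by
      have := congrArg L hgh
      simpa [hsucc] using this)) T hz0 hzc
  refine ⟨(fun e => (ArcDigraph.arcCount l e : ℝ)) + φ, add_nonneg (fun e => Nat.cast_nonneg _) k1,
    hlc.add k2, fun a => ?_, ?_⟩
  · rw [flowProj_add, k3]
    simp
  · rw [returnFlow_add, k4, returnFlow_count, hret]
    simp

/-- Conversely, a flow is a combination of cycles without repeated arcs. A cycle with a return arc
projects to a circulation with label `F`, and any other cycle to a circulation with label `0`, which
is a recession direction of the hull. -/
theorem unitFlows_subset (hinjL : Function.Injective L)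
    (hsucc : ∀ g a, L (succ g a) = L g + w a) (h0 : L g₀ = 0) (hfin : ∀ g, fin g ↔ L g = F) :
    unitFlows G v succ g₀ fin ⊆
      convexHull ℝ ((fun (y : A → ℤ) (a : A) => (y a : ℝ)) '' labelledCirculations G w F) := by
  set S := convexHull ℝ ((fun (y : A → ℤ) (a : A) => (y a : ℝ)) '' labelledCirculations G w F)
    with hS
  have hconv : Convex ℝ S := convex_convexHull _ _
  -- integer circulations with label zero span recession directions
  have hrec : ∀ z ∈ labelledCirculations G w 0, ∀ c : ℝ, 0 ≤ c → ∀ x ∈ S,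
      x + c • (fun a => (z a : ℝ)) ∈ S := by
    rintro z ⟨hz0, hzc, hzw⟩ c hc x hx
    have hsub : S ⊆ (fun x => x + c • fun a => (z a : ℝ)) ⁻¹' S := by
      refine convexHull_min ?_ (hconv.affine_preimage
        (AffineMap.id ℝ (A → ℝ) + AffineMap.const ℝ (A → ℝ) (c • fun a => (z a : ℝ))))
      rintro _ ⟨y, ⟨hy0, hyc, hyF⟩, rfl⟩
      obtain ⟨k, hk⟩ := exists_nat_gt c
      have hk0 : (0 : ℝ) < k := hc.trans_lt hk
      have hmem : (fun a => ((y + (k : ℤ) • z) a : ℝ)) ∈ S := by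
        refine subset_convexHull _ _ ⟨_, ⟨?_, ?_, ?_⟩, rfl⟩
        · exact add_nonneg hy0 (smul_nonneg (Int.natCast_nonneg k) hz0)
        · exact hyc.add (hzc.smul _)
        · simp only [Pi.add_apply, Pi.smul_apply, add_smul, Finset.sum_add_distrib, hyF, smul_assoc,
            ← Finset.smul_sum, hzw, smul_zero, add_zero]
      have := hconv (subset_convexHull _ _ ⟨y, ⟨hy0, hyc, hyF⟩, rfl⟩) hmem
        (a := 1 - c / k) (b := c / k)
        (by rw [sub_nonneg, div_le_one hk0]; exact hk.le) (by positivity) (by ring)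
      rw [Set.mem_preimage]
      convert this using 1
      ext a
      have hck : c / k * k = c := div_mul_cancel₀ c hk0.ne'
      simp only [Pi.add_apply, Pi.smul_apply, smul_eq_mul]
      push_cast
      linear_combination -(z a : ℝ) * hck
    exact hsub hx
  rintro x ⟨φ, hφ0, hφc, hφx, hφ1⟩
  -- `y` is the weighted mean of the cycles with a return arc (meaningless as long as there are none),
  -- and `z` collects the other cycles
  have key : 0 ≤ returnFlow fin φ ∧ ∃ y z : A → ℝ, flowProj φ = returnFlow fin φ • y + z ∧
      (returnFlow fin φ ≠ 0 → y ∈ S) ∧ ∀ x ∈ S, x + z ∈ S := by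
    refine ArcDigraph.IsCirc.induction (P := fun φ => 0 ≤ returnFlow fin φ ∧ ∃ y z : A → ℝ,
      flowProj φ = returnFlow fin φ • y + z ∧ (returnFlow fin φ ≠ 0 → y ∈ S) ∧
        ∀ x ∈ S, x + z ∈ S) ?_ ?_ hφ0 hφc
    · have h1 : returnFlow fin (0 : ((τ × Fin (K + 1)) × σ) × Option A → ℝ) = 0 := by
        simp [returnFlow]
      have h2 : flowProj (0 : ((τ × Fin (K + 1)) × σ) × Option A → ℝ) = 0 := by
        ext a
        simp [flowProj]
      rw [h1, h2]
      exact ⟨le_rfl, 0, 0, by simp, by simp, by simp⟩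
    · rintro φ c u l hc hl hnd ⟨hκ, y, z, hyz, hy, hz⟩
      have hcirc := hl.isCirc (R := ℤ)
      have hlab := label_flowProj hsucc h0 hfin hcirc
      have hp0 : 0 ≤ flowProj (fun e => (ArcDigraph.arcCount l e : ℤ)) := fun a => by
        rw [flowProj_count]
        exact Int.natCast_nonneg _
      have hpc := flowProj_isCirc hcirc
      have hcast : flowProj (fun e => (ArcDigraph.arcCount l e : ℝ)) =
          fun a => ((flowProj (fun e => (ArcDigraph.arcCount l e : ℤ)) a : ℤ) : ℝ) := by
        ext a
        rw [flowProj_count, flowProj_count, Int.cast_natCast]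
      rw [returnFlow_add, returnFlow_smul, flowProj_add, flowProj_smul, returnFlow_count, hcast]
      rw [returnFlow_count] at hlab
      rcases Nat.le_one_iff_eq_zero_or_eq_one.1 (countP_isReturn_le_one hinjL hfin hl hnd) with h | h
      · rw [h] at hlab ⊢
        rw [Nat.cast_zero, mul_zero, add_zero]
        refine ⟨hκ, y, z + c • fun a => ((flowProj (fun e => (ArcDigraph.arcCount l e : ℤ)) a : ℤ) : ℝ),
          ?_, hy, fun x hx => ?_⟩
        · rw [hyz, add_assoc]
        · rw [← add_assoc]
          exact hrec _ ⟨hp0, hpc, by simpa using hlab⟩ c hc.le _ (hz x hx)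
      · rw [h] at hlab ⊢
        rw [Nat.cast_one, mul_one]
        set κ := returnFlow fin φ
        have hpos : 0 < κ + c := by linarith
        set yC : A → ℝ :=
          fun a => ((flowProj (fun e => (ArcDigraph.arcCount l e : ℤ)) a : ℤ) : ℝ) with hyC
        have hyCS : yC ∈ S :=
          subset_convexHull _ _ ⟨_, ⟨hp0, hpc, by simpa using hlab⟩, rfl⟩
        refine ⟨hpos.le, (κ / (κ + c)) • y + (c / (κ + c)) • yC, z, ?_, fun _ => ?_, hz⟩
        · rw [hyz, smul_add, smul_smul, smul_smul, mul_div_cancel₀ _ hpos.ne',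
            mul_div_cancel₀ _ hpos.ne']
          abel
        · by_cases hκ0 : κ = 0
          · rw [hκ0]
            simpa [hc.ne'] using hyCS
          · exact hconv (hy hκ0) hyCS (by positivity) (by positivity) (by field_simp)
  obtain ⟨-, y, z, hyz, hy, hz⟩ := key
  rw [hφ1] at hyz hy
  rw [show x = flowProj φ from funext hφx, hyz, one_smul]
  exact hz y (hy one_ne_zero)

/-- The hull of the labelled circulations is the projection of a flow polyhedron. -/
theorem convexHull_labelledCirculations [Nonempty V] (hinjL : Function.Injective L)
    (hsucc : ∀ g a, L (succ g a) = L g + w a) (h0 : L g₀ = 0) (hfin : ∀ g, fin g ↔ L g = F)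
    (hcard : Fintype.card σ ≤ K + 1) (hv : ∀ u : Fin K → V, ∃ T, ∀ i, v T i.castSucc = u i) :
    convexHull ℝ ((fun (y : A → ℤ) (a : A) => (y a : ℝ)) '' labelledCirculations G w F) =
      unitFlows G v succ g₀ fin :=
  (convexHull_min (image_subset_unitFlows hinjL hsucc h0 hfin hcard hv)
    convex_unitFlows).antisymm (unitFlows_subset hinjL hsucc h0 hfin)

end Hull

/-! ### Programs for vectors and matrices -/

namespace Comp

variable {α : Type} {μ : α → ℕ} {a : α → CVal} {N k l r : α → ℕ}

/-- An expression of the surrounding environment, inside a loop over indices below `N`. -/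
theorem up {b : α → CVal} (h : Comp μ a b) (hN : PolyBdd μ N) :
    Comp (fun p : Σ x, Fin (N x) => μ p.1) (fun p => .cons (.int (p.2 : ℕ)) (a p.1))
      (fun p => b p.1) :=
  (h.inner N).weaken hN.fin

/-- The index of a loop. -/
theorem idx (ha : PolyBdd μ fun x => (a x).size) (hN : PolyBdd μ N) :
    Comp (fun p : Σ x, Fin (N x) => μ p.1) (fun p => .cons (.int (p.2 : ℕ)) (a p.1))
      (fun p => .int (p.2 : ℕ)) :=
  head (ha.reindex Sigma.fst) hN.fin

theorem cast {b c : α → CVal} (h : Comp μ a b) (e : ∀ x, b x = c x) : Comp μ a c :=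
  (congrArg (Comp μ a) (funext e)).mp h

section Nat

variable {u v : α → ℕ} (hu : Comp μ a fun x => .int (u x)) (hv : Comp μ a fun x => .int (v x))
include hu hv

theorem natAdd : Comp μ a fun x => .int ((u x + v x : ℕ)) := (hu.add hv).cast fun x => by simp

theorem natMul : Comp μ a fun x => .int ((u x * v x : ℕ)) := (hu.mul hv).cast fun x => by simp

theorem natDiv : Comp μ a fun x => .int ((u x / v x : ℕ)) := (hu.div hv).cast fun x => by simp

theorem natMod : Comp μ a fun x => .int ((u x % v x : ℕ)) := (hu.mod hv).cast fun x => by simp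

theorem natEqInd : Comp μ a fun x => .int (if u x = v x then 1 else 0) :=
  (hu.eqInd hv).cast fun x => by simp

end Nat

theorem vec (hN : PolyBdd μ N) (hn : Comp μ a fun x => .int (N x)) {b : ∀ x, Fin (N x) → ℤ}
    (hb : Comp (fun p : Σ x, Fin (N x) => μ p.1) (fun p => .cons (.int (p.2 : ℕ)) (a p.1))
      (fun p => .int (b p.1 p.2))) :
    Comp μ a fun x => encodeVec (b x) := tab (b := fun x i => .int (b x i)) hN hn hb

theorem vget {b : ∀ x, Fin (N x) → ℤ} (hl : Comp μ a fun x => encodeVec (b x))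
    {i : ∀ x, Fin (N x)} (hi : Comp μ a fun x => .int (i x : ℕ)) :
    Comp μ a fun x => .int (b x (i x)) := get (b := fun x i => .int (b x i)) hl hi

theorem mat (hk : PolyBdd μ k) (hkn : Comp μ a fun x => .int (k x)) (hl : PolyBdd μ l)
    (hln : Comp μ a fun x => .int (l x)) {M : ∀ x, Matrix (Fin (k x)) (Fin (l x)) ℤ}
    (hb : Comp (fun p : Σ y : Σ x, Fin (k x), Fin (l y.1) => μ p.1.1)
      (fun p => .cons (.int (p.2 : ℕ)) (.cons (.int (p.1.2 : ℕ)) (a p.1.1)))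
      (fun p => .int (M p.1.1 p.1.2 p.2))) :
    Comp μ a fun x => encodeMatrix (M x) :=
  tab (b := fun x i => encodeVec (M x i)) hk hkn
    (vec (b := fun p => M p.1 p.2) (hl.reindex Sigma.fst) (hln.up hk) hb)

theorem mget {M : ∀ x, Matrix (Fin (k x)) (Fin (l x)) ℤ}
    (hM : Comp μ a fun x => encodeMatrix (M x)) {i : ∀ x, Fin (k x)} {j : ∀ x, Fin (l x)}
    (hi : Comp μ a fun x => .int (i x : ℕ)) (hj : Comp μ a fun x => .int (j x : ℕ)) :
    Comp μ a fun x => .int (M x (i x) (j x)) :=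
  vget (b := fun x => M x (i x)) (get (b := fun x i => encodeVec (M x i)) hM hi) hj

theorem matMul {A : ∀ x, Matrix (Fin (k x)) (Fin (l x)) ℤ}
    {B : ∀ x, Matrix (Fin (l x)) (Fin (r x)) ℤ} (hk : PolyBdd μ k)
    (hkn : Comp μ a fun x => .int (k x)) (hl : PolyBdd μ l) (hln : Comp μ a fun x => .int (l x))
    (hr : PolyBdd μ r) (hrn : Comp μ a fun x => .int (r x))
    (hA : Comp μ a fun x => encodeMatrix (A x)) (hB : Comp μ a fun x => encodeMatrix (B x)) :
    Comp μ a fun x => encodeMatrix (A x * B x) := by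
  have ha := hA.bdd_left
  have hr' : PolyBdd (fun p : Σ x, Fin (k x) => μ p.1) fun p => r p.1 := hr.reindex Sigma.fst
  have hl' : PolyBdd (fun p : Σ y : Σ x, Fin (k x), Fin (r y.1) => μ p.1.1)
      fun p => l p.1.1 := (hl.reindex Sigma.fst).reindex Sigma.fst
  refine mat hk hkn hr hrn (M := fun x => A x * B x) ?_
  have hi := ((idx ha hk).up hr').up hl'
  have hj := (idx (idx ha hk).bdd_left hr').up hl'
  have hq := idx (idx (idx ha hk).bdd_left hr').bdd_left hl'
  exact sum (b := fun p q => A p.1.1 p.1.2 q * B p.1.1 q p.2) hl' ((hln.up hk).up hr')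
    ((mget
      (((hA.up hk).up hr').up hl') hi hq).mul
      (mget
      (((hB.up hk).up hr').up hl') hq hj))

theorem mulVec {A : ∀ x, Matrix (Fin (k x)) (Fin (l x)) ℤ} {v : ∀ x, Fin (l x) → ℤ}
    (hk : PolyBdd μ k) (hkn : Comp μ a fun x => .int (k x)) (hl : PolyBdd μ l)
    (hln : Comp μ a fun x => .int (l x)) (hA : Comp μ a fun x => encodeMatrix (A x))
    (hv : Comp μ a fun x => encodeVec (v x)) :
    Comp μ a fun x => encodeVec ((A x).mulVec (v x)) := by
  have ha := hA.bdd_left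
  have hl' : PolyBdd (fun p : Σ x, Fin (k x) => μ p.1) fun p => l p.1 := hl.reindex Sigma.fst
  have hq := idx (idx ha hk).bdd_left hl'
  exact vec hk hkn (sum (b := fun p q => A p.1 p.2 q * v p.1 q) hl' (hln.up hk)
    ((mget
      ((hA.up hk).up hl') ((idx ha hk).up hl') hq).mul
      (vget ((hv.up hk).up hl') hq)))

theorem trace {A : ∀ x, Matrix (Fin (k x)) (Fin (k x)) ℤ} (hk : PolyBdd μ k)
    (hkn : Comp μ a fun x => .int (k x)) (hA : Comp μ a fun x => encodeMatrix (A x)) :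
    Comp μ a fun x => .int (A x).trace :=
  sum (b := fun x i => A x i i) hk hkn (mget (hA.up hk) (idx hA.bdd_left hk) (idx hA.bdd_left hk))

theorem matSubSmulOne {A : ∀ x, Matrix (Fin (k x)) (Fin (k x)) ℤ} {c : α → ℤ} (hk : PolyBdd μ k)
    (hkn : Comp μ a fun x => .int (k x)) (hA : Comp μ a fun x => encodeMatrix (A x))
    (hc : Comp μ a fun x => .int (c x)) :
    Comp μ a fun x => encodeMatrix (A x - c x • 1) := by
  have ha := hA.bdd_left
  have hk' : PolyBdd (fun p : Σ x, Fin (k x) => μ p.1) fun p => k p.1 := hk.reindex Sigma.fst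
  have hi := (idx ha hk).up hk'
  have hj := idx (idx ha hk).bdd_left hk'
  refine mat hk hkn hk hkn (M := fun x => A x - c x • 1) ?_
  refine ((mget
    ((hA.up hk).up hk') hi hj).sub (((hc.up hk).up hk').mul (hi.natEqInd hj))).cast fun p => ?_
  rw [Matrix.sub_apply, Matrix.smul_apply, Matrix.one_apply, smul_eq_mul]
  simp only [Fin.ext_iff]

/-- The indicator of an equation between vectors, as a sum of squares. -/
theorem vecEqInd {u v : ∀ x, Fin (N x) → ℤ} (hN : PolyBdd μ N)
    (hn : Comp μ a fun x => .int (N x)) (hu : Comp μ a fun x => encodeVec (u x))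
    (hv : Comp μ a fun x => encodeVec (v x)) :
    Comp μ a fun x => .int (if u x = v x then 1 else 0) := by
  have ha := hu.bdd_left
  have hi := idx ha hN
  have hd := (vget (hu.up hN) hi).sub (vget (hv.up hN) hi)
  refine ((sum (b := fun x i => (u x i - v x i) * (u x i - v x i)) hN hn (hd.mul hd)).eqInd
    (const ha 0)).cast fun x => ?_
  congr 1
  refine if_congr ?_ rfl rfl
  rw [Finset.sum_eq_zero_iff_of_nonneg fun i _ => mul_self_nonneg _, funext_iff]
  simp [sub_eq_zero]

end Comp

/-! ### Sizes of encodings -/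

theorem size_encodeVec_le {k B : ℕ} {v : Fin k → ℤ} (h : ∀ i, (v i).natAbs.size ≤ B) :
    (encodeVec v).size ≤ 1 + k * (B + 2) := by
  refine (CVal.size_ofList_le (B := B + 1) fun w hw => ?_).trans (by simp)
  obtain ⟨i, rfl⟩ := List.mem_ofFn.1 hw
  have := h i
  simp only [CVal.size]
  omega

theorem size_encodeMatrix_le {k l B : ℕ} {M : Matrix (Fin k) (Fin l) ℤ}
    (h : ∀ i j, (M i j).natAbs.size ≤ B) :
    (encodeMatrix M).size ≤ 1 + k * (1 + l * (B + 2) + 1) := by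
  refine (CVal.size_ofList_le (B := 1 + l * (B + 2)) fun w hw => ?_).trans (by simp)
  obtain ⟨i, rfl⟩ := List.mem_ofFn.1 hw
  exact size_encodeVec_le (h i)

theorem le_size_ofList {l : List CVal} {v : CVal} (h : v ∈ l) : v.size ≤ (CVal.ofList l).size := by
  induction l with
  | nil => simp at h
  | cons w l ih =>
    simp only [CVal.ofList, CVal.size]
    rcases List.mem_cons.1 h with rfl | h
    · omega
    · have := ih h
      omega

theorem size_le_encodeVec {k : ℕ} (v : Fin k → ℤ) (i : Fin k) :
    (v i).natAbs.size ≤ (encodeVec v).size := by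
  have := le_size_ofList (List.mem_ofFn.2 ⟨i, rfl⟩ : CVal.int (v i) ∈ List.ofFn fun i => .int (v i))
  rw [CVal.size] at this
  exact (Nat.le_add_left _ _).trans this

theorem size_le_encodeMatrix {k l : ℕ} (M : Matrix (Fin k) (Fin l) ℤ) (i : Fin k) (j : Fin l) :
    (M i j).natAbs.size ≤ (encodeMatrix M).size :=
  (size_le_encodeVec (M i) j).trans (le_size_ofList (List.mem_ofFn.2 ⟨i, rfl⟩))

theorem length_le_encodeVec {k : ℕ} (v : Fin k → ℤ) : k ≤ (encodeVec v).size := by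
  simpa [encodeVec] using CVal.length_le_size_ofList (List.ofFn fun i => CVal.int (v i))

theorem length_le_encodeMatrix {k l : ℕ} (M : Matrix (Fin k) (Fin l) ℤ) :
    k ≤ (encodeMatrix M).size := by
  simpa [encodeMatrix] using CVal.length_le_size_ofList (List.ofFn fun i => encodeVec (M i))

/-! ### The inequalities of the formulation -/

section Rows

variable {V A σ τ : Type*} {K : ℕ} [DecidableEq A] [DecidableEq σ] [DecidableEq τ] [DecidableEq V]
  (D : ArcDigraph (((τ × Fin (K + 1)) × V) × σ) (((τ × Fin (K + 1)) × σ) × Option A))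
  (fin : σ → Prop) [DecidablePred fin]

/-- Coefficients of the flow on the arc `e'` in the inequality with the number `c` at the arc `e`:
nonnegativity of the flow on `e`; at the tail of `e`, no more flow leaves than arrives; the last two
give the value of the projection at the arc of `G` below `e`, or one unit of return flow. -/
def flowCoeff (e : ((τ × Fin (K + 1)) × σ) × Option A) (c : Fin 4)
    (e' : ((τ × Fin (K + 1)) × σ) × Option A) : ℤ :=
  let P : ℤ := if e.2 = none then (if IsReturn A fin e' then 1 else 0)
    else if e'.2 = e.2 then 1 else 0
  if (c : ℕ) = 0 then -(if e' = e then 1 else 0)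
  else if (c : ℕ) = 1 then
    (if D.tail e' = D.tail e then 1 else 0) - (if D.head e' = D.tail e then 1 else 0)
  else if (c : ℕ) = 2 then -P
  else P

/-- Coefficients of the variables on the arcs of `G`. -/
def arcCoeff (e : ((τ × Fin (K + 1)) × σ) × Option A) (c : Fin 4) (a : A) : ℤ :=
  let P : ℤ := if e.2 = some a then 1 else 0
  if (c : ℕ) ≤ 1 then 0 else if (c : ℕ) = 2 then P else -P

/-- Right-hand sides. -/
def rhsCoeff (e : ((τ × Fin (K + 1)) × σ) × Option A) (c : Fin 4) : ℤ :=
  let P : ℤ := if e.2 = none then 1 else 0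
  if (c : ℕ) ≤ 1 then 0 else if (c : ℕ) = 2 then -P else P

variable [Fintype V] [Fintype A] [Fintype σ] [Fintype τ]

/-- If at no node more flow leaves than arrives, then the flow is a circulation. -/
theorem ArcDigraph.isCirc_of_le {N E : Type*} [Fintype N] [DecidableEq N] [Fintype E]
    (D : ArcDigraph N E) {φ : E → ℝ} (h0 : 0 ≤ φ)
    (h : ∀ e, ∑ e', φ e' * ((if D.tail e' = D.tail e then 1 else 0) -
      (if D.head e' = D.tail e then 1 else 0)) ≤ 0) : D.IsCirc φ := by
  have hle : ∀ u ∈ (Finset.univ : Finset N), ∑ e', φ e' * ((if D.tail e' = u then 1 else 0) -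
      (if D.head e' = u then 1 else 0)) ≤ 0 := by
    intro u _
    by_cases hu : ∃ e, D.tail e = u
    · obtain ⟨e, rfl⟩ := hu
      exact h e
    · push Not at hu
      refine Finset.sum_nonpos fun e _ => mul_nonpos_of_nonneg_of_nonpos (h0 e) ?_
      rw [if_neg (hu e)]
      split_ifs <;> norm_num
  have hsum : ∑ u, ∑ e', φ e' * ((if D.tail e' = u then 1 else 0) -
      (if D.head e' = u then 1 else 0)) = 0 := by
    rw [Finset.sum_comm]
    refine Finset.sum_eq_zero fun e _ => ?_
    rw [← Finset.mul_sum, Finset.sum_sub_distrib]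
    simp
  intro u
  exact (Finset.sum_eq_zero_iff_of_nonpos hle).1 hsum u (Finset.mem_univ u)

theorem mem_unitFlows_iff {G : ArcDigraph V A} {v : τ → Fin (K + 1) → V} {succ : σ → A → σ}
    {g₀ : σ} [Nonempty τ] {x : A → ℝ} :
    x ∈ unitFlows G v succ g₀ fin ↔ ∃ φ : ((τ × Fin (K + 1)) × σ) × Option A → ℝ, ∀ e c,
      ∑ a, (arcCoeff e c a : ℝ) * x a +
        ∑ e', (flowCoeff (layered G v succ g₀ fin) fin e c e' : ℝ) * φ e' ≤ rhsCoeff e c := by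
  have r0 : ∀ (φ : ((τ × Fin (K + 1)) × σ) × Option A → ℝ) e,
      ∑ a, (arcCoeff e 0 a : ℝ) * x a +
        ∑ e', (flowCoeff (layered G v succ g₀ fin) fin e 0 e' : ℝ) * φ e' ≤ rhsCoeff e 0 ↔
      0 ≤ φ e := by
    intro φ e
    simp [arcCoeff, flowCoeff, rhsCoeff]
  have r1 : ∀ (φ : ((τ × Fin (K + 1)) × σ) × Option A → ℝ) e,
      ∑ a, (arcCoeff e 1 a : ℝ) * x a +
        ∑ e', (flowCoeff (layered G v succ g₀ fin) fin e 1 e' : ℝ) * φ e' ≤ rhsCoeff e 1 ↔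
      ∑ e', φ e' * ((if (layered G v succ g₀ fin).tail e' = (layered G v succ g₀ fin).tail e
        then 1 else 0) - (if (layered G v succ g₀ fin).head e' = (layered G v succ g₀ fin).tail e
        then 1 else 0)) ≤ 0 := by
    intro φ e
    simp [arcCoeff, flowCoeff, rhsCoeff, mul_comm]
  have r2 : ∀ (φ : ((τ × Fin (K + 1)) × σ) × Option A → ℝ) y,
      (∑ a, (arcCoeff (y, none) 2 a : ℝ) * x a + ∑ e', (flowCoeff (layered G v succ g₀ fin)
        fin (y, none) 2 e' : ℝ) * φ e' ≤ rhsCoeff ((y, none) : _ × Option A) 2 ↔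
        1 ≤ returnFlow fin φ) ∧
      (∑ a, (arcCoeff (y, none) 3 a : ℝ) * x a + ∑ e', (flowCoeff (layered G v succ g₀ fin)
        fin (y, none) 3 e' : ℝ) * φ e' ≤ rhsCoeff ((y, none) : _ × Option A) 3 ↔
        returnFlow fin φ ≤ 1) := by
    intro φ y
    constructor <;> simp [arcCoeff, flowCoeff, rhsCoeff, returnFlow]
  have r3 : ∀ (φ : ((τ × Fin (K + 1)) × σ) × Option A → ℝ) y b,
      (∑ a, (arcCoeff (y, some b) 2 a : ℝ) * x a + ∑ e', (flowCoeff (layered G v succ g₀ fin)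
        fin (y, some b) 2 e' : ℝ) * φ e' ≤ rhsCoeff (y, some b) 2 ↔ x b ≤ flowProj φ b) ∧
      (∑ a, (arcCoeff (y, some b) 3 a : ℝ) * x a + ∑ e', (flowCoeff (layered G v succ g₀ fin)
        fin (y, some b) 3 e' : ℝ) * φ e' ≤ rhsCoeff (y, some b) 3 ↔ flowProj φ b ≤ x b) := by
    intro φ y b
    constructor <;> simp [arcCoeff, flowCoeff, rhsCoeff, flowProj]
  constructor
  · rintro ⟨φ, h0, hc, hx, h1⟩
    refine ⟨φ, fun e c => ?_⟩
    have hcases : c = 0 ∨ c = 1 ∨ c = 2 ∨ c = 3 := by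
      fin_cases c <;> simp
    rcases hcases with rfl | rfl | rfl | rfl
    · exact (r0 φ e).2 (h0 e)
    · exact (r1 φ e).2 (hc _).le
    · rcases e with ⟨y, _ | b⟩
      · exact (r2 φ y).1.2 h1.ge
      · exact (r3 φ y b).1.2 (hx b).le
    · rcases e with ⟨y, _ | b⟩
      · exact (r2 φ y).2.2 h1.le
      · exact (r3 φ y b).2.2 (hx b).ge
  · rintro ⟨φ, h⟩
    have h0 : 0 ≤ φ := fun e => (r0 φ e).1 (h e 0)
    let y : (τ × Fin (K + 1)) × σ := ((Classical.arbitrary τ, 0), g₀)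
    exact ⟨φ, h0, ArcDigraph.isCirc_of_le _ h0 fun e => (r1 φ e).1 (h e 1),
      fun b => le_antisymm ((r3 φ y b).1.1 (h _ 2)) ((r3 φ y b).2.1 (h _ 3)),
      le_antisymm ((r2 φ y).2.1 (h _ 3)) ((r2 φ y).1.1 (h _ 2))⟩

end Rows

/-- The numbering of the arcs of the layered digraph. -/
def arcEquiv (N K s m : ℕ) : ((Fin N × Fin (K + 1)) × Fin s) × Option (Fin m) ≃
    Fin (((N * (K + 1)) * s) * (m + 1)) :=
  ((((finProdFinEquiv.prodCongr (Equiv.refl _)).trans finProdFinEquiv).prodCongr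
    finSuccEquivLast.symm).trans finProdFinEquiv)

section Numbered

variable {N K s m n : ℕ} (G : ArcDigraph (Fin n) (Fin m)) (v : Fin N → Fin (K + 1) → Fin n)
  (succ : Fin s → Fin m → Fin s) (g₀ : Fin s) (fin : Fin s → Prop) [DecidablePred fin]

/-- The matrix of the flow variables. Its row `r` belongs to the arc `r / 4` and to the inequality
with the number `r % 4`. -/
def flowMatrix : Matrix (Fin (((N * (K + 1)) * s * (m + 1)) * 4))
    (Fin ((N * (K + 1)) * s * (m + 1))) ℤ := fun r j =>
  flowCoeff (layered G v succ g₀ fin) fin ((arcEquiv N K s m).symm r.divNat) r.modNat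
    ((arcEquiv N K s m).symm j)

/-- The matrix of the original variables. -/
def arcMatrix (N K s m : ℕ) : Matrix (Fin (((N * (K + 1)) * s * (m + 1)) * 4)) (Fin m) ℤ :=
  fun r a => arcCoeff ((arcEquiv N K s m).symm r.divNat) r.modNat a

/-- The right-hand side. -/
def rhsVec (N K s m : ℕ) : Fin (((N * (K + 1)) * s * (m + 1)) * 4) → ℤ :=
  fun r => rhsCoeff ((arcEquiv N K s m).symm r.divNat) r.modNat

theorem isExtendedFormulation_unitFlows [NeZero N] :
    IsExtendedFormulation (unitFlows G v succ g₀ fin)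
      ((arcMatrix N K s m).map (Int.cast : ℤ → ℝ))
      ((flowMatrix G v succ g₀ fin).map (Int.cast : ℤ → ℝ))
      (fun i => (rhsVec N K s m i : ℝ)) := by
  ext x
  rw [mem_unitFlows_iff]
  have hrow : ∀ (y : Fin ((N * (K + 1)) * s * (m + 1)) → ℝ) e c,
      (((arcMatrix N K s m).map (Int.cast : ℤ → ℝ)).mulVec x +
        ((flowMatrix G v succ g₀ fin).map (Int.cast : ℤ → ℝ)).mulVec y)
          (finProdFinEquiv (arcEquiv N K s m e, c)) =
      ∑ a, (arcCoeff e c a : ℝ) * x a + ∑ e', (flowCoeff (layered G v succ g₀ fin) fin e c e' : ℝ) *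
        y (arcEquiv N K s m e') := by
    intro y e c
    have h := finProdFinEquiv.symm_apply_apply (arcEquiv N K s m e, c)
    rw [finProdFinEquiv_symm_apply, Prod.mk.injEq] at h
    simp only [Pi.add_apply, Matrix.mulVec, dotProduct, Matrix.map_apply, arcMatrix, flowMatrix,
      h.1, h.2, Equiv.symm_apply_apply]
    congr 1
    rw [← (arcEquiv N K s m).sum_comp]
    simp
  have hrhs : ∀ e c, rhsVec N K s m (finProdFinEquiv (arcEquiv N K s m e, c)) = rhsCoeff e c := by
    intro e c
    have h := finProdFinEquiv.symm_apply_apply (arcEquiv N K s m e, c)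
    rw [finProdFinEquiv_symm_apply, Prod.mk.injEq] at h
    simp only [rhsVec, h.1, h.2, Equiv.symm_apply_apply]
  have hall : ∀ y : Fin ((N * (K + 1)) * s * (m + 1)) → ℝ,
      (((arcMatrix N K s m).map (Int.cast : ℤ → ℝ)).mulVec x +
        ((flowMatrix G v succ g₀ fin).map (Int.cast : ℤ → ℝ)).mulVec y ≤
          fun i => (rhsVec N K s m i : ℝ)) ↔
      ∀ e c, ∑ a, (arcCoeff e c a : ℝ) * x a +
        ∑ e', (flowCoeff (layered G v succ g₀ fin) fin e c e' : ℝ) *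
          y (arcEquiv N K s m e') ≤ rhsCoeff e c := by
    intro y
    constructor
    · intro h e c
      have := h (finProdFinEquiv (arcEquiv N K s m e, c))
      rw [hrow] at this
      dsimp only at this
      rwa [hrhs] at this
    · intro h r
      obtain ⟨⟨j, c⟩, rfl⟩ := finProdFinEquiv.surjective r
      obtain ⟨e, rfl⟩ := (arcEquiv N K s m).surjective j
      rw [hrow]
      dsimp only
      rw [hrhs]
      exact h e c
  constructor
  · rintro ⟨φ, h⟩
    refine ⟨fun j => φ ((arcEquiv N K s m).symm j), (hall _).2 fun e c => ?_⟩
    simpa using h e c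
  · rintro ⟨y, h⟩
    exact ⟨fun e => y (arcEquiv N K s m e), (hall y).1 h⟩

end Numbered

/-! ### Enumeration of the group generated by the labels -/

/-- Vectors of residues modulo `Δ`, represented by remainders. -/
def vecMod {d : ℕ} (Δ : ℕ) (v : Fin d → ℤ) : Fin d → ℤ := fun i => v i % Δ

/-- The candidate number `p`: a multiple of `w` added to a member of `l`. -/
def candidate {d : ℕ} (Δ : ℕ) (l : List (Fin d → ℤ)) (w : Fin d → ℤ) (p : ℕ) : Fin d → ℤ :=
  vecMod Δ (l.getD (p % l.length) 0 + ((p / l.length : ℕ) : ℤ) • w)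

/-- The list of the first `p` candidates, without repetitions. -/
def collect {d : ℕ} (Δ : ℕ) (l : List (Fin d → ℤ)) (w : Fin d → ℤ) : ℕ → List (Fin d → ℤ)
  | 0 => []
  | p + 1 =>
    if candidate Δ l w p ∈ collect Δ l w p then collect Δ l w p
    else candidate Δ l w p :: collect Δ l w p

/-- All sums of a member of `l` and one of the first `Δ` multiples of `w`. -/
def closeUp {d : ℕ} (Δ : ℕ) (l : List (Fin d → ℤ)) (w : Fin d → ℤ) : List (Fin d → ℤ) :=
  collect Δ l w (Δ * l.length)

/-- The elements of the group generated by the given residue vectors. -/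
def groupList {d : ℕ} (Δ : ℕ) (ws : List (Fin d → ℤ)) : List (Fin d → ℤ) :=
  ws.foldl (closeUp Δ) [0]

section

variable {d Δ : ℕ}

theorem vecMod_vecMod (v : Fin d → ℤ) : vecMod Δ (vecMod Δ v) = vecMod Δ v := by
  ext i
  simp [vecMod]

theorem vecMod_eq_iff {u v : Fin d → ℤ} :
    vecMod Δ u = vecMod Δ v ↔ (fun i => (u i : ZMod Δ)) = fun i => (v i : ZMod Δ) := by
  simp only [funext_iff, vecMod, ZMod.intCast_eq_intCast_iff, Int.ModEq]

theorem vecMod_add_vecMod (u v : Fin d → ℤ) : vecMod Δ (vecMod Δ u + v) = vecMod Δ (u + v) := by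
  ext i
  simp [vecMod]

theorem collect_nodup (l : List (Fin d → ℤ)) (w : Fin d → ℤ) (p : ℕ) : (collect Δ l w p).Nodup := by
  induction p with
  | zero => simp [collect]
  | succ p ih =>
    rw [collect]
    split_ifs with h
    · exact ih
    · exact List.nodup_cons.2 ⟨h, ih⟩

theorem length_collect_le (l : List (Fin d → ℤ)) (w : Fin d → ℤ) (p : ℕ) :
    (collect Δ l w p).length ≤ p := by
  induction p with
  | zero => simp [collect]
  | succ p ih =>
    rw [collect]
    split_ifs with h
    · omega
    · simpa using ih

theorem mem_collect {l : List (Fin d → ℤ)} {w v : Fin d → ℤ} {p : ℕ} :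
    v ∈ collect Δ l w p ↔ ∃ q < p, v = candidate Δ l w q := by
  induction p with
  | zero => simp [collect]
  | succ p ih =>
    have hs : (∃ q < p + 1, v = candidate Δ l w q) ↔
        v = candidate Δ l w p ∨ ∃ q < p, v = candidate Δ l w q := by
      constructor
      · rintro ⟨q, hq, h⟩
        rcases Nat.lt_succ_iff_lt_or_eq.1 hq with hq | rfl
        · exact .inr ⟨q, hq, h⟩
        · exact .inl h
      · rintro (h | ⟨q, hq, h⟩)
        · exact ⟨p, by omega, h⟩
        · exact ⟨q, by omega, h⟩
    rw [hs, collect, ← ih]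
    split_ifs with h
    · constructor
      · exact .inr
      · rintro (rfl | h')
        · exact h
        · exact h'
    · rw [List.mem_cons]

theorem mem_closeUp {l : List (Fin d → ℤ)} {w v : Fin d → ℤ} :
    v ∈ closeUp Δ l w ↔ ∃ u ∈ l, ∃ k < Δ, v = vecMod Δ (u + (k : ℤ) • w) := by
  rw [closeUp, mem_collect]
  constructor
  · rintro ⟨q, hq, rfl⟩
    have hl : 0 < l.length := Nat.pos_of_ne_zero fun h => by simp [h] at hq
    have hm := Nat.mod_lt q hl
    refine ⟨l[q % l.length], List.getElem_mem hm, q / l.length, ?_, ?_⟩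
    · exact Nat.div_lt_of_lt_mul (by rwa [mul_comm])
    · rw [candidate, List.getD_eq_getElem _ _ hm]
  · rintro ⟨u, hu, k, hk, rfl⟩
    obtain ⟨i, hi, rfl⟩ := List.getElem_of_mem hu
    refine ⟨i + l.length * k, ?_, ?_⟩
    · calc i + l.length * k < l.length * (k + 1) := by rw [mul_add]; omega
        _ ≤ Δ * l.length := by rw [mul_comm]; exact Nat.mul_le_mul_right _ hk
    · rw [candidate, Nat.add_mul_mod_self_left, Nat.mod_eq_of_lt hi,
        Nat.add_mul_div_left _ _ (by omega), Nat.div_eq_of_lt hi, zero_add,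
        List.getD_eq_getElem _ _ hi]

/-- Invariants of the enumeration. The predicate `P` stands for a subgroup which contains the
given labels. -/
theorem groupList_spec (hΔ : Δ ≠ 0) {P : (Fin d → ℤ) → Prop} (h0 : P 0)
    (hadd : ∀ u v, P u → P v → P (u + v)) (hmod : ∀ u, P u → P (vecMod Δ u))
    (ws : List (Fin d → ℤ)) (hws : ∀ w ∈ ws, P w) :
    (groupList Δ ws).Nodup ∧ 0 ∈ groupList Δ ws ∧
      (∀ v ∈ groupList Δ ws, vecMod Δ v = v ∧ P v) ∧
      ∀ v ∈ groupList Δ ws, ∀ w ∈ ws, vecMod Δ (v + w) ∈ groupList Δ ws := by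
  induction ws using List.reverseRecOn with
  | nil =>
    simp only [groupList, List.foldl_nil, List.nodup_singleton, List.mem_singleton, forall_eq,
      List.not_mem_nil, false_imp_iff, implies_true, and_true, true_and]
    exact ⟨by ext i; simp [vecMod], h0⟩
  | append_singleton ws w ih =>
    obtain ⟨-, i2, i3, i4⟩ := ih fun w' hw => hws w' (by simp [hw])
    have hw : P w := hws w (by simp)
    have e : groupList Δ (ws ++ [w]) = closeUp Δ (groupList Δ ws) w := by simp [groupList]
    have hsmul : ∀ k : ℕ, P ((k : ℤ) • w) := by
      intro k
      induction k with
      | zero => simpa using h0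
      | succ k ih =>
        push_cast
        rw [add_smul, one_smul]
        exact hadd _ _ ih hw
    rw [e]
    refine ⟨collect_nodup _ _ _, ?_, ?_, ?_⟩
    · exact mem_closeUp.2 ⟨0, i2, 0, by omega, by simp [vecMod, funext_iff]⟩
    · intro v hv
      obtain ⟨u, hu, k, hk, rfl⟩ := mem_closeUp.1 hv
      exact ⟨vecMod_vecMod _, hmod _ (hadd _ _ (i3 u hu).2 (hsmul k))⟩
    · intro v hv w' hw'
      obtain ⟨u, hu, k, hk, rfl⟩ := mem_closeUp.1 hv
      rw [vecMod_add_vecMod, mem_closeUp]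
      rcases List.mem_append.1 hw' with hw' | hw'
      · refine ⟨_, i4 u hu w' hw', k, hk, ?_⟩
        rw [vecMod_add_vecMod]
        congr 1
        abel
      · rw [List.mem_singleton] at hw'
        subst hw'
        by_cases hk' : k + 1 < Δ
        · refine ⟨u, hu, k + 1, hk', ?_⟩
          push_cast
          rw [add_smul, one_smul, add_assoc]
        · -- the multiple of `w'` by `k + 1 = Δ` vanishes modulo `Δ`
          refine ⟨u, hu, 0, by omega, ?_⟩
          have hkΔ : k + 1 = Δ := by omega
          rw [vecMod_eq_iff]
          ext i
          have : ((k : ZMod Δ) + 1) = 0 := by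
            have := ZMod.natCast_self Δ
            rw [← hkΔ] at this ⊢
            exact_mod_cast this
          simp only [Pi.add_apply, Pi.smul_apply, smul_eq_mul]
          push_cast
          linear_combination (w' i : ZMod Δ) * this

/-- Residues with respect to the lattice `H ℤᵈ`, represented by remainders: vectors are multiplied by
the adjugate and reduced modulo `Δ`. -/
def residueVec (H : Matrix (Fin d) (Fin d) ℤ) (Δ : ℕ) (x : Fin d → ℤ) : Fin d → ℤ :=
  vecMod Δ ((pseudoAdj H).mulVec x)

theorem cast_residueVec (H : Matrix (Fin d) (Fin d) ℤ) (x : Fin d → ℤ) :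
    (fun i => (residueVec H Δ x i : ZMod Δ)) = latticeResidue H Δ x := by
  exact vecMod_eq_iff.1 (vecMod_vecMod _)

/-- The group generated by residues is enumerated by at most `Δ` vectors. -/
theorem length_groupList_le {H : Matrix (Fin d) (Fin d) ℤ} (hΔ : Δ = H.det.natAbs) (h0 : Δ ≠ 0)
    {ws : List (Fin d → ℤ)} (hws : ∀ w ∈ ws, ∃ x, w = residueVec H Δ x) :
    (groupList Δ ws).length ≤ Δ := by
  obtain ⟨h1, -, h3, -⟩ := groupList_spec h0
    (P := fun v => ∃ x, vecMod Δ v = residueVec H Δ x) ⟨0, by simp [residueVec]⟩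
    (by
      rintro u v ⟨x, hx⟩ ⟨y, hy⟩
      refine ⟨x + y, ?_⟩
      rw [residueVec, vecMod_eq_iff] at hx hy ⊢
      ext i
      have hxi := congrFun hx i
      have hyi := congrFun hy i
      simp only [Matrix.mulVec_add, Pi.add_apply] at hxi hyi ⊢
      push_cast
      rw [hxi, hyi])
    (by
      rintro u ⟨x, hx⟩
      exact ⟨x, by rw [vecMod_vecMod, hx]⟩)
    ws (by
      intro w hw
      obtain ⟨x, rfl⟩ := hws w hw
      exact ⟨x, by rw [residueVec, vecMod_vecMod]⟩)
  have h4 : ∀ g : Fin (groupList Δ ws).length, ∃ x, (groupList Δ ws)[g] = residueVec H Δ x := by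
    intro g
    obtain ⟨k1, x, k2⟩ := h3 _ (List.getElem_mem g.2)
    exact ⟨x, k1.symm.trans k2⟩
  choose x hx using h4
  refine card_le_of_latticeResidue hΔ h0 x fun g h hgh => ?_
  simp only [← cast_residueVec] at hgh
  rw [← vecMod_eq_iff, ← hx, ← hx] at hgh
  exact Fin.ext (h1.getElem_inj_iff.1 ((h3 _ (List.getElem_mem g.2)).1.symm.trans
    (hgh.trans (h3 _ (List.getElem_mem h.2)).1)))

end

/-! ### Programs for the recursion and for the enumeration -/

theorem natAbs_mulSum_le {d c e : ℕ} {u v : Fin d → ℤ} (hu : ∀ i, (u i).natAbs ≤ c)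
    (hv : ∀ i, (v i).natAbs ≤ e) : (∑ i, u i * v i).natAbs ≤ d * (c * e) := by
  refine (Int.natAbs_sum_le _ _).trans ?_
  refine (Finset.sum_le_card_nsmul _ _ (c * e) fun i _ => ?_).trans (by simp)
  rw [Int.natAbs_mul]
  exact Nat.mul_le_mul (hu i) (hv i)

/-- The numbers in the Faddeev–LeVerrier recursion have polynomially many digits: every round
multiplies the bound by a constant. -/
theorem natAbs_faddeev_le {d B : ℕ} {A : Matrix (Fin d) (Fin d) ℤ} (hd : d ≤ 2 ^ B)
    (hA : ∀ i j, (A i j).natAbs ≤ 2 ^ B) (k : ℕ) :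
    (∀ i j, ((faddeev A k).1 i j).natAbs ≤ 2 ^ (k * (5 * B + 1))) ∧
      (faddeev A k).2.natAbs ≤ 2 ^ (k * (5 * B + 1)) := by
  induction k with
  | zero => simp [faddeev]
  | succ k ih =>
    set E := 2 ^ (k * (5 * B + 1))
    have h1 : ∀ i j, ((faddeev A (k + 1)).1 i j).natAbs ≤ 2 ^ (2 * B + 1) * E := by
      intro i j
      simp only [faddeev, Matrix.sub_apply, Matrix.smul_apply, Matrix.mul_apply, smul_eq_mul]
      have e1 := natAbs_mulSum_le (hA i) fun l => ih.1 l j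
      have e2 : ((faddeev A k).2 * (1 : Matrix (Fin d) (Fin d) ℤ) i j).natAbs ≤ E := by
        rw [Matrix.one_apply]
        split_ifs
        · simpa using ih.2
        · simp
      have e3 : d * (2 ^ B * E) ≤ 2 ^ B * (2 ^ B * E) := Nat.mul_le_mul_right _ hd
      have e4 : E ≤ 2 ^ B * (2 ^ B * E) := by
        rw [← mul_assoc]
        exact Nat.le_mul_of_pos_left _ (by positivity)
      have e5 : 2 ^ (2 * B + 1) * E = 2 * (2 ^ B * (2 ^ B * E)) := by ring
      omega
    have h2 : (faddeev A (k + 1)).2.natAbs ≤ 2 ^ (5 * B + 1) * E := by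
      have e1 : (faddeev A (k + 1)).2.natAbs ≤ (A * (faddeev A (k + 1)).1).trace.natAbs := by
        zify
        exact Int.abs_ediv_le_abs _ _
      refine e1.trans ((Int.natAbs_sum_le _ _).trans ?_)
      refine (Finset.sum_le_card_nsmul _ _ (d * (2 ^ B * (2 ^ (2 * B + 1) * E)))
        fun i _ => ?_).trans ?_
      · rw [Matrix.diag_apply, Matrix.mul_apply]
        exact natAbs_mulSum_le (hA i) fun l => h1 l i
      · rw [Finset.card_univ, Fintype.card_fin, smul_eq_mul]
        calc d * (d * (2 ^ B * (2 ^ (2 * B + 1) * E)))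
            ≤ 2 ^ B * (2 ^ B * (2 ^ B * (2 ^ (2 * B + 1) * E))) := by gcongr
          _ = 2 ^ (5 * B + 1) * E := by ring
    have e : 2 ^ ((k + 1) * (5 * B + 1)) = 2 ^ (5 * B + 1) * E := by
      simp only [E]
      ring
    rw [e]
    refine ⟨fun i j => (h1 i j).trans (Nat.mul_le_mul_right _ ?_), h2⟩
    exact Nat.pow_le_pow_right (by norm_num) (by omega)

theorem natAbs_vecMod_le {d Δ : ℕ} (hΔ : Δ ≠ 0) (v : Fin d → ℤ) (i : Fin d) :
    (vecMod Δ v i).natAbs.size ≤ Δ := by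
  refine (Nat.size_le_self _).trans ?_
  have h1 := Int.emod_nonneg (v i) (b := Δ) (by omega)
  have h2 := Int.emod_lt_of_pos (v i) (b := Δ) (by omega)
  simp only [vecMod]
  omega

/-- Lists of vectors. -/
def encodeVecs {d : ℕ} (l : List (Fin d → ℤ)) : CVal := .ofList (l.map encodeVec)

theorem size_encodeVecs_le {d Δ B : ℕ} (hΔ : Δ ≠ 0) {l : List (Fin d → ℤ)}
    (hl : ∀ v ∈ l, vecMod Δ v = v) (hB : l.length ≤ B) :
    (encodeVecs l).size ≤ 1 + B * (1 + d * (Δ + 2) + 1) := by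
  refine (CVal.size_ofList_le (B := 1 + d * (Δ + 2)) fun w hw => ?_).trans ?_
  · obtain ⟨v, hv, rfl⟩ := List.mem_map.1 hw
    refine size_encodeVec_le fun i => ?_
    rw [← hl v hv]
    exact natAbs_vecMod_le hΔ v i
  · rw [List.length_map]
    gcongr

theorem sum_getElem_eq_pos_iff {d : ℕ} (l : List (Fin d → ℤ)) (v : Fin d → ℤ) :
    ∑ i : Fin l.length, (if l[i] = v then (1 : ℤ) else 0) ≤ 0 ↔ v ∉ l := by
  rw [Finset.sum_boole]
  simp only [Nat.cast_nonpos, Finset.card_eq_zero, Finset.filter_eq_empty_iff, Finset.mem_univ,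
    true_imp_iff]
  constructor
  · rintro h hv
    obtain ⟨i, hi, rfl⟩ := List.getElem_of_mem hv
    exact h (x := ⟨i, hi⟩) rfl
  · rintro h i rfl
    exact h (List.getElem_mem i.2)

theorem sum_mul_getElem_eq {d : ℕ} {l : List (Fin d → ℤ)} (hl : l.Nodup) {v : Fin d → ℤ}
    (hv : v ∈ l) : ∑ i : Fin l.length, ((i : ℕ) : ℤ) * (if l[i] = v then 1 else 0) = l.idxOf v := by
  have hlt := List.idxOf_lt_length_of_mem hv
  rw [Finset.sum_eq_single ⟨l.idxOf v, hlt⟩]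
  · simp
  · intro i _ hi
    rw [if_neg, mul_zero]
    rintro rfl
    apply hi
    ext
    exact (hl.idxOf_getElem i i.2).symm
  · simp

namespace Comp

variable {α : Type} {μ : α → ℕ} {a : α → CVal} {d Δ : α → ℕ}

/-- The last round of the Faddeev–LeVerrier recursion. -/
theorem faddeev {H : ∀ x, Matrix (Fin (d x)) (Fin (d x)) ℤ} (hd : PolyBdd μ d)
    (hdn : Comp μ a fun x => .int (d x)) (hH : Comp μ a fun x => encodeMatrix (H x)) :
    Comp μ a fun x => .cons (encodeMatrix (_root_.faddeev (H x) (d x)).1)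
      (.int (_root_.faddeev (H x) (d x)).2) := by
  have ha := hH.bdd_left
  let st : α → ℕ → CVal := fun x k =>
    .cons (encodeMatrix (_root_.faddeev (H x) k).1) (.int (_root_.faddeev (H x) k).2)
  let S : α → ℕ := fun x => d x * (5 * (encodeMatrix (H x)).size + 1) + 1
  have hS : PolyBdd μ S := (hd.mul (((PolyBdd.const μ 5).mul hH.bdd_right).add (.const μ 1))).add
    (.const μ 1)
  have hst : ∀ x k, k ≤ d x → (st x k).size ≤ (1 + d x * (1 + d x * (S x + 2) + 1)) + (2 + S x) := by
    intro x k hk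
    obtain ⟨h1, h2⟩ := natAbs_faddeev_le (A := H x) (B := (encodeMatrix (H x)).size)
      ((length_le_encodeMatrix _).trans Nat.lt_two_pow_self.le)
      (fun i j => (Nat.lt_size_self _).le.trans
        (Nat.pow_le_pow_right (by norm_num) (size_le_encodeMatrix _ i j))) k
    have hkS : ∀ z : ℕ, z ≤ 2 ^ (k * (5 * (encodeMatrix (H x)).size + 1)) → z.size ≤ S x := by
      intro z hz
      rw [Nat.size_le]
      refine hz.trans_lt (Nat.pow_lt_pow_right (by norm_num) ?_)
      exact Nat.lt_succ_of_le (Nat.mul_le_mul_right _ hk)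
    have e1 := size_encodeMatrix_le fun i j => hkS _ (h1 i j)
    have e2 := hkS _ h2
    simp only [st, CVal.size]
    omega
  have hbd : PolyBdd μ fun x => (1 + d x * (1 + d x * (S x + 2) + 1)) + (2 + S x) :=
    ((PolyBdd.const μ 1).add (hd.mul (((PolyBdd.const μ 1).add
      (hd.mul (hS.add (.const μ 2)))).add (.const μ 1)))).add ((PolyBdd.const μ 2).add hS)
  have hstb : PolyBdd (fun p : Σ x, Fin (d x) => μ p.1) fun p => (st p.1 p.2).size :=
    (hbd.reindex Sigma.fst).mono fun p => hst p.1 p.2 p.2.2.le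
  have hd' : PolyBdd (fun p : Σ x, Fin (d x) => μ p.1) fun p => d p.1 := hd.reindex Sigma.fst
  have hs := (head (ha.reindex Sigma.fst : PolyBdd (fun p : Σ x, Fin (d x) => μ p.1) _)
    hstb).weaken hd.fin
  have hi := head (head (ha.reindex Sigma.fst :
    PolyBdd (fun p : Σ x, Fin (d x) => μ p.1) _) hstb).bdd_left hd.fin
  have hdn' := ((hdn.inner d).weaken hstb).weaken hd.fin
  have hH' := ((hH.inner d).weaken hstb).weaken hd.fin
  have hM : Comp (fun p : Σ x, Fin (d x) => μ p.1)
      (fun p => .cons (.int (p.2 : ℕ)) (.cons (st p.1 p.2) (a p.1)))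
      (fun p => encodeMatrix (_root_.faddeev (H p.1) (p.2 + 1)).1) :=
    matSubSmulOne hd' hdn' (matMul hd' hdn' hd' hdn' hd' hdn' hH' hs.fst) hs.snd
  have ht := (trace hd' hdn' (matMul hd' hdn' hd' hdn' hd' hdn' hH' hM)).div
    (hi.add (const hi.bdd_left 1))
  refine iter hd hdn st hbd hst ?_ (hM.pair ht)
  have h0 := mat (M := fun x => (0 : Matrix (Fin (d x)) (Fin (d x)) ℤ)) hd hdn hd hdn
    (const (idx (idx ha hd).bdd_left (hd.reindex Sigma.fst)).bdd_left 0)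
  exact h0.pair (const ha (-1))

variable {l : ∀ x, List (Fin (d x) → ℤ)}

theorem vecsLength (hl : Comp μ a fun x => encodeVecs (l x)) :
    Comp μ a fun x => .int ((l x).length : ℕ) := hl.length.cast fun x => by simp

theorem vecsGet (hl : Comp μ a fun x => encodeVecs (l x)) {k : α → ℕ}
    (hk : Comp μ a fun x => .int (k x)) (hlt : ∀ x, k x < (l x).length) :
    Comp μ a fun x => encodeVec ((l x)[k x]'(hlt x)) :=
  (hl.getElem hk fun x => by simpa using hlt x).cast fun x => by simp

theorem polyBdd_length (hl : Comp μ a fun x => encodeVecs (l x)) :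
    PolyBdd μ fun x => (l x).length :=
  hl.bdd_right.mono fun x => by
    have h := CVal.length_le_size_ofList ((l x).map encodeVec)
    rwa [List.length_map] at h

/-- A loop over the members of a list which are equal to a given vector. -/
theorem vecsSum (hd : PolyBdd μ d) (hdn : Comp μ a fun x => .int (d x))
    (hl : Comp μ a fun x => encodeVecs (l x)) {v : ∀ x, Fin (d x) → ℤ}
    (hv : Comp μ a fun x => encodeVec (v x)) {c : ∀ x, Fin (l x).length → ℤ}
    (hc : Comp (fun p : Σ x, Fin (l x).length => μ p.1)
      (fun p => .cons (.int (p.2 : ℕ)) (a p.1)) fun p => .int (c p.1 p.2)) :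
    Comp μ a fun x => .int (∑ i : Fin (l x).length, c x i * if (l x)[i] = v x then 1 else 0) := by
  have hN := polyBdd_length hl
  refine sum (b := fun x i => c x i * if (l x)[i] = v x then 1 else 0) hN (vecsLength hl)
    (hc.mul (vecEqInd (u := fun p : Σ x, Fin (l x).length => (l p.1)[p.2])
      (v := fun p => v p.1) (hd.reindex Sigma.fst) (hdn.up hN) ?_ (hv.up hN)))
  exact vecsGet (l := fun p : Σ x, Fin (l x).length => l p.1) (k := fun p => (p.2 : ℕ))
    (hl.up hN) (idx hv.bdd_left hN) fun p => p.2.2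

theorem idxOf (hd : PolyBdd μ d) (hdn : Comp μ a fun x => .int (d x))
    (hl : Comp μ a fun x => encodeVecs (l x)) {v : ∀ x, Fin (d x) → ℤ}
    (hv : Comp μ a fun x => encodeVec (v x)) (hnd : ∀ x, (l x).Nodup) (hmem : ∀ x, v x ∈ l x) :
    Comp μ a fun x => .int ((l x).idxOf (v x) : ℕ) :=
  (vecsSum (c := fun x i => ((i : ℕ) : ℤ)) hd hdn hl hv
    (idx hv.bdd_left (polyBdd_length hl))).cast fun x => by
      rw [sum_mul_getElem_eq (hnd x) (hmem x)]

theorem vecMod (hd : PolyBdd μ d) (hdn : Comp μ a fun x => .int (d x))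
    (hΔ : Comp μ a fun x => .int ((Δ x : ℕ) : ℤ)) {v : ∀ x, Fin (d x) → ℤ}
    (hv : Comp μ a fun x => encodeVec (v x)) :
    Comp μ a fun x => encodeVec (_root_.vecMod (Δ x) (v x)) :=
  vec hd hdn ((vget (hv.up hd) (idx hv.bdd_left hd)).mod (hΔ.up hd))

/-- The closure of a list of vectors under a further generator. -/
theorem closeUp (hd : PolyBdd μ d) (hdn : Comp μ a fun x => .int (d x)) (h0 : ∀ x, Δ x ≠ 0)
    (hΔ : PolyBdd μ Δ) (hΔn : Comp μ a fun x => .int (Δ x))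
    (hl : Comp μ a fun x => encodeVecs (l x)) {w : ∀ x, Fin (d x) → ℤ}
    (hw : Comp μ a fun x => encodeVec (w x)) :
    Comp μ a fun x => encodeVecs (_root_.closeUp (Δ x) (l x) (w x)) := by
  have ha := hw.bdd_left
  have hN := polyBdd_length hl
  have hP := hΔ.mul hN
  let st : α → ℕ → CVal := fun x p => encodeVecs (collect (Δ x) (l x) (w x) p)
  have hst : ∀ x p, p ≤ Δ x * (l x).length →
      (st x p).size ≤ 1 + Δ x * (l x).length * (1 + d x * (Δ x + 2) + 1) := by
    intro x p hp
    refine size_encodeVecs_le (h0 x) (fun v hv => ?_) ((length_collect_le _ _ _).trans hp)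
    obtain ⟨q, -, rfl⟩ := mem_collect.1 hv
    exact vecMod_vecMod _
  have hbd : PolyBdd μ fun x => 1 + Δ x * (l x).length * (1 + d x * (Δ x + 2) + 1) :=
    (PolyBdd.const μ 1).add (hP.mul (((PolyBdd.const μ 1).add
      (hd.mul (hΔ.add (.const μ 2)))).add (.const μ 1)))
  have hstb : PolyBdd (fun p : Σ x, Fin (Δ x * (l x).length) => μ p.1)
      fun p => (st p.1 p.2).size :=
    (hbd.reindex Sigma.fst).mono fun p => hst p.1 p.2 p.2.2.le
  have hs0 := head (ha.reindex Sigma.fst :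
    PolyBdd (fun p : Σ x, Fin (Δ x * (l x).length) => μ p.1) _) hstb
  have hs := hs0.weaken hP.fin
  have hi := head hs0.bdd_left hP.fin
  have hd' : PolyBdd (fun p : Σ x, Fin (Δ x * (l x).length) => μ p.1) fun p => d p.1 :=
    hd.reindex Sigma.fst
  have hdn' := ((hdn.inner fun x => Δ x * (l x).length).weaken hstb).weaken hP.fin
  have hl' := ((hl.inner fun x => Δ x * (l x).length).weaken hstb).weaken hP.fin
  have hw' := ((hw.inner fun x => Δ x * (l x).length).weaken hstb).weaken hP.fin
  have hΔ' := ((hΔn.inner fun x => Δ x * (l x).length).weaken hstb).weaken hP.fin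
  have hpos : ∀ p : Σ x, Fin (Δ x * (l x).length), 0 < (l p.1).length := fun p =>
    Nat.pos_of_ne_zero fun h => by
      have := p.2.2
      simp [h] at this
  have hu := vecsGet hl' (hi.natMod (vecsLength hl')) fun p => Nat.mod_lt _ (hpos p)
  have hk := hi.natDiv (vecsLength hl')
  have hc : Comp (fun p : Σ x, Fin (Δ x * (l x).length) => μ p.1)
      (fun p => .cons (.int (p.2 : ℕ)) (.cons (st p.1 p.2) (a p.1)))
      (fun p => encodeVec (candidate (Δ p.1) (l p.1) (w p.1) p.2)) := by
    refine (vecMod (v := fun p => (l p.1)[(p.2 : ℕ) % (l p.1).length]'(Nat.mod_lt _ (hpos p)) +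
      (((p.2 : ℕ) / (l p.1).length : ℕ) : ℤ) • w p.1) hd' hdn' hΔ' ?_).cast fun p => ?_
    · have hj := idx hi.bdd_left hd'
      exact vec hd' hdn' ((vget (hu.up hd') hj).add ((hk.up hd').mul (vget (hw'.up hd') hj)))
    · rw [candidate, List.getD_eq_getElem _ _ (Nat.mod_lt _ (hpos p))]
  -- the candidate is new if none of the members found before is equal to it
  have hcount := vecsSum (c := fun p _ => 1) hd' hdn' hs hc
    (const (idx hi.bdd_left (polyBdd_length hs)).bdd_left 1)
  have hbody := ite' hcount (const hi.bdd_left 0) (hc.pair hs) hs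
  have h := iter hP (hΔn.natMul (vecsLength hl)) st hbd hst (nil ha)
    (hbody.cast fun p => by
      simp only [one_mul, sum_getElem_eq_pos_iff, st, collect]
      split_ifs <;> rfl)
  exact h

/-- The enumeration of the group generated by a list of vectors. The hypothesis `hlen` keeps all
intermediate lists short. -/
theorem groupList {m : α → ℕ} {w : ∀ x, Fin (m x) → Fin (d x) → ℤ} (hm : PolyBdd μ m)
    (hmn : Comp μ a fun x => .int (m x)) (hd : PolyBdd μ d) (hdn : Comp μ a fun x => .int (d x))
    (h0 : ∀ x, Δ x ≠ 0) (hΔ : PolyBdd μ Δ) (hΔn : Comp μ a fun x => .int (Δ x))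
    (hw : Comp μ a fun x => .ofList (List.ofFn fun i => encodeVec (w x i)))
    (hlen : ∀ x k, (_root_.groupList (Δ x) ((List.ofFn (w x)).take k)).length ≤ Δ x) :
    Comp μ a fun x => encodeVecs (_root_.groupList (Δ x) (List.ofFn (w x))) := by
  have ha := hw.bdd_left
  let st : α → ℕ → CVal := fun x k => encodeVecs (_root_.groupList (Δ x) ((List.ofFn (w x)).take k))
  have hst : ∀ x k, k ≤ m x → (st x k).size ≤ 1 + Δ x * (1 + d x * (Δ x + 2) + 1) := by
    intro x k _
    refine size_encodeVecs_le (h0 x) (fun v hv => ?_) (hlen x k)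
    obtain ⟨-, -, h3, -⟩ := groupList_spec (h0 x) (P := fun _ => True) trivial
      (fun _ _ _ _ => trivial) (fun _ _ => trivial) ((List.ofFn (w x)).take k) fun _ _ => trivial
    exact (h3 v hv).1
  have hbd : PolyBdd μ fun x => 1 + Δ x * (1 + d x * (Δ x + 2) + 1) :=
    (PolyBdd.const μ 1).add (hΔ.mul (((PolyBdd.const μ 1).add
      (hd.mul (hΔ.add (.const μ 2)))).add (.const μ 1)))
  have hstb : PolyBdd (fun p : Σ x, Fin (m x) => μ p.1) fun p => (st p.1 p.2).size :=
    (hbd.reindex Sigma.fst).mono fun p => hst p.1 p.2 p.2.2.le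
  have hs0 := head (ha.reindex Sigma.fst : PolyBdd (fun p : Σ x, Fin (m x) => μ p.1) _) hstb
  have hs := hs0.weaken hm.fin
  have hi := head hs0.bdd_left hm.fin
  have hdn' := ((hdn.inner m).weaken hstb).weaken hm.fin
  have hΔ' := ((hΔn.inner m).weaken hstb).weaken hm.fin
  have hw' := ((hw.inner m).weaken hstb).weaken hm.fin
  have hrow := get (b := fun (p : Σ x, Fin (m x)) i => encodeVec (w p.1 i)) (k := fun p => p.2)
    hw' hi
  have hbody := closeUp (hd.reindex Sigma.fst) hdn' (fun p => h0 p.1) (hΔ.reindex Sigma.fst) hΔ'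
    hs hrow
  have hzero := vec (b := fun x (_ : Fin (d x)) => 0) hd hdn (const (idx ha hd).bdd_left 0)
  have h := iter hm hmn st hbd hst (hzero.pair (nil ha)) (hbody.cast fun p => by
    have hlt : (p.2 : ℕ) < (List.ofFn (w p.1)).length := by simp
    simp only [st]
    rw [List.take_succ_eq_append_getElem hlt]
    simp [_root_.groupList])
  refine h.cast fun x => ?_
  simp only [st]
  rw [List.take_of_length_le (by simp)]

end Comp

/-! ### The layered digraph of an instance -/

/-- An input whose lattice has full rank, with at least one arc. -/
structure CircInstance where
  n : ℕ
  m : ℕ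
  d : ℕ
  G : ArcDigraph (Fin n) (Fin m)
  H : Matrix (Fin d) (Fin d) ℤ
  W : Matrix (Fin d) (Fin m) ℤ
  f : Fin d → ℤ
  m_pos : 0 < m
  det_ne : H.det ≠ 0

namespace CircInstance

variable (I : CircInstance)

/-- The index of the lattice. -/
def Δ : ℕ := I.H.det.natAbs

/-- The number of the last layer. -/
def K : ℕ := I.Δ - 1

/-- The number of tuples of starting nodes. -/
def N : ℕ := I.n ^ I.K

/-- The label of an arc, as a vector of remainders modulo `Δ`. -/
def label (a : Fin I.m) : Fin I.d → ℤ := residueVec I.H I.Δ fun i => I.W i a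

/-- The label which the circulations have to attain. -/
def target : Fin I.d → ℤ := residueVec I.H I.Δ I.f

/-- The list of all states: the group generated by the labels. -/
def states : List (Fin I.d → ℤ) := groupList I.Δ (List.ofFn I.label)

/-- The number of states. -/
def s : ℕ := I.states.length

/-- The number of arcs of the layered digraph. -/
abbrev M : ℕ := I.N * (I.K + 1) * I.s * (I.m + 1)

theorem Δ_ne_zero : I.Δ ≠ 0 := Int.natAbs_ne_zero.2 I.det_ne

theorem K_add_one : I.K + 1 = I.Δ := Nat.succ_pred_eq_of_ne_zero I.Δ_ne_zero

theorem n_pos : 0 < I.n := (Nat.zero_le _).trans_lt (I.G.tail ⟨0, I.m_pos⟩).2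

instance : NeZero I.N := ⟨pow_ne_zero _ I.n_pos.ne'⟩

instance : NeZero I.n := ⟨I.n_pos.ne'⟩

theorem states_spec : I.states.Nodup ∧ 0 ∈ I.states ∧ (∀ v ∈ I.states, vecMod I.Δ v = v) ∧
    ∀ v ∈ I.states, ∀ a, vecMod I.Δ (v + I.label a) ∈ I.states := by
  obtain ⟨h1, h2, h3, h4⟩ := groupList_spec I.Δ_ne_zero (P := fun _ => True) trivial
    (fun _ _ _ _ => trivial) (fun _ _ => trivial) (List.ofFn I.label) fun _ _ => trivial
  exact ⟨h1, h2, fun v hv => (h3 v hv).1, fun v hv a => h4 v hv _ (List.mem_ofFn.2 ⟨a, rfl⟩)⟩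

theorem length_groupList_take_le (k : ℕ) :
    (groupList I.Δ ((List.ofFn I.label).take k)).length ≤ I.Δ := by
  refine length_groupList_le rfl I.Δ_ne_zero fun w hw => ?_
  obtain ⟨a, rfl⟩ := List.mem_ofFn.1 (List.mem_of_mem_take hw)
  exact ⟨_, rfl⟩

theorem s_le : I.s ≤ I.Δ := by
  have h := I.length_groupList_take_le I.m
  rwa [List.take_of_length_le (by simp)] at h

/-- The state after an arc. -/
def succ (g : Fin I.s) (a : Fin I.m) : Fin I.s :=
  ⟨I.states.idxOf (vecMod I.Δ (I.states[(g : ℕ)]'g.2 + I.label a)),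
    List.idxOf_lt_length_of_mem (I.states_spec.2.2.2 _ (List.getElem_mem g.2) a)⟩

/-- The state with the label `0`. -/
def start : Fin I.s := ⟨I.states.idxOf 0, List.idxOf_lt_length_of_mem I.states_spec.2.1⟩

/-- The final states. -/
def fin (g : Fin I.s) : Prop := I.states[(g : ℕ)]'g.2 = I.target

instance : DecidablePred I.fin := fun g =>
  inferInstanceAs (Decidable (I.states[(g : ℕ)]'g.2 = I.target))

/-- The starting nodes of the tuple number `T` are its digits in base `n`. -/
def startNode (T : Fin I.N) (i : Fin (I.K + 1)) : Fin I.n :=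
  ⟨(T : ℕ) / I.n ^ (i : ℕ) % I.n, Nat.mod_lt _ I.n_pos⟩

/-- Every choice of starting nodes for the layers below `K` is realized by a number `T`. -/
theorem exists_startNode (u : Fin I.K → Fin I.n) : ∃ T, ∀ i, I.startNode T i.castSucc = u i := by
  refine ⟨finFunctionFinEquiv u, fun i => ?_⟩
  have h := congrFun (finFunctionFinEquiv.symm_apply_apply u) i
  rw [← h]
  rfl

theorem sum_smul_latticeResidue (y : Fin I.m → ℤ) :
    ∑ a, y a • latticeResidue I.H I.Δ (fun i => I.W i a) =
      latticeResidue I.H I.Δ (I.W.mulVec y) := by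
  ext i
  simp only [latticeResidue, Matrix.mulVec_mulVec, Finset.sum_apply, Pi.smul_apply]
  simp only [Matrix.mulVec, dotProduct, Matrix.mul_apply, zsmul_eq_mul]
  push_cast
  exact Finset.sum_congr rfl fun a _ => mul_comm _ _

theorem labelledCirculations_eq :
    labelledCirculations I.G (fun a => latticeResidue I.H I.Δ fun i => I.W i a)
      (latticeResidue I.H I.Δ I.f) = congruenceCirculations I.G I.H I.W I.f := by
  ext y
  simp only [labelledCirculations, congruenceCirculations, Set.mem_ofPred_eq,
    ArcDigraph.incidence_mulVec_eq_zero, sum_smul_latticeResidue]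
  rw [← latticeResidue_eq_zero_iff rfl I.Δ_ne_zero, latticeResidue_sub, sub_eq_zero]
  rfl

/-- The states are identified with group elements by casting their entries to `ZMod Δ`. -/
theorem circulationHull_eq :
    circulationHull I.G I.H I.W I.f = unitFlows I.G I.startNode I.succ I.start I.fin := by
  obtain ⟨h1, h2, h3, h4⟩ := I.states_spec
  have hinj : ∀ u ∈ I.states, ∀ v : Fin I.d → ℤ, vecMod I.Δ v = v →
      (u = v ↔ (fun i => (u i : ZMod I.Δ)) = fun i => (v i : ZMod I.Δ)) := by
    intro u hu v hv
    rw [← vecMod_eq_iff, h3 u hu, hv]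
  rw [circulationHull, ← labelledCirculations_eq]
  refine convexHull_labelledCirculations
    (L := fun (g : Fin I.s) i => (((I.states[(g : ℕ)]'g.2) i : ℤ) : ZMod I.Δ)) ?_ ?_ ?_ ?_ ?_
    I.exists_startNode
  · intro g h hgh
    exact Fin.ext (h1.getElem_inj_iff.1
      ((hinj _ (List.getElem_mem g.2) _ (h3 _ (List.getElem_mem h.2))).2 hgh))
  · intro g a
    have : I.states[(I.succ g a : ℕ)]'(I.succ g a).2 =
        vecMod I.Δ (I.states[(g : ℕ)]'g.2 + I.label a) := by simp [succ]
    rw [this, ← cast_residueVec, vecMod_eq_iff.1 (vecMod_vecMod _)]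
    ext i
    simp [label]
  · have : I.states[(I.start : ℕ)]'I.start.2 = 0 := by simp [start]
    rw [this]
    ext i
    simp
  · intro g
    rw [← cast_residueVec]
    exact hinj _ (List.getElem_mem g.2) _ (vecMod_vecMod _)
  · rw [Fintype.card_fin, K_add_one]
    exact I.s_le

/-- The layered digraph of an instance. -/
def D : ArcDigraph (((Fin I.N × Fin (I.K + 1)) × Fin I.n) × Fin I.s)
    (((Fin I.N × Fin (I.K + 1)) × Fin I.s) × Option (Fin I.m)) :=
  layered I.G I.startNode I.succ I.start I.fin

/-! ### Numbers for the nodes and arcs of the layered digraph -/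

variable {I}

/-- The tuple of starting nodes which belongs to an arc. -/
def copy (j : Fin I.M) : Fin I.N := j.divNat.divNat.divNat

/-- The layer of an arc. -/
def layer (j : Fin I.M) : Fin (I.K + 1) := j.divNat.divNat.modNat

/-- The state at the tail of an arc. -/
def state (j : Fin I.M) : Fin I.s := j.divNat.modNat

/-- The number of the underlying arc of `G`, which is `m` for the arcs between layers. -/
def below (j : Fin I.M) : Fin (I.m + 1) := j.modNat

/-- The arc number `j`. -/
def arc (j : Fin I.M) : ((Fin I.N × Fin (I.K + 1)) × Fin I.s) × Option (Fin I.m) :=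
  (arcEquiv I.N I.K I.s I.m).symm j

theorem arc_inj {j j' : Fin I.M} : arc j = arc j' ↔ (j : ℕ) = j' := by
  rw [arc, arc, Equiv.apply_eq_iff_eq, Fin.ext_iff]

theorem finSuccEquivLast_eq {m : ℕ} (j : Fin (m + 1)) :
    finSuccEquivLast j = if h : (j : ℕ) < m then some ⟨j, h⟩ else none := by
  refine Fin.lastCases ?_ (fun i => ?_) j
  · simp
  · simp

theorem arc_eq (j : Fin I.M) : arc j = (((copy j, layer j), state j),
    if h : (below j : ℕ) < I.m then some ⟨below j, h⟩ else none) := by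
  rw [← finSuccEquivLast_eq]
  rfl

theorem arc_eq_some {j : Fin I.M} (h : (below j : ℕ) < I.m) :
    arc j = (((copy j, layer j), state j), some ⟨below j, h⟩) := by rw [arc_eq, dif_pos h]

theorem arc_eq_none {j : Fin I.M} (h : ¬ (below j : ℕ) < I.m) :
    arc j = (((copy j, layer j), state j), none) := by rw [arc_eq, dif_neg h]

theorem arc_snd_eq_iff {j j' : Fin I.M} : (arc j).2 = (arc j').2 ↔ (below j : ℕ) = below j' := by
  rw [← Fin.ext_iff, ← (finSuccEquivLast (n := I.m)).apply_eq_iff_eq]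
  rfl

theorem arc_snd_eq_some_iff {j : Fin I.M} {a : Fin I.m} :
    (arc j).2 = some a ↔ (below j : ℕ) = a := by
  rw [arc_eq]
  split_ifs with h
  · simp [Fin.ext_iff]
  · simp only [false_iff]
    omega

theorem arc_snd_eq_none_iff {j : Fin I.M} : (arc j).2 = none ↔ (below j : ℕ) = I.m := by
  rw [arc_eq]
  split_ifs with h
  · simp [h.ne]
  · simp only [true_iff]
    have := (below j).2
    omega

/-- The number of a node of the layered digraph. -/
def nodeCode (x : ((Fin I.N × Fin (I.K + 1)) × Fin I.n) × Fin I.s) : ℕ :=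
  x.2 + I.s * (x.1.2 + I.n * (x.1.1.2 + (I.K + 1) * x.1.1.1))

theorem nodeCode_inj {x y : ((Fin I.N × Fin (I.K + 1)) × Fin I.n) × Fin I.s} :
    nodeCode x = nodeCode y ↔ x = y := by
  let e : ((Fin I.N × Fin (I.K + 1)) × Fin I.n) × Fin I.s ≃
      Fin (I.N * (I.K + 1) * I.n * I.s) :=
    (((finProdFinEquiv.prodCongr (Equiv.refl _)).trans finProdFinEquiv).prodCongr
      (Equiv.refl _)).trans finProdFinEquiv
  have h : ∀ z : ((Fin I.N × Fin (I.K + 1)) × Fin I.n) × Fin I.s, nodeCode z = (e z : ℕ) :=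
    fun z => rfl
  rw [h, h, ← Fin.ext_iff, e.apply_eq_iff_eq]

end CircInstance

/-! ### Branching on indicators -/

namespace Comp

variable {α : Type} {μ : α → ℕ} {a b c : α → CVal} {p : α → Prop} [DecidablePred p]

/-- Branching on an indicator. Each branch has to work only where it is taken. -/
theorem iteInd (hp : Comp μ a fun x => .int (if p x then 1 else 0))
    (hb : Comp (fun x : {x // p x} => μ x) (fun x => a x) fun x => b x)
    (hc : Comp (fun x : {x // ¬ p x} => μ x) (fun x => a x) fun x => c x) :
    Comp μ a fun x => if p x then b x else c x := by
  have h1 : ∀ x, (1 : ℤ) ≤ (if p x then 1 else 0) ↔ p x := fun x => by split_ifs with h <;> simp [h]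
  have hb' : Comp (fun x : {x // (1 : ℤ) ≤ if p x then 1 else 0} => μ x) (fun x => a x)
      fun x => b x := hb.reindex (Subtype.map id fun x => (h1 x).1)
  have hc' : Comp (fun x : {x // ¬ (1 : ℤ) ≤ if p x then 1 else 0} => μ x) (fun x => a x)
      fun x => c x := hc.reindex (Subtype.map id fun x hx h => hx ((h1 x).2 h))
  refine (ite (const hp.bdd_left 1) hp hb' hc').cast fun x => ?_
  simp only [h1]

/-- Only the first branch is restricted to the arguments where it is taken. -/
theorem iteIndLeft (hp : Comp μ a fun x => .int (if p x then 1 else 0))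
    (hb : Comp (fun x : {x // p x} => μ x) (fun x => a x) fun x => b x) (hc : Comp μ a c) :
    Comp μ a fun x => if p x then b x else c x := iteInd hp hb (hc.reindex Subtype.val)

theorem iteInd' (hp : Comp μ a fun x => .int (if p x then 1 else 0)) (hb : Comp μ a b)
    (hc : Comp μ a c) : Comp μ a fun x => if p x then b x else c x :=
  iteIndLeft hp (hb.reindex Subtype.val) hc

/-- Branching for integers. -/
theorem intIte {u v : α → ℤ} (hp : Comp μ a fun x => .int (if p x then 1 else 0))
    (hu : Comp μ a fun x => .int (u x)) (hv : Comp μ a fun x => .int (v x)) :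
    Comp μ a fun x => .int (if p x then u x else v x) :=
  (iteInd' hp hu hv).cast fun _ => (apply_ite CVal.int _ _ _).symm

theorem natLtInd {u v : α → ℕ} (hu : Comp μ a fun x => .int (u x))
    (hv : Comp μ a fun x => .int (v x)) :
    Comp μ a fun x => .int (if u x < v x then 1 else 0) :=
  (ite' hv hu (const hu.bdd_left 0) (const hu.bdd_left 1)).cast fun x => by
    by_cases h : u x < v x
    · simp [h]
    · simp [h, not_lt.1 h]

end Comp

namespace CircInstance

/-! ### Programs for the data of an instance -/

/-- The encoding of an instance. -/
def input (I : CircInstance) : CVal := encodeInput I.G I.H I.W I.f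

/-- The measure in which all programs run in polynomial time. -/
def measure (I : CircInstance) : ℕ := I.input.size + sizeBound I.Δ I.m I.n

theorem bdd_input : PolyBdd measure fun I => I.input.size :=
  (PolyBdd.self _).mono fun _ => Nat.le_add_right _ _

theorem bdd_sizeBound : PolyBdd measure fun I => sizeBound I.Δ I.m I.n :=
  (PolyBdd.self _).mono fun _ => Nat.le_add_left _ _

/-- The bound with the factors `|V|^(Δ-1)` and `Δ^2` split off. -/
theorem sizeBound_eq (I : CircInstance) :
    sizeBound I.Δ I.m I.n = I.Δ ^ (I.Δ - 1) * I.m * I.N * (I.Δ * I.Δ) := by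
  have h : I.Δ ^ (I.Δ + 1) = I.Δ ^ (I.Δ - 1) * (I.Δ * I.Δ) := by
    rw [← pow_two, ← pow_add]
    congr 1
    have := I.Δ_ne_zero
    omega
  rw [sizeBound, h, N, K]
  ring

theorem bdd_Δ : PolyBdd measure Δ := bdd_sizeBound.mono fun I => by
  have h1 := Nat.pos_of_ne_zero I.Δ_ne_zero
  have h2 := Nat.pos_of_ne_zero (NeZero.ne I.N)
  rw [sizeBound_eq, ← mul_assoc]
  exact Nat.le_mul_of_pos_left _ (by have := I.m_pos; positivity)

theorem bdd_N : PolyBdd measure N := bdd_sizeBound.mono fun I => by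
  have h1 := Nat.pos_of_ne_zero I.Δ_ne_zero
  rw [sizeBound_eq, mul_right_comm]
  exact Nat.le_mul_of_pos_left _ (by have := I.m_pos; positivity)

theorem bdd_K : PolyBdd measure K := bdd_Δ.mono fun _ => Nat.sub_le _ _

theorem bdd_s : PolyBdd measure s := bdd_Δ.mono fun I => I.s_le

theorem comp_input : Comp measure input input := .refl bdd_input

theorem comp_nodes : Comp measure input fun I => encodeVec fun v : Fin I.n => ((v : ℕ) : ℤ) :=
  comp_input.fst.fst

theorem comp_arcs : Comp measure input fun I => .ofList (List.ofFn fun a : Fin I.m =>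
    .cons (.int ((I.G.tail a : ℕ) : ℤ)) (.int ((I.G.head a : ℕ) : ℤ))) := comp_input.fst.snd

theorem comp_H : Comp measure input fun I => encodeMatrix I.H := comp_input.snd.fst

theorem comp_W : Comp measure input fun I => encodeMatrix I.W := comp_input.snd.snd.fst

theorem comp_f : Comp measure input fun I => encodeVec I.f := comp_input.snd.snd.snd.fst

theorem comp_n : Comp measure input fun I => .int (I.n : ℕ) := comp_nodes.length_ofFn

theorem comp_m : Comp measure input fun I => .int (I.m : ℕ) := comp_arcs.length_ofFn

theorem comp_d : Comp measure input fun I => .int (I.d : ℕ) := comp_f.length_ofFn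

theorem bdd_d : PolyBdd measure d := comp_f.bdd_right.mono fun _ => length_le_encodeVec _

theorem bdd_m : PolyBdd measure m := comp_arcs.bdd_right.mono fun I => by
  refine le_trans ?_ (CVal.length_le_size_ofList _)
  rw [List.length_ofFn]

theorem comp_pseudoAdj : Comp measure input fun I => encodeMatrix (pseudoAdj I.H) :=
  (Comp.faddeev bdd_d comp_d comp_H).fst

/-- The index of the lattice: the last number of the recursion is the determinant up to sign. -/
theorem comp_Δ : Comp measure input fun I => .int (I.Δ : ℕ) := by
  have h := (Comp.faddeev bdd_d comp_d comp_H).snd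
  have h0 := Comp.const bdd_input 0
  refine (Comp.ite' h0 h h (h0.sub h)).cast fun I => ?_
  have e := natAbs_faddeev I.H
  rw [Δ]
  split_ifs <;> congr 1 <;> omega

theorem comp_K : Comp measure input fun I => .int (I.K : ℕ) :=
  (comp_Δ.sub (.const bdd_input 1)).cast fun I => by
    have := I.K_add_one
    congr 1
    omega

theorem comp_N : Comp measure input fun I => .int (I.N : ℕ) :=
  (comp_n.pow bdd_K comp_K).cast fun I => by simp [N]

theorem comp_labels : Comp measure input fun I =>
    .ofList (List.ofFn fun a => encodeVec (I.label a)) := by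
  have hd : PolyBdd (fun p : Σ I : CircInstance, Fin I.m => p.1.measure) fun p => p.1.d :=
    bdd_d.reindex Sigma.fst
  have hx : Comp (fun p : Σ I : CircInstance, Fin I.m => p.1.measure)
      (fun p => .cons (.int (p.2 : ℕ)) p.1.input)
      (fun p => encodeVec fun i => p.1.W i p.2) :=
    .vec hd (comp_d.up bdd_m) (.mget ((comp_W.up bdd_m).up hd)
      (.idx (Comp.idx bdd_input bdd_m).bdd_left hd) ((Comp.idx bdd_input bdd_m).up hd))
  exact .tab bdd_m comp_m (.vecMod hd (comp_d.up bdd_m) (comp_Δ.up bdd_m)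
    (.mulVec hd (comp_d.up bdd_m) hd (comp_d.up bdd_m) (comp_pseudoAdj.up bdd_m) hx))

theorem comp_target : Comp measure input fun I => encodeVec I.target :=
  .vecMod bdd_d comp_d comp_Δ (.mulVec bdd_d comp_d bdd_d comp_d comp_pseudoAdj comp_f)

theorem comp_states : Comp measure input fun I => encodeVecs I.states :=
  .groupList bdd_m comp_m bdd_d comp_d Δ_ne_zero bdd_Δ comp_Δ comp_labels length_groupList_take_le

theorem comp_s : Comp measure input fun I => .int (I.s : ℕ) := comp_states.vecsLength

theorem comp_start : Comp measure input fun I => .int (I.start : ℕ) :=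
  .idxOf bdd_d comp_d comp_states (.vec bdd_d comp_d
    (.const (Comp.idx bdd_input bdd_d).bdd_left 0)) (fun I => I.states_spec.1)
    fun I => I.states_spec.2.1

end CircInstance

/-! ### Programs for the nodes of the layered digraph -/

namespace CircInstance

/-- The number of a node with the given coordinates. -/
def code (I : CircInstance) (T i u g : ℕ) : ℕ := g + I.s * (u + I.n * (i + (I.K + 1) * T))

/-- The starting node in the layer `i` as a number. -/
def digit (I : CircInstance) (T i : ℕ) : ℕ := T / I.n ^ i % I.n

section

variable {α : Type} {μ : α → ℕ} {a : α → CVal} {I : α → CircInstance} {T i u g : α → ℕ}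

theorem comp_code (hn : Comp μ a fun x => .int ((I x).n : ℕ))
    (hs : Comp μ a fun x => .int ((I x).s : ℕ)) (hK : Comp μ a fun x => .int ((I x).K : ℕ))
    (hT : Comp μ a fun x => .int (T x : ℕ)) (hi : Comp μ a fun x => .int (i x : ℕ))
    (hu : Comp μ a fun x => .int (u x : ℕ)) (hg : Comp μ a fun x => .int (g x : ℕ)) :
    Comp μ a fun x => .int ((I x).code (T x) (i x) (u x) (g x) : ℕ) :=
  hg.natAdd (hs.natMul (hu.natAdd (hn.natMul (hi.natAdd
    ((hK.natAdd (.const hn.bdd_left 1)).natMul hT)))))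

theorem comp_digit (hn : Comp μ a fun x => .int ((I x).n : ℕ))
    (hT : Comp μ a fun x => .int (T x : ℕ)) (hi : Comp μ a fun x => .int (i x : ℕ))
    (hb : PolyBdd μ i) : Comp μ a fun x => .int ((I x).digit (T x) (i x) : ℕ) := by
  have hp : Comp μ a fun x => .int (((I x).n ^ i x : ℕ) : ℤ) :=
    (hn.pow hb hi).cast fun x => by simp
  exact (hT.natDiv hp).natMod hn

end

/-- The environment for loops over the arcs of the layered digraph. -/
def arcEnv (p : Σ I : CircInstance, Fin I.M) : CVal := .cons (.int (p.2 : ℕ)) p.1.input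

/-- The measure of the instance, for pairs of an instance and an arc of its layered digraph. -/
def arcMeasure (p : Σ I : CircInstance, Fin I.M) : ℕ := p.1.measure

theorem bdd_M : PolyBdd measure M :=
  ((bdd_N.mul (bdd_K.add (.const _ 1))).mul bdd_s).mul (bdd_m.add (.const _ 1))

theorem comp_M : Comp measure input fun I => .int (I.M : ℕ) := by
  have h1 := Comp.const bdd_input ((1 : ℕ) : ℤ)
  exact ((comp_N.natMul (comp_K.natAdd h1)).natMul comp_s).natMul (comp_m.natAdd h1)

theorem comp_arc {b : CircInstance → CVal} (h : Comp measure input b) :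
    Comp arcMeasure arcEnv fun p => b p.1 := h.up bdd_M

theorem comp_index : Comp arcMeasure arcEnv fun p => .int (p.2 : ℕ) := .idx bdd_input bdd_M

theorem bdd_arcEnv : PolyBdd arcMeasure fun p => (arcEnv p).size := comp_index.bdd_left

theorem comp_quot : Comp arcMeasure arcEnv fun p => .int ((p.2 : ℕ) / (p.1.m + 1) : ℕ) :=
  comp_index.natDiv ((comp_arc comp_m).natAdd (.const bdd_arcEnv 1))

theorem comp_below : Comp arcMeasure arcEnv fun p => .int (below p.2 : ℕ) :=
  comp_index.natMod ((comp_arc comp_m).natAdd (.const bdd_arcEnv 1))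

theorem comp_state : Comp arcMeasure arcEnv fun p => .int (state p.2 : ℕ) :=
  comp_quot.natMod (comp_arc comp_s)

theorem comp_layer : Comp arcMeasure arcEnv fun p => .int (layer p.2 : ℕ) :=
  (comp_quot.natDiv (comp_arc comp_s)).natMod ((comp_arc comp_K).natAdd (.const bdd_arcEnv 1))

theorem comp_copy : Comp arcMeasure arcEnv fun p => .int (copy p.2 : ℕ) :=
  (comp_quot.natDiv (comp_arc comp_s)).natDiv ((comp_arc comp_K).natAdd (.const bdd_arcEnv 1))

theorem bdd_layer : PolyBdd arcMeasure fun p => (layer p.2 : ℕ) :=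
  PolyBdd.mono (bdd_K.reindex Sigma.fst) fun p => Nat.lt_succ_iff.1 (layer p.2).2

theorem comp_finInd : Comp arcMeasure arcEnv fun p =>
    .int (if p.1.fin (state p.2) then 1 else 0) :=
  .vecEqInd (bdd_d.reindex Sigma.fst) (comp_arc comp_d)
    (.vecsGet (comp_arc comp_states) comp_state fun p => (state p.2).2) (comp_arc comp_target)

/-- The indicator of the return arcs. -/
theorem comp_returnInd : Comp arcMeasure arcEnv fun p =>
    .int (if IsReturn (Fin p.1.m) p.1.fin (arc p.2) then 1 else 0) := by
  refine (((comp_below.natEqInd (comp_arc comp_m)).mul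
    (comp_layer.natEqInd (comp_arc comp_K))).mul comp_finInd).cast fun p => ?_
  have h : IsReturn (Fin p.1.m) p.1.fin (arc p.2) ↔
      (below p.2 : ℕ) = p.1.m ∧ (layer p.2 : ℕ) = p.1.K ∧ p.1.fin (state p.2) := by
    rw [IsReturn, arc_snd_eq_none_iff, arc_eq]
  simp only [h]
  congr 1
  by_cases h1 : (below p.2 : ℕ) = p.1.m <;> by_cases h2 : (layer p.2 : ℕ) = p.1.K <;>
    simp [h1, h2]

/-- The number of the tail of an arc which follows an arc of `G`. -/
def tailCode (p : Σ I : CircInstance, Fin I.M) : ℕ :=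
  if h : (below p.2 : ℕ) < p.1.m then
    p.1.code (copy p.2) (layer p.2) (p.1.G.tail ⟨below p.2, h⟩) (state p.2)
  else 0

/-- The number of the head of an arc which follows an arc of `G`. -/
def headCode (p : Σ I : CircInstance, Fin I.M) : ℕ :=
  if h : (below p.2 : ℕ) < p.1.m then
    p.1.code (copy p.2) (layer p.2) (p.1.G.head ⟨below p.2, h⟩)
      (p.1.succ (state p.2) ⟨below p.2, h⟩)
  else 0

/-- The number of a starting node with an arbitrary state. -/
def startCode (I : CircInstance) (T i g : ℕ) : ℕ := I.code T i (I.digit T i) g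

theorem nodeCode_tail (p : Σ I : CircInstance, Fin I.M) : nodeCode (p.1.D.tail (arc p.2)) =
    if (below p.2 : ℕ) < p.1.m then tailCode p
    else p.1.startCode (copy p.2) (layer p.2) (state p.2) := by
  split_ifs with h
  · rw [arc_eq_some h, tailCode, dif_pos h]
    rfl
  · rw [arc_eq_none h]
    rfl

theorem nodeCode_head (p : Σ I : CircInstance, Fin I.M) : nodeCode (p.1.D.head (arc p.2)) =
    if (below p.2 : ℕ) < p.1.m then headCode p
    else if (layer p.2 : ℕ) < p.1.K then p.1.startCode (copy p.2) (layer p.2 + 1 : ℕ) (state p.2)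
    else if p.1.fin (state p.2) then p.1.startCode (copy p.2) 0 p.1.start
    else p.1.startCode (copy p.2) (layer p.2) (state p.2) := by
  by_cases h : (below p.2 : ℕ) < p.1.m
  · rw [if_pos h, arc_eq_some h, headCode, dif_pos h]
    rfl
  · rw [if_neg h, arc_eq_none h, D, layered]
    dsimp only
    split_ifs <;> rfl

theorem comp_startCode {i g : (Σ I : CircInstance, Fin I.M) → ℕ}
    (hi : Comp arcMeasure arcEnv fun p => .int (i p : ℕ)) (hb : PolyBdd arcMeasure i)
    (hg : Comp arcMeasure arcEnv fun p => .int (g p : ℕ)) :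
    Comp arcMeasure arcEnv fun p => .int (p.1.startCode (copy p.2) (i p) (g p) : ℕ) :=
  comp_code (comp_arc comp_n) (comp_arc comp_s) (comp_arc comp_K) comp_copy hi
    (comp_digit (comp_arc comp_n) comp_copy hi hb) hg

/-- The pairs of an instance and an arc of its layered digraph which follows an arc of `G`. -/
abbrev GArc : Type := {p : Σ I : CircInstance, Fin I.M // (below p.2 : ℕ) < p.1.m}

theorem comp_sub {b : (Σ I : CircInstance, Fin I.M) → CVal} (h : Comp arcMeasure arcEnv b) :
    Comp (fun q : GArc => arcMeasure q.1) (fun q => arcEnv q.1) fun q => b q.1 :=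
  h.reindex Subtype.val

theorem comp_ends : Comp (fun q : GArc => arcMeasure q.1) (fun q => arcEnv q.1) fun q =>
    .cons (.int (q.1.1.G.tail ⟨below q.1.2, q.2⟩ : ℕ))
      (.int (q.1.1.G.head ⟨below q.1.2, q.2⟩ : ℕ)) :=
  (comp_sub (comp_arc comp_arcs)).get (k := fun q => ⟨below q.1.2, q.2⟩) (comp_sub comp_below)

theorem comp_succ : Comp (fun q : GArc => arcMeasure q.1) (fun q => arcEnv q.1) fun q =>
    .int (q.1.1.succ (state q.1.2) ⟨below q.1.2, q.2⟩ : ℕ) := by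
  have hd : PolyBdd (fun q : GArc => arcMeasure q.1) fun q => q.1.1.d :=
    bdd_d.reindex fun q : GArc => q.1.1
  have hdn := comp_sub (comp_arc comp_d)
  have hl := comp_sub (comp_arc comp_states)
  have hu := hl.vecsGet (comp_sub comp_state) fun q => (state q.1.2).2
  have hw : Comp (fun q : GArc => arcMeasure q.1) (fun q => arcEnv q.1) fun q =>
      encodeVec (q.1.1.label ⟨below q.1.2, q.2⟩) :=
    (comp_sub (comp_arc comp_labels)).get (k := fun q => ⟨below q.1.2, q.2⟩) (comp_sub comp_below)
  have hj := Comp.idx hw.bdd_left hd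
  have hv := Comp.vec (b := fun (q : GArc) i => (q.1.1.states[(state q.1.2 : ℕ)]'(state q.1.2).2 +
    q.1.1.label ⟨below q.1.2, q.2⟩) i) hd hdn ((Comp.vget (hu.up hd) hj).add (Comp.vget (hw.up hd) hj))
  exact .idxOf hd hdn hl (.vecMod hd hdn (comp_sub (comp_arc comp_Δ)) hv)
    (fun q => q.1.1.states_spec.1)
    fun q => q.1.1.states_spec.2.2.2 _ (List.getElem_mem (state q.1.2).2) _

theorem comp_belowInd : Comp arcMeasure arcEnv fun p =>
    .int (if (below p.2 : ℕ) < p.1.m then 1 else 0) := comp_below.natLtInd (comp_arc comp_m)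

theorem comp_nodeCode_tail : Comp arcMeasure arcEnv fun p =>
    .int (nodeCode (p.1.D.tail (arc p.2)) : ℕ) := by
  have h1 := comp_code (comp_sub (comp_arc comp_n)) (comp_sub (comp_arc comp_s))
    (comp_sub (comp_arc comp_K)) (comp_sub comp_copy) (comp_sub comp_layer) comp_ends.fst
    (comp_sub comp_state)
  have h2 := comp_startCode comp_layer bdd_layer comp_state
  refine (Comp.iteIndLeft (b := fun p => .int (tailCode p : ℕ)) comp_belowInd
    (h1.cast fun q => ?_) h2).cast fun p => ?_
  · rw [tailCode, dif_pos q.2]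
  · rw [nodeCode_tail]
    split_ifs <;> rfl

theorem comp_nodeCode_head : Comp arcMeasure arcEnv fun p =>
    .int (nodeCode (p.1.D.head (arc p.2)) : ℕ) := by
  have h1 := comp_code (comp_sub (comp_arc comp_n)) (comp_sub (comp_arc comp_s))
    (comp_sub (comp_arc comp_K)) (comp_sub comp_copy) (comp_sub comp_layer) comp_ends.snd comp_succ
  have h2 := comp_startCode comp_layer bdd_layer comp_state
  have h3 := comp_startCode (comp_layer.natAdd (.const bdd_arcEnv 1)) (bdd_layer.add (.const _ 1))
    comp_state
  have h4 := comp_startCode (i := fun _ => 0) (.const bdd_arcEnv 0) (.const _ 0)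
    (comp_arc comp_start)
  refine (Comp.iteIndLeft (b := fun p => .int (headCode p : ℕ)) comp_belowInd
    (h1.cast fun q => ?_) (Comp.iteInd'
      (comp_layer.natLtInd (comp_arc comp_K)) h3 (.iteInd' comp_finInd h4 h2))).cast
    fun p => ?_
  · rw [headCode, dif_pos q.2]
  · rw [nodeCode_head]
    split_ifs <;> rfl

end CircInstance

/-! ### The program -/

namespace CircInstance

/-- The number of inequalities. -/
abbrev rows (I : CircInstance) : ℕ := I.M * 4

theorem bdd_rows : PolyBdd measure rows := bdd_M.mul (.const _ 4)

theorem comp_rows : Comp measure input fun I => .int (I.rows : ℕ) :=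
  comp_M.natMul (.const bdd_input ((4 : ℕ) : ℤ))

/-- The environment for loops over the inequalities. -/
def rowEnv (p : Σ I : CircInstance, Fin I.rows) : CVal := .cons (.int (p.2 : ℕ)) p.1.input

/-- The measure of the instance, for pairs of an instance and an inequality. -/
def rowMeasure (p : Σ I : CircInstance, Fin I.rows) : ℕ := p.1.measure

theorem comp_row {b : CircInstance → CVal} (h : Comp measure input b) :
    Comp rowMeasure rowEnv fun p => b p.1 := h.up bdd_rows

theorem bdd_rowEnv : PolyBdd rowMeasure fun p => (rowEnv p).size :=
  (comp_row comp_input).bdd_left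

theorem comp_rowArc : Comp rowMeasure rowEnv fun p => .int (p.2.divNat : ℕ) :=
  (Comp.idx bdd_input bdd_rows).natDiv (.const bdd_rowEnv ((4 : ℕ) : ℤ))

theorem comp_rowKind : Comp rowMeasure rowEnv fun p => .int (p.2.modNat : ℕ) :=
  (Comp.idx bdd_input bdd_rows).natMod (.const bdd_rowEnv ((4 : ℕ) : ℤ))

theorem comp_tails : Comp measure input fun I =>
    encodeVec fun j : Fin I.M => ((nodeCode (I.D.tail (arc j)) : ℕ) : ℤ) :=
  .vec bdd_M comp_M comp_nodeCode_tail

theorem comp_heads : Comp measure input fun I =>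
    encodeVec fun j : Fin I.M => ((nodeCode (I.D.head (arc j)) : ℕ) : ℤ) :=
  .vec bdd_M comp_M comp_nodeCode_head

theorem comp_belows : Comp measure input fun I =>
    encodeVec fun j : Fin I.M => ((below j : ℕ) : ℤ) := .vec bdd_M comp_M comp_below

theorem comp_returns : Comp measure input fun I =>
    encodeVec fun j : Fin I.M => if IsReturn (Fin I.m) I.fin (arc j) then 1 else 0 :=
  .vec bdd_M comp_M comp_returnInd

/-- The matrix of the flow variables of an instance. -/
def C (I : CircInstance) : Matrix (Fin I.rows) (Fin I.M) ℤ :=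
  flowMatrix I.G I.startNode I.succ I.start I.fin

/-- The matrix of the original variables of an instance. -/
def B (I : CircInstance) : Matrix (Fin I.rows) (Fin I.m) ℤ := arcMatrix I.N I.K I.s I.m

/-- The right-hand side of an instance. -/
def b (I : CircInstance) : Fin I.rows → ℤ := rhsVec I.N I.K I.s I.m

theorem C_apply (I : CircInstance) (r : Fin I.rows) (j : Fin I.M) : I.C r j =
    let P : ℤ := if (below r.divNat : ℕ) = I.m then
        (if IsReturn (Fin I.m) I.fin (arc j) then 1 else 0)
      else if (below j : ℕ) = below r.divNat then 1 else 0
    if (r.modNat : ℕ) = 0 then 0 - (if (j : ℕ) = r.divNat then 1 else 0)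
    else if (r.modNat : ℕ) = 1 then
      (if nodeCode (I.D.tail (arc j)) = nodeCode (I.D.tail (arc r.divNat)) then 1 else 0) -
        (if nodeCode (I.D.head (arc j)) = nodeCode (I.D.tail (arc r.divNat)) then 1 else 0)
    else if (r.modNat : ℕ) = 2 then 0 - P else P := by
  simp only [nodeCode_inj, ← arc_inj, ← arc_snd_eq_none_iff, ← arc_snd_eq_iff, zero_sub]
  rfl

theorem B_apply (I : CircInstance) (r : Fin I.rows) (a : Fin I.m) : I.B r a =
    let P : ℤ := if (below r.divNat : ℕ) = a then 1 else 0
    if (r.modNat : ℕ) < 2 then 0 else if (r.modNat : ℕ) = 2 then P else 0 - P := by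
  simp only [← arc_snd_eq_some_iff, zero_sub, Nat.lt_succ_iff]
  rfl

theorem b_apply (I : CircInstance) (r : Fin I.rows) : I.b r =
    let P : ℤ := if (below r.divNat : ℕ) = I.m then 1 else 0
    if (r.modNat : ℕ) < 2 then 0 else if (r.modNat : ℕ) = 2 then 0 - P else P := by
  simp only [← arc_snd_eq_none_iff, zero_sub, Nat.lt_succ_iff]
  rfl

theorem comp_rowBelow : Comp rowMeasure rowEnv fun p => .int (below p.2.divNat : ℕ) :=
  .vget (comp_row comp_belows) comp_rowArc

theorem comp_b : Comp measure input fun I => encodeVec I.b := by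
  have h0 := Comp.const bdd_rowEnv 0
  have hP := comp_rowBelow.natEqInd (comp_row comp_m)
  refine .vec bdd_rows comp_rows (Comp.cast (.intIte
    (comp_rowKind.natLtInd (.const bdd_rowEnv ((2 : ℕ) : ℤ))) h0
    (.intIte (comp_rowKind.natEqInd (.const bdd_rowEnv ((2 : ℕ) : ℤ))) (h0.sub hP) hP))
    fun p => ?_)
  rw [b_apply]

theorem comp_B : Comp measure input fun I => encodeMatrix I.B := by
  have hm : PolyBdd rowMeasure fun p => p.1.m := bdd_m.reindex Sigma.fst
  have hj := Comp.idx bdd_rowEnv hm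
  have h0 := Comp.const hj.bdd_left 0
  have h2 := Comp.const hj.bdd_left ((2 : ℕ) : ℤ)
  have hP := (comp_rowBelow.up hm).natEqInd hj
  refine .mat bdd_rows comp_rows bdd_m comp_m (Comp.cast (.intIte
    ((comp_rowKind.up hm).natLtInd h2) h0
    (.intIte ((comp_rowKind.up hm).natEqInd h2) hP (h0.sub hP))) fun p => ?_)
  rw [B_apply]

theorem comp_C : Comp measure input fun I => encodeMatrix I.C := by
  have hM : PolyBdd rowMeasure fun p => p.1.M := bdd_M.reindex Sigma.fst
  have hj := Comp.idx bdd_rowEnv hM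
  have h0 := Comp.const hj.bdd_left 0
  have h1 := Comp.const hj.bdd_left ((1 : ℕ) : ℤ)
  have h2 := Comp.const hj.bdd_left ((2 : ℕ) : ℤ)
  have hz := Comp.const hj.bdd_left ((0 : ℕ) : ℤ)
  have hr := comp_rowArc.up hM
  have hk := comp_rowKind.up hM
  have htail := ((comp_row comp_tails).up hM).vget hr
  have hP := Comp.intIte ((comp_rowBelow.up hM).natEqInd ((comp_row comp_m).up hM))
    (((comp_row comp_returns).up hM).vget hj)
    (Comp.natEqInd (((comp_row comp_belows).up hM).vget hj) (comp_rowBelow.up hM))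
  refine .mat bdd_rows comp_rows bdd_M comp_M (Comp.cast (.intIte (hk.natEqInd hz)
    (h0.sub (hj.natEqInd hr)) (.intIte (hk.natEqInd h1)
      ((Comp.natEqInd (((comp_row comp_tails).up hM).vget hj) htail).sub
        (Comp.natEqInd (((comp_row comp_heads).up hM).vget hj) htail))
      (.intIte (hk.natEqInd h2) (h0.sub hP) hP))) fun p => ?_)
  rw [C_apply]

theorem comp_output : Comp measure input fun I => encodeOutput I.B I.C I.b :=
  comp_B.pair (comp_C.pair (comp_b.pair (.nil bdd_input)))

theorem rows_le (I : CircInstance) : I.rows ≤ 8 * sizeBound I.Δ I.m I.n := by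
  have hΔ := Nat.pos_of_ne_zero I.Δ_ne_zero
  have hm := I.m_pos
  have h1 : I.rows ≤ I.N * I.Δ * I.Δ * (I.m + I.m) * 4 := by
    rw [rows, M, K_add_one]
    have := I.s_le
    gcongr
    omega
  refine h1.trans ?_
  rw [sizeBound_eq]
  have h2 : 1 ≤ I.Δ ^ (I.Δ - 1) := Nat.one_le_pow _ _ hΔ
  calc I.N * I.Δ * I.Δ * (I.m + I.m) * 4 = 8 * (1 * I.m * I.N * (I.Δ * I.Δ)) := by ring
    _ ≤ _ := by gcongr

theorem isExtendedFormulation (I : CircInstance) :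
    IsExtendedFormulation (circulationHull I.G I.H I.W I.f) (I.B.map (Int.cast : ℤ → ℝ))
      (I.C.map (Int.cast : ℤ → ℝ)) (fun i => (I.b i : ℝ)) := by
  rw [circulationHull_eq]
  exact isExtendedFormulation_unitFlows _ _ _ _ _

end CircInstance

theorem mainTheorem2 :
    ∃ (c : ℕ) (q : Polynomial ℕ) (P : CProg),
      ∀ (n m d : ℕ) (G : ArcDigraph (Fin n) (Fin m)) (H : Matrix (Fin d) (Fin d) ℤ)
        (W : Matrix (Fin d) (Fin m) ℤ) (f : Fin d → ℤ) (Δ : ℕ),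
        0 < m → Δ = H.det.natAbs → Δ ≠ 0 →
        ∃ (l k : ℕ) (B : Matrix (Fin l) (Fin m) ℤ) (C : Matrix (Fin l) (Fin k) ℤ)
          (b : Fin l → ℤ) (t : ℕ),
          IsExtendedFormulation (circulationHull G H W f)
            (B.map (Int.cast : ℤ → ℝ)) (C.map (Int.cast : ℤ → ℝ)) (fun i => (b i : ℝ)) ∧
          l ≤ c * sizeBound Δ m n ∧
          P.Runs (encodeInput G H W f) (encodeOutput B C b) t ∧
          t ≤ q.eval ((encodeInput G H W f).size + sizeBound Δ m n) := by
  obtain ⟨P, t, hP, q, hq⟩ := CircInstance.comp_output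
  refine ⟨8, q, P, fun n m d G H W f Δ hm hΔ h0 => ?_⟩
  subst hΔ
  let I : CircInstance := ⟨n, m, d, G, H, W, f, hm, Int.natAbs_ne_zero.1 h0⟩
  exact ⟨I.rows, I.M, I.B, I.C, I.b, t I, I.isExtendedFormulation, I.rows_le, hP I, hq I⟩
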